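/- Let a \emph{cyclic surface} be a surface $\Sigma\subset\mathbb R^3$ swept out by a smooth one-parameter family of circles, i.e. the image of a smooth immersion $$X(s,\theta)=\mathbf c(s)+r(s)\bigl(\cos\theta\,\mathbf e_1(s)+\sin\theta\,\mathbf e_2(s)\bigr),\qquad s\in I,\ \theta\in\mathbb R,$$ where $I\subset\mathbb R$ is a nonempty open interval, $\mathbf c,\mathbf e_1,\mathbf e_2\colon I\to\mathbb R^3$ and $r\colon I\to(0,\infty)$ are smooth, and $\mathbf e_1(s),\mathbf e_2(s)$ are orthonormal for each $s$. Let $\nu=(\nu_1,\nu_2,\nu_3)$ be the unit normal of $\Sigma$. For the Dirichlet energy $\int_\Sigma F(\nu)\,d\Sigma$, $F(\nu)=\frac1{\nu_3}-\nu_3$, the anisotropic mean curvature is $\Lambda=2HF(\nu)-\operatorname{div}_\Sigma(DF(\nu))$ at the points with $\nu_3\ne0$, where $H$ is the mean curvature and $DF$ the gradient of $F$ on the unit sphere. The cyclic surface $\Sigma$ is called \emph{anisotropic minimal} if $\nu_3\neq0$ on a dense set of points $(s,\theta)\in I\times\mathbb R$ and $\Lambda=0$ at all points with $\nu_3\ne0$.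 A set $\Sigma\subset\mathbb R^3$ is a cyclic anisotropic minimal surface if and only if it is one of the following. (1) A surface of revolution about an axis parallel to the $z$-axis, namely a cyclic surface contained in a horizontal plane $z=z_0$ or, after a translation of $\mathbb R^3$, the surface $z=c\log\sqrt{x^2+y^2}$ with $c\neq0$ and $\sqrt{x^2+y^2}\in J$, where $J\subset(0,\infty)$ is a nonempty open interval. (2) After a translation of $\mathbb R^3$, the surface parametrized by $$X(s,\theta)=(a(s),b(s),s)+r(s)(\cos\theta,\sin\theta,0),\qquad s\in J,\ \theta\in\mathbb R,$$ where, for some $c,\lambda,\mu\in\mathbb R$ with $c\ne0$ and $\lambda^2+\mu^2\neq0$, the functions $a,b,r$ are given by one of the following, and $J$ is a nonempty open interval on which the denominators do not vanish ($r$ may be negative on $J$; the circle then has radius $|r|$): Type I: $\ r=\dfrac{c}{\sqrt{\lambda^2+\mu^2}\cos(cs)},\quad a=\dfrac{c\lambda\tan(cs)}{\lambda^2+\mu^2},\quad b=\dfrac{c\mu\tan(cs)}{\lambda^2+\mu^2}$; Type II: $\ r=\dfrac{1}{\sqrt{\lambda^2+\mu^2}\,s+c},\quad a=-\dfrac{\lambda}{(\lambda^2+\mu^2)s+c\sqrt{\lambda^2+\mu^2}},\quad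 b=-\dfrac{\mu}{(\lambda^2+\mu^2)s+c\sqrt{\lambda^2+\mu^2}}$; Type III: $\ r=\dfrac{c}{\sqrt{\lambda^2+\mu^2}\sinh(cs)},\quad a=-\dfrac{c\lambda\coth(cs)}{\lambda^2+\mu^2},\quad b=-\dfrac{c\mu\coth(cs)}{\lambda^2+\mu^2}$. (3) (Trivial case.) A cyclic surface contained in a plane that is neither horizontal nor vertical. -/

import Mathlib

open scoped ContDiff RealInnerProductSpace

noncomputable section

namespace DirichletCyclic

/-- Euclidean space `ℝ³`; the coordinates `x, y, z` are `p 0, p 1, p 2`. -/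
abbrev E3 : Type := EuclideanSpace ℝ (Fin 3)

/-- The vector product of `ℝ³`. -/
def cross (u v : E3) : E3 :=
  !₂[u 1 * v 2 - u 2 * v 1, u 2 * v 0 - u 0 * v 2, u 0 * v 1 - u 1 * v 0]

/-! ### Anisotropic mean curvature of a parametrized surface -/

/-- Partial derivative in the first variable `s`. -/
def ds (X : ℝ → ℝ → E3) (s θ : ℝ) : E3 := deriv (fun t => X t θ) s

/-- Partial derivative in the second variable `θ`. -/
def dθ (X : ℝ → ℝ → E3) (s θ : ℝ) : E3 := deriv (fun t => X s t) θ

/-- The unit normal `ν = X_s × X_θ / |X_s × X_θ|`. -/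
def unitNormal (X : ℝ → ℝ → E3) (s θ : ℝ) : E3 :=
  ‖cross (ds X s θ) (dθ X s θ)‖⁻¹ • cross (ds X s θ) (dθ X s θ)

/-- Determinant of the first fundamental form. -/
def detG (X : ℝ → ℝ → E3) (s θ : ℝ) : ℝ :=
  ⟪ds X s θ, ds X s θ⟫ * ⟪dθ X s θ, dθ X s θ⟫ - ⟪ds X s θ, dθ X s θ⟫ ^ 2

/-- The trace `∑ g^{ij} β_{ij}` with respect to the first fundamental form, where
`β` has the entries `b₁₁, b₁₂, b₂₁, b₂₂` in the basis `X_s, X_θ`. -/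
def metricTrace (X : ℝ → ℝ → E3) (s θ b₁₁ b₁₂ b₂₁ b₂₂ : ℝ) : ℝ :=
  (⟪dθ X s θ, dθ X s θ⟫ * b₁₁ - ⟪ds X s θ, dθ X s θ⟫ * (b₁₂ + b₂₁)
    + ⟪ds X s θ, ds X s θ⟫ * b₂₂) / detG X s θ

/-- The mean curvature `H`: half the trace of the second fundamental form
`h(X_i, X_j) = ⟨ν, X_{ij}⟩`. -/
def meanCurvature (X : ℝ → ℝ → E3) (s θ : ℝ) : ℝ :=
  metricTrace X s θ
    ⟪unitNormal X s θ, ds (ds X) s θ⟫ ⟪unitNormal X s θ, ds (dθ X) s θ⟫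
    ⟪unitNormal X s θ, dθ (ds X) s θ⟫ ⟪unitNormal X s θ, dθ (dθ X) s θ⟫ / 2

/-- The surface divergence `div_Σ V = ∑ g^{ij} ⟨V_i, X_j⟩` of a vector field `V` along `X`. -/
def surfaceDiv (X V : ℝ → ℝ → E3) (s θ : ℝ) : ℝ :=
  metricTrace X s θ
    ⟪ds V s θ, ds X s θ⟫ ⟪ds V s θ, dθ X s θ⟫
    ⟪dθ V s θ, ds X s θ⟫ ⟪dθ V s θ, dθ X s θ⟫

/-- The gradient on the unit sphere, at `n`, of the restriction of `F` to the sphere. -/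
def sphereGradient (F : E3 → ℝ) (n : E3) : E3 :=
  gradient F n - ⟪gradient F n, n⟫ • n

/-- The anisotropic mean curvature `Λ = 2 H F(ν) - div_Σ (DF(ν))` for the energy `∫ F(ν) dΣ`. -/
def anisotropicMeanCurvature (F : E3 → ℝ) (X : ℝ → ℝ → E3) (s θ : ℝ) : ℝ :=
  2 * meanCurvature X s θ * F (unitNormal X s θ)
    - surfaceDiv X (fun s' θ' => sphereGradient F (unitNormal X s' θ')) s θ

/-- The integrand of the Dirichlet energy, `F(ν) = 1/ν₃ - ν₃`, meaningful for `ν₃ ≠ 0`. -/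
def dirichletIntegrand (n : E3) : ℝ := 1 / n 2 - n 2

/-! ### Cyclic surfaces -/

/-- `X(s,θ) = 𝐜(s) + r(s) (cos θ 𝐞₁(s) + sin θ 𝐞₂(s))`. -/
def circleFamily (center e₁ e₂ : ℝ → E3) (r : ℝ → ℝ) (s θ : ℝ) : E3 :=
  center s + r s • (Real.cos θ • e₁ s + Real.sin θ • e₂ s)

/-- A nonempty open interval of `ℝ` (possibly unbounded). -/
def IsOpenInterval (I : Set ℝ) : Prop := IsOpen I ∧ I.OrdConnected ∧ I.Nonempty

/-- A cyclic surface: a surface immersed in `ℝ³` that is swept out by a smooth one-parameter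
family of circles. The circle of parameter `s` has centre `center s` and radius `radius s`, and
lies in the plane through its centre spanned by the orthonormal vectors `e₁ s`, `e₂ s`. -/
structure CyclicSurface where
  I : Set ℝ
  center : ℝ → E3
  radius : ℝ → ℝ
  e₁ : ℝ → E3
  e₂ : ℝ → E3
  interval : IsOpenInterval I
  center_smooth : ContDiffOn ℝ ∞ center I
  radius_smooth : ContDiffOn ℝ ∞ radius I
  e₁_smooth : ContDiffOn ℝ ∞ e₁ I
  e₂_smooth : ContDiffOn ℝ ∞ e₂ I
  radius_pos : ∀ s ∈ I, 0 < radius s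
  orthonormal : ∀ s ∈ I, Orthonormal ℝ ![e₁ s, e₂ s]
  immersion : ∀ s ∈ I, ∀ θ : ℝ,
    LinearIndependent ℝ ![ds (circleFamily center e₁ e₂ radius) s θ,
      dθ (circleFamily center e₁ e₂ radius) s θ]

namespace CyclicSurface

/-- The parametrization of the surface by `I × ℝ`. -/
def X (C : CyclicSurface) : ℝ → ℝ → E3 := circleFamily C.center C.e₁ C.e₂ C.radius

/-- The point set of the surface. -/
def carrier (C : CyclicSurface) : Set E3 := {p | ∃ s ∈ C.I, ∃ θ : ℝ, p = C.X s θ}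

/-- The parameters at which `ν₃ ≠ 0`, i.e. at which the Dirichlet integrand is defined. -/
def regular (C : CyclicSurface) : Set (ℝ × ℝ) :=
  {q | q.1 ∈ C.I ∧ unitNormal C.X q.1 q.2 2 ≠ 0}

/-- Anisotropic minimal surface of the Dirichlet energy: `ν₃ ≠ 0` on a dense set of parameters,
and the anisotropic mean curvature vanishes wherever `ν₃ ≠ 0`. -/
def IsAnisotropicMinimal (C : CyclicSurface) : Prop :=
  C.I ×ˢ Set.univ ⊆ closure C.regular ∧
    ∀ q ∈ C.regular, anisotropicMeanCurvature dirichletIntegrand C.X q.1 q.2 = 0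

end CyclicSurface

/-- `S` is (the point set of) a cyclic surface. -/
def IsCyclic (S : Set E3) : Prop := ∃ C : CyclicSurface, C.carrier = S

/-- `S` is (the point set of) a cyclic anisotropic minimal surface of the Dirichlet energy. -/
def IsCyclicAnisotropicMinimal (S : Set E3) : Prop :=
  ∃ C : CyclicSurface, C.IsAnisotropicMinimal ∧ C.carrier = S

/-! ### The surfaces of the classification -/

/-- The surface obtained by rotating the curve `z = u(ρ)`, `ρ ∈ J`, about the `z`-axis and then
translating by `v`. -/
def revolution (v : E3) (J : Set ℝ) (u : ℝ → ℝ) : Set E3 :=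
  {p | ∃ ρ ∈ J, ∃ θ : ℝ, p = v + !₂[ρ * Real.cos θ, ρ * Real.sin θ, u ρ]}

/-- The translate by `v` of the surface parametrized by
`X(s,θ) = (a(s), b(s), s) + r(s) (cos θ, sin θ, 0)`, `s ∈ J`. -/
def horizontalCircles (v : E3) (J : Set ℝ) (a b r : ℝ → ℝ) : Set E3 :=
  {p | ∃ s ∈ J, ∃ θ : ℝ,
    p = v + (!₂[a s, b s, s] + r s • !₂[Real.cos θ, Real.sin θ, 0])}

/-- `S` is a part, swept out by circles, of a horizontal plane. -/
def IsHorizontalPlanePiece (S : Set E3) : Prop :=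
  IsCyclic S ∧ ∃ z₀ : ℝ, ∀ p ∈ S, p 2 = z₀

/-- `S` is a part, swept out by circles, of a plane that is neither horizontal nor vertical. -/
def IsInclinedPlanePiece (S : Set E3) : Prop :=
  IsCyclic S ∧ ∃ A B z₀ : ℝ, (A, B) ≠ (0, 0) ∧ ∀ p ∈ S, p 2 = A * p 0 + B * p 1 + z₀

/-- After a translation, `S` is the surface of revolution `z = c log √(x² + y²)`, `c ≠ 0`, over
an open interval of radii. -/
def IsLogarithmicRevolution (S : Set E3) : Prop :=
  ∃ c : ℝ, c ≠ 0 ∧ ∃ J : Set ℝ, IsOpenInterval J ∧ J ⊆ Set.Ioi 0 ∧ ∃ v : E3,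
    S = revolution v J (fun ρ => c * Real.log ρ)

/-- Type I. -/
def IsTypeI (S : Set E3) : Prop :=
  ∃ c l m : ℝ, c ≠ 0 ∧ l ^ 2 + m ^ 2 ≠ 0 ∧ ∃ J : Set ℝ, IsOpenInterval J ∧
    (∀ s ∈ J, Real.cos (c * s) ≠ 0) ∧ ∃ v : E3,
    S = horizontalCircles v J
      (fun s => c * l * Real.tan (c * s) / (l ^ 2 + m ^ 2))
      (fun s => c * m * Real.tan (c * s) / (l ^ 2 + m ^ 2))
      (fun s => c / (Real.sqrt (l ^ 2 + m ^ 2) * Real.cos (c * s)))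

/-- Type II. -/
def IsTypeII (S : Set E3) : Prop :=
  ∃ c l m : ℝ, c ≠ 0 ∧ l ^ 2 + m ^ 2 ≠ 0 ∧ ∃ J : Set ℝ, IsOpenInterval J ∧
    (∀ s ∈ J, Real.sqrt (l ^ 2 + m ^ 2) * s + c ≠ 0) ∧ ∃ v : E3,
    S = horizontalCircles v J
      (fun s => -(l / ((l ^ 2 + m ^ 2) * s + c * Real.sqrt (l ^ 2 + m ^ 2))))
      (fun s => -(m / ((l ^ 2 + m ^ 2) * s + c * Real.sqrt (l ^ 2 + m ^ 2))))
      (fun s => 1 / (Real.sqrt (l ^ 2 + m ^ 2) * s + c))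

/-- Type III; here `coth = cosh / sinh`. -/
def IsTypeIII (S : Set E3) : Prop :=
  ∃ c l m : ℝ, c ≠ 0 ∧ l ^ 2 + m ^ 2 ≠ 0 ∧ ∃ J : Set ℝ, IsOpenInterval J ∧
    (∀ s ∈ J, Real.sinh (c * s) ≠ 0) ∧ ∃ v : E3,
    S = horizontalCircles v J
      (fun s => -(c * l * (Real.cosh (c * s) / Real.sinh (c * s)) / (l ^ 2 + m ^ 2)))
      (fun s => -(c * m * (Real.cosh (c * s) / Real.sinh (c * s)) / (l ^ 2 + m ^ 2)))
      (fun s => c / (Real.sqrt (l ^ 2 + m ^ 2) * Real.sinh (c * s)))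

end DirichletCyclic

end

/-!
Where `ν₃ ≠ 0`, the anisotropic mean curvature is a nonzero multiple of the Laplacian of the height
as a function of `(x, y)`, so an anisotropic minimal surface is locally the graph of a harmonic
function. On each circle the harmonicity condition is a trigonometric polynomial in `θ`. Write
`E_i = r e_i` and let `M = E₁ - i E₂`, an isotropic vector of `ℂ³`. The coefficient of degree `5` is
a multiple of `M₃² det(M', M, M'')`, and isotropy gives `M' × M = σ M` and makes the determinant a
multiple of `σ³`. Hence the planes of the circles do not turn as long as they are not horizontal,
and therefore they are all parallel.

If the planes are not horizontal, the coefficients of degrees `3` and `2` leave only a vertical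
translation of a circle, for which `ν₃ = 0`, and circles in a single inclined plane. If they are
horizontal, the coefficients of degree `1` say that the centre `(a, b, z)` satisfies
`a' = λ z' r²` and `b' = μ z' r²`, and the constant one that `y = 1 / r`, as a function of `z`,
satisfies `y'' = κ y` and `y'² - κ y² = λ² + μ²`. The sign of `κ` separates the three types,
`λ = μ = 0` gives the logarithmic surface, and uniqueness for linear differential equations shows
that `z'` vanishes everywhere or nowhere.
-/

namespace DirichletCyclic

/-! ### Coordinates -/

theorem inner_coord (u v : E3) : ⟪u, v⟫ = u 0 * v 0 + u 1 * v 1 + u 2 * v 2 := by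
  simp [PiLp.inner_apply, Fin.sum_univ_three, mul_comm]

theorem norm_sq_coord (u : E3) : ‖u‖ ^ 2 = u 0 ^ 2 + u 1 ^ 2 + u 2 ^ 2 := by
  rw [← real_inner_self_eq_norm_sq, inner_coord]; ring

theorem E3.ext_coord {u v : E3} (h₀ : u 0 = v 0) (h₁ : u 1 = v 1) (h₂ : u 2 = v 2) : u = v := by
  ext i; fin_cases i <;> assumption

@[simp] theorem cross_zero (u v : E3) : cross u v 0 = u 1 * v 2 - u 2 * v 1 := rfl
@[simp] theorem cross_one (u v : E3) : cross u v 1 = u 2 * v 0 - u 0 * v 2 := rfl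
@[simp] theorem cross_two (u v : E3) : cross u v 2 = u 0 * v 1 - u 1 * v 0 := rfl

theorem inner_cross_left (u v : E3) : ⟪cross u v, u⟫ = 0 := by
  simp only [inner_coord, cross_zero, cross_one, cross_two]; ring

theorem inner_cross_right (u v : E3) : ⟪cross u v, v⟫ = 0 := by
  simp only [inner_coord, cross_zero, cross_one, cross_two]; ring

theorem norm_cross_sq (u v : E3) : ‖cross u v‖ ^ 2 = ⟪u, u⟫ * ⟪v, v⟫ - ⟪u, v⟫ ^ 2 := by
  simp only [norm_sq_coord, inner_coord, cross_zero, cross_one, cross_two]; ring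

theorem cross_cross_left (u v : E3) : cross (cross u v) u = ⟪u, u⟫ • v - ⟪u, v⟫ • u := by
  apply E3.ext_coord <;> simp [inner_coord, norm_sq_coord] <;> ring

theorem cross_cross_right (u v : E3) : cross v (cross u v) = ⟪v, v⟫ • u - ⟪u, v⟫ • v := by
  apply E3.ext_coord <;> simp [inner_coord, norm_sq_coord] <;> ring

theorem norm_cross_sq_smul (u v w : E3) :
    ‖cross u v‖ ^ 2 • w = ⟪w, u⟫ • cross v (cross u v) + ⟪w, v⟫ • cross (cross u v) u
      + ⟪w, cross u v⟫ • cross u v := by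
  apply E3.ext_coord <;> simp [inner_coord, norm_sq_coord] <;> ring

theorem hasDerivAt_coord {f : ℝ → E3} {f' : E3} {t : ℝ} (hf : HasDerivAt f f' t) (i : Fin 3) :
    HasDerivAt (fun τ => f τ i) (f' i) t :=
  ((EuclideanSpace.proj i : E3 →L[ℝ] ℝ).hasFDerivAt (x := f t)).comp_hasDerivAt t hf

theorem hasDerivAt_of_coord {f : ℝ → E3} {f' : E3} {t : ℝ}
    (hf : ∀ i, HasDerivAt (fun τ => f τ i) (f' i) t) : HasDerivAt f f' t := by
  rw [hasDerivAt_iff_hasFDerivAt, ← hasFDerivWithinAt_univ, hasFDerivWithinAt_euclidean]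
  intro i
  exact ((hf i).hasFDerivAt.congr_fderiv (by ext; simp)).hasFDerivWithinAt

theorem hasDerivAt_cross {f g : ℝ → E3} {f' g' : E3} {t : ℝ} (hf : HasDerivAt f f' t)
    (hg : HasDerivAt g g' t) :
    HasDerivAt (fun τ => cross (f τ) (g τ)) (cross f' (g t) + cross (f t) g') t := by
  have f_coord := hasDerivAt_coord hf
  have g_coord := hasDerivAt_coord hg
  refine hasDerivAt_of_coord fun i => ?_
  fin_cases i
  · exact (((f_coord 1).mul (g_coord 2)).sub ((f_coord 2).mul (g_coord 1))).congr_deriv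
      (by simp; ring)
  · exact (((f_coord 2).mul (g_coord 0)).sub ((f_coord 0).mul (g_coord 2))).congr_deriv
      (by simp; ring)
  · exact (((f_coord 0).mul (g_coord 1)).sub ((f_coord 1).mul (g_coord 0))).congr_deriv
      (by simp; ring)

/-! ### The anisotropic mean curvature as a Laplacian of the height -/

theorem inner_left_eq_neg_of_hasDerivAt {E : Type*} [NormedAddCommGroup E]
    [InnerProductSpace ℝ E] {f g : ℝ → E} {f' g' : E} {t k : ℝ} (hf : HasDerivAt f f' t)
    (hg : HasDerivAt g g' t) (h : ∀ᶠ τ in nhds t, ⟪f τ, g τ⟫ = k) : ⟪f', g t⟫ = -⟪f t, g'⟫ := by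
  have := ((hf.inner ℝ hg).congr_of_eventuallyEq (h.mono fun _ => Eq.symm)).unique
    (hasDerivAt_const t k)
  linarith

/-- The unit vector in the direction of `u × v`; it is `0` if `u` and `v` are parallel. -/
noncomputable def unitCross (u v : E3) : E3 := ‖cross u v‖⁻¹ • cross u v

theorem inner_unitCross (u v w : E3) : ⟪unitCross u v, w⟫ = ‖cross u v‖⁻¹ * ⟪cross u v, w⟫ :=
  real_inner_smul_left _ _ _

theorem inner_unitCross_left (u v : E3) : ⟪unitCross u v, u⟫ = 0 := by
  rw [inner_unitCross, inner_cross_left, mul_zero]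

theorem inner_unitCross_right (u v : E3) : ⟪unitCross u v, v⟫ = 0 := by
  rw [inner_unitCross, inner_cross_right, mul_zero]

theorem inner_unitCross_self {u v : E3} (h : cross u v ≠ 0) :
    ⟪unitCross u v, unitCross u v⟫ = 1 := by
  rw [real_inner_self_eq_norm_sq, unitCross,
    show ‖‖cross u v‖⁻¹ • cross u v‖ = 1 from norm_smul_inv_norm (𝕜 := ℝ) h, one_pow]

theorem cross_ne_zero_of_unitCross_two_ne_zero {u v : E3} (h : unitCross u v 2 ≠ 0) :
    cross u v ≠ 0 := fun h₀ => h (by simp [unitCross, h₀])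

section

variable {A B : ℝ → E3} {A' B' ν' : E3} {t : ℝ}

theorem differentiableAt_unitCross (hA : HasDerivAt A A' t) (hB : HasDerivAt B B' t)
    (h₀ : cross (A t) (B t) ≠ 0) : DifferentiableAt ℝ (fun τ => unitCross (A τ) (B τ)) t :=
  have hN := (hasDerivAt_cross hA hB).differentiableAt
  ((hN.norm ℝ h₀).inv (norm_ne_zero_iff.2 h₀)).smul hN

theorem norm_cross_sq_mul_unitCross_vertical (hA : HasDerivAt A A' t) (hB : HasDerivAt B B' t)
    (h₀ : cross (A t) (B t) ≠ 0) (hν : HasDerivAt (fun τ => unitCross (A τ) (B τ)) ν' t) :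
    ‖cross (A t) (B t)‖ ^ 2 * ν' 2 =
      -(⟪unitCross (A t) (B t), A'⟫ * cross (B t) (cross (A t) (B t)) 2
        + ⟪unitCross (A t) (B t), B'⟫ * cross (cross (A t) (B t)) (A t) 2) := by
  have hνA := inner_left_eq_neg_of_hasDerivAt hν hA (.of_forall fun τ => inner_unitCross_left _ _)
  have hνB := inner_left_eq_neg_of_hasDerivAt hν hB (.of_forall fun τ => inner_unitCross_right _ _)
  have hνν := inner_left_eq_neg_of_hasDerivAt hν hν
    (((hasDerivAt_cross hA hB).continuousAt.eventually_ne h₀).mono fun _ => inner_unitCross_self)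
  have hνN : ⟪ν', cross (A t) (B t)⟫ = 0 := by
    have : ⟪ν', unitCross (A t) (B t)⟫ = 0 := by
      rw [real_inner_comm] at hνν ⊢; linarith
    simpa [unitCross, real_inner_smul_right, h₀] using this
  have dual := congrArg (fun u : E3 => u 2) (norm_cross_sq_smul (A t) (B t) ν')
  simp only [hνA, hνB, hνN, PiLp.smul_apply, PiLp.add_apply, smul_eq_mul] at dual
  linarith

end

theorem gradient_dirichletIntegrand {n : E3} (hn : n 2 ≠ 0) :
    gradient dirichletIntegrand n = !₂[0, 0, -(1 / n 2 ^ 2 + 1)] := by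
  apply HasGradientAt.gradient
  rw [hasGradientAt_iff_hasFDerivAt]
  have profile : HasDerivAt (fun x : ℝ => 1 / x - x) (-(1 / n 2 ^ 2 + 1)) (n 2) := by
    simp only [one_div]
    exact ((hasDerivAt_inv hn).sub (hasDerivAt_id (n 2))).congr_deriv (by ring)
  have composed := HasDerivAt.comp_hasFDerivAt (h₂ := fun x : ℝ => 1 / x - x)
    (f := fun m : E3 => m 2) n profile
    ((EuclideanSpace.proj 2 : E3 →L[ℝ] ℝ).hasFDerivAt (x := n))
  refine HasFDerivAt.congr_fderiv (f := dirichletIntegrand) composed ?_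
  ext v
  simp [inner_coord]

theorem sphereGradient_dirichletIntegrand {n : E3} (hn : n 2 ≠ 0) :
    sphereGradient dirichletIntegrand n =
      (1 / n 2 + n 2) • n - (1 / n 2 ^ 2 + 1) • !₂[0, 0, 1] := by
  rw [sphereGradient, gradient_dirichletIntegrand hn]
  apply E3.ext_coord <;> simp [inner_coord] <;> field_simp
  all_goals ring

theorem inner_deriv_sphereGradient_dirichletIntegrand {ν : ℝ → E3} {ν' u : E3} {t : ℝ}
    (hν : HasDerivAt ν ν' t) (h₂ : ν t 2 ≠ 0) (hu : ⟪ν t, u⟫ = 0) :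
    ⟪deriv (fun τ => sphereGradient dirichletIntegrand (ν τ)) t, u⟫ =
      (1 / ν t 2 + ν t 2) * ⟪ν', u⟫ + 2 / ν t 2 ^ 3 * ν' 2 * u 2 := by
  have hν₂ := hasDerivAt_coord hν 2
  have formula : (fun τ => sphereGradient dirichletIntegrand (ν τ)) =ᶠ[nhds t] fun τ =>
      ((ν τ 2)⁻¹ + ν τ 2) • ν τ - ((ν τ 2 ^ 2)⁻¹ + 1) • !₂[0, 0, 1] := by
    filter_upwards [hν₂.continuousAt.eventually_ne h₂] with τ hτ
    simpa only [one_div] using sphereGradient_dirichletIntegrand hτ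
  have derivative := ((((hν₂.fun_inv h₂).fun_add hν₂).fun_smul hν).fun_sub
    ((((hν₂.fun_pow 2).fun_inv (pow_ne_zero 2 h₂)).add_const 1).smul_const
      (!₂[0, 0, 1] : E3))).congr_of_eventuallyEq formula
  have inner_vertical : ⟪(!₂[0, 0, 1] : E3), u⟫ = u 2 := by simp [inner_coord]
  rw [derivative.deriv]
  simp only [inner_sub_left, inner_add_left, real_inner_smul_left, hu, inner_vertical]
  field_simp
  ring

theorem inner_deriv_sphereGradient_unitCross {A B U : ℝ → E3} {A' B' U' : E3} {t : ℝ}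
    (hA : HasDerivAt A A' t) (hB : HasDerivAt B B' t) (hU : HasDerivAt U U' t)
    (tangent : ∀ τ, ⟪unitCross (A τ) (B τ), U τ⟫ = 0) (h₂ : unitCross (A t) (B t) 2 ≠ 0) :
    ⟪deriv (fun τ => sphereGradient dirichletIntegrand (unitCross (A τ) (B τ))) t, U t⟫ =
      -(1 / unitCross (A t) (B t) 2 + unitCross (A t) (B t) 2) * ⟪unitCross (A t) (B t), U'⟫
      - 2 / unitCross (A t) (B t) 2 ^ 3 *
        ((⟪unitCross (A t) (B t), A'⟫ * cross (B t) (cross (A t) (B t)) 2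
          + ⟪unitCross (A t) (B t), B'⟫ * cross (cross (A t) (B t)) (A t) 2)
          / ‖cross (A t) (B t)‖ ^ 2) * U t 2 := by
  have h₀ := cross_ne_zero_of_unitCross_two_ne_zero h₂
  have hν := (differentiableAt_unitCross hA hB h₀).hasDerivAt
  have vertical := norm_cross_sq_mul_unitCross_vertical hA hB h₀ hν
  rw [mul_comm, ← eq_div_iff (pow_ne_zero 2 (norm_ne_zero_iff.2 h₀))] at vertical
  rw [inner_deriv_sphereGradient_dirichletIntegrand hν h₂ (tangent t),
    inner_left_eq_neg_of_hasDerivAt hν hU (.of_forall tangent), vertical]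
  ring

/-- The Euclidean product of the horizontal parts of two vectors. -/
noncomputable def horizontalInner (u v : E3) : ℝ := u 0 * v 0 + u 1 * v 1

section

variable (A B : E3)

theorem norm_cross_sq_mul_horizontalInner_left :
    ‖cross A B‖ ^ 2 * horizontalInner A A =
      cross A B 2 ^ 2 * ⟪A, A⟫ + cross (cross A B) A 2 ^ 2 := by
  simp only [norm_sq_coord, inner_coord, horizontalInner, cross_zero, cross_one, cross_two]; ring

theorem norm_cross_sq_mul_horizontalInner :
    ‖cross A B‖ ^ 2 * horizontalInner A B =
      cross A B 2 ^ 2 * ⟪A, B⟫ - cross B (cross A B) 2 * cross (cross A B) A 2 := by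
  simp only [norm_sq_coord, inner_coord, horizontalInner, cross_zero, cross_one, cross_two]; ring

theorem norm_cross_sq_mul_horizontalInner_right :
    ‖cross A B‖ ^ 2 * horizontalInner B B =
      cross A B 2 ^ 2 * ⟪B, B⟫ + cross B (cross A B) 2 ^ 2 := by
  simp only [norm_sq_coord, inner_coord, horizontalInner, cross_zero, cross_one, cross_two]; ring

end

/-- Up to a nonzero factor, the Laplacian of the height `z` as a function of `(x, y)`, for a
surface with first derivatives `A = X_s`, `B = X_θ` and second derivatives `Ass = (X_s)_s`,
`Ast = (X_θ)_s`, `Ats = (X_s)_θ`, `Att = (X_θ)_θ`. -/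
noncomputable def heightLaplacian (A B Ass Ast Ats Att : E3) : ℝ :=
  horizontalInner B B * ⟪cross A B, Ass⟫
    - horizontalInner A B * (⟪cross A B, Ast⟫ + ⟪cross A B, Ats⟫)
    + horizontalInner A A * ⟪cross A B, Att⟫

theorem heightLaplacian_eq {A B : E3} (h₀ : cross A B ≠ 0) (Ass Ast Ats Att : E3) :
    heightLaplacian A B Ass Ast Ats Att =
      ((cross A B 2 ^ 2 * ⟪B, B⟫ + cross B (cross A B) 2 ^ 2) * ⟪cross A B, Ass⟫
        - (cross A B 2 ^ 2 * ⟪A, B⟫ - cross B (cross A B) 2 * cross (cross A B) A 2)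
          * (⟪cross A B, Ast⟫ + ⟪cross A B, Ats⟫)
        + (cross A B 2 ^ 2 * ⟪A, A⟫ + cross (cross A B) A 2 ^ 2) * ⟪cross A B, Att⟫)
        / ‖cross A B‖ ^ 2 := by
  rw [eq_div_iff (pow_ne_zero 2 (norm_ne_zero_iff.2 h₀)), heightLaplacian,
    ← norm_cross_sq_mul_horizontalInner_left, ← norm_cross_sq_mul_horizontalInner,
    ← norm_cross_sq_mul_horizontalInner_right]
  ring

section

variable {X : ℝ → ℝ → E3} {s θ : ℝ} {Ass Ast Ats Att : E3}

theorem detG_eq_norm_cross_sq : detG X s θ = ‖cross (ds X s θ) (dθ X s θ)‖ ^ 2 :=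
  (norm_cross_sq _ _).symm

theorem meanCurvature_eq (hss : HasDerivAt (fun t => ds X t θ) Ass s)
    (hst : HasDerivAt (fun t => dθ X t θ) Ast s) (hts : HasDerivAt (fun t => ds X s t) Ats θ)
    (htt : HasDerivAt (fun t => dθ X s t) Att θ) :
    meanCurvature X s θ =
      (⟪dθ X s θ, dθ X s θ⟫ * ⟪cross (ds X s θ) (dθ X s θ), Ass⟫
        - ⟪ds X s θ, dθ X s θ⟫ *
          (⟪cross (ds X s θ) (dθ X s θ), Ast⟫ + ⟪cross (ds X s θ) (dθ X s θ), Ats⟫)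
        + ⟪ds X s θ, ds X s θ⟫ * ⟪cross (ds X s θ) (dθ X s θ), Att⟫)
        / (2 * ‖cross (ds X s θ) (dθ X s θ)‖ ^ 3) := by
  have hν : unitNormal X s θ = unitCross (ds X s θ) (dθ X s θ) := rfl
  have ess : ds (ds X) s θ = Ass := hss.deriv
  have est : ds (dθ X) s θ = Ast := hst.deriv
  have ets : dθ (ds X) s θ = Ats := hts.deriv
  have ett : dθ (dθ X) s θ = Att := htt.deriv
  simp only [meanCurvature, metricTrace, detG_eq_norm_cross_sq, hν, inner_unitCross, ess, est, ets,
    ett]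
  field_simp

theorem surfaceDiv_sphereGradient_dirichletIntegrand
    (hss : HasDerivAt (fun t => ds X t θ) Ass s) (hst : HasDerivAt (fun t => dθ X t θ) Ast s)
    (hts : HasDerivAt (fun t => ds X s t) Ats θ) (htt : HasDerivAt (fun t => dθ X s t) Att θ)
    (h₂ : unitNormal X s θ 2 ≠ 0) :
    surfaceDiv X (fun s' θ' => sphereGradient dirichletIntegrand (unitNormal X s' θ')) s θ =
      -(1 / unitNormal X s θ 2 + unitNormal X s θ 2) * (2 * meanCurvature X s θ)
      - 2 / unitNormal X s θ 2 ^ 3 *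
        ((cross (dθ X s θ) (cross (ds X s θ) (dθ X s θ)) 2 ^ 2
              * ⟪cross (ds X s θ) (dθ X s θ), Ass⟫
            + cross (dθ X s θ) (cross (ds X s θ) (dθ X s θ)) 2
              * cross (cross (ds X s θ) (dθ X s θ)) (ds X s θ) 2
              * (⟪cross (ds X s θ) (dθ X s θ), Ast⟫ + ⟪cross (ds X s θ) (dθ X s θ), Ats⟫)
            + cross (cross (ds X s θ) (dθ X s θ)) (ds X s θ) 2 ^ 2
              * ⟪cross (ds X s θ) (dθ X s θ), Att⟫)
          / ‖cross (ds X s θ) (dθ X s θ)‖ ^ 5) := by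
  have derivative_s : ds (fun s' θ' => sphereGradient dirichletIntegrand (unitNormal X s' θ')) s θ =
    deriv (fun t => sphereGradient dirichletIntegrand (unitCross (ds X t θ) (dθ X t θ))) s := rfl
  have derivative_θ : dθ (fun s' θ' => sphereGradient dirichletIntegrand (unitNormal X s' θ')) s θ =
    deriv (fun t => sphereGradient dirichletIntegrand (unitCross (ds X s t) (dθ X s t))) θ := rfl
  have hν : unitNormal X s θ = unitCross (ds X s θ) (dθ X s θ) := rfl
  have cross_left := congrArg (fun u : E3 => u 2) (cross_cross_left (ds X s θ) (dθ X s θ))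
  have cross_right := congrArg (fun u : E3 => u 2) (cross_cross_right (ds X s θ) (dθ X s θ))
  simp only [PiLp.sub_apply, PiLp.smul_apply, smul_eq_mul] at cross_left cross_right
  rw [surfaceDiv, metricTrace, detG_eq_norm_cross_sq, derivative_s, derivative_θ,
    inner_deriv_sphereGradient_unitCross hss hst hss (fun _ => inner_unitCross_left _ _) h₂,
    inner_deriv_sphereGradient_unitCross hss hst hst (fun _ => inner_unitCross_right _ _) h₂,
    inner_deriv_sphereGradient_unitCross hts htt hts (fun _ => inner_unitCross_left _ _) h₂,
    inner_deriv_sphereGradient_unitCross hts htt htt (fun _ => inner_unitCross_right _ _) h₂,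
    meanCurvature_eq hss hst hts htt, hν]
  simp only [inner_unitCross, cross_left, cross_right]
  rw [hν] at h₂
  have hN := norm_ne_zero_iff.2 (cross_ne_zero_of_unitCross_two_ne_zero h₂)
  field_simp
  ring

theorem anisotropicMeanCurvature_dirichletIntegrand
    (hss : HasDerivAt (fun t => ds X t θ) Ass s) (hst : HasDerivAt (fun t => dθ X t θ) Ast s)
    (hts : HasDerivAt (fun t => ds X s t) Ats θ) (htt : HasDerivAt (fun t => dθ X s t) Att θ)
    (h₂ : unitNormal X s θ 2 ≠ 0) :
    anisotropicMeanCurvature dirichletIntegrand X s θ = 2 / cross (ds X s θ) (dθ X s θ) 2 ^ 3 *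
      heightLaplacian (ds X s θ) (dθ X s θ) Ass Ast Ats Att := by
  have h₀ : cross (ds X s θ) (dθ X s θ) ≠ 0 := cross_ne_zero_of_unitCross_two_ne_zero h₂
  have hN := norm_ne_zero_iff.2 h₀
  have hN₂ : cross (ds X s θ) (dθ X s θ) 2 ≠ 0 := fun h => h₂ (by simp [unitNormal, h])
  have hν₂ : unitNormal X s θ 2 =
    ‖cross (ds X s θ) (dθ X s θ)‖⁻¹ * cross (ds X s θ) (dθ X s θ) 2 := rfl
  rw [anisotropicMeanCurvature, surfaceDiv_sphereGradient_dirichletIntegrand hss hst hts htt h₂,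
    meanCurvature_eq hss hst hts htt, dirichletIntegrand, heightLaplacian_eq h₀, hν₂]
  generalize cross (cross (ds X s θ) (dθ X s θ)) (ds X s θ) 2 = p
  generalize cross (dθ X s θ) (cross (ds X s θ) (dθ X s θ)) 2 = q
  generalize cross (ds X s θ) (dθ X s θ) 2 = n at *
  field_simp
  ring

end

/-! ### Trigonometric polynomials -/

open Polynomial in
/-- `f` is a trigonometric polynomial of degree at most `n`, with coefficient `L` at `e^{inθ}`;
it is encoded by the polynomial `q` of degree at most `2n` with `e^{inθ} f(θ) = q(e^{iθ})`. -/
def HasTopFourierCoeff (n : ℕ) (f : ℝ → ℝ) (L : ℂ) : Prop :=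
  ∃ q : ℂ[X], q.natDegree ≤ 2 * n ∧ q.coeff (2 * n) = L ∧
    ∀ θ : ℝ, Complex.exp (θ * Complex.I) ^ n * (f θ : ℂ) = q.eval (Complex.exp (θ * Complex.I))

namespace HasTopFourierCoeff

variable {n m : ℕ} {f g : ℝ → ℝ} {L M : ℂ}

theorem add (hf : HasTopFourierCoeff n f L) (hg : HasTopFourierCoeff n g M) :
    HasTopFourierCoeff n (fun θ => f θ + g θ) (L + M) := by
  obtain ⟨p, p_degree, p_coeff, p_eval⟩ := hf
  obtain ⟨q, q_degree, q_coeff, q_eval⟩ := hg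
  refine ⟨p + q, (Polynomial.natDegree_add_le _ _).trans (max_le p_degree q_degree),
    by simp [p_coeff, q_coeff], fun θ => ?_⟩
  rw [Polynomial.eval_add, ← p_eval, ← q_eval]; push_cast; ring

theorem mul (hf : HasTopFourierCoeff n f L) (hg : HasTopFourierCoeff m g M) :
    HasTopFourierCoeff (n + m) (fun θ => f θ * g θ) (L * M) := by
  obtain ⟨p, p_degree, p_coeff, p_eval⟩ := hf
  obtain ⟨q, q_degree, q_coeff, q_eval⟩ := hg
  refine ⟨p * q, Polynomial.natDegree_mul_le.trans (by omega), ?_, fun θ => ?_⟩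
  · rw [mul_add, Polynomial.coeff_mul_add_eq_of_natDegree_le p_degree q_degree, p_coeff, q_coeff]
  · rw [Polynomial.eval_mul, ← p_eval, ← q_eval]; push_cast; ring

theorem const (a : ℝ) : HasTopFourierCoeff 0 (fun _ => a) a :=
  ⟨Polynomial.C (a : ℂ), by simp, by simp, by simp⟩

theorem neg (hf : HasTopFourierCoeff n f L) : HasTopFourierCoeff n (fun θ => -f θ) (-L) := by
  simpa using (const (-1)).mul hf

theorem sub (hf : HasTopFourierCoeff n f L) (hg : HasTopFourierCoeff n g M) :
    HasTopFourierCoeff n (fun θ => f θ - g θ) (L - M) := by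
  simpa [sub_eq_add_neg] using hf.add hg.neg

theorem linear (a b c : ℝ) :
    HasTopFourierCoeff 1 (fun θ => a + (b * Real.cos θ + c * Real.sin θ))
      ((b - c * Complex.I) / 2) := by
  refine ⟨Polynomial.C ((b - c * Complex.I) / 2) * Polynomial.X ^ 2
    + Polynomial.C (a : ℂ) * Polynomial.X + Polynomial.C ((b + c * Complex.I) / 2),
    Polynomial.natDegree_quadratic_le, by simp, fun θ => ?_⟩
  simp only [Polynomial.eval_add, Polynomial.eval_mul, Polynomial.eval_C, Polynomial.eval_pow,
    Polynomial.eval_X, pow_one, Complex.exp_mul_I]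
  push_cast
  linear_combination ((b + c * Complex.I) / 2) * Complex.sin_sq_add_cos_sq (θ : ℂ) +
    (-b * Complex.sin θ ^ 2 / 2 + c * Complex.cos θ * Complex.sin θ +
      c * Complex.I * Complex.sin θ ^ 2 / 2) * Complex.I_sq

theorem raise (hf : HasTopFourierCoeff n f L) : HasTopFourierCoeff (n + 1) f 0 := by
  rw [add_comm n 1]
  simpa using (linear 1 0 0).mul hf

theorem eq_zero (hf : HasTopFourierCoeff n f L) (h : ∀ θ, f θ = 0) : L = 0 := by
  obtain ⟨q, -, q_coeff, q_eval⟩ := hf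
  have root_on_circle : (fun θ : ℝ => Complex.exp (θ * Complex.I)) '' Set.Icc 0 1 ⊆
      {z | q.IsRoot z} := by
    rintro _ ⟨θ, -, rfl⟩
    simpa [h θ] using (q_eval θ).symm
  have injOn : Set.InjOn (fun θ : ℝ => Complex.exp (θ * Complex.I)) (Set.Icc 0 1) := by
    intro x hx y hy hxy
    have := congrArg Complex.re hxy
    simp only [Complex.exp_ofReal_mul_I_re] at this
    exact Real.injOn_cos ⟨hx.1, by linarith [hx.2, Real.pi_gt_three]⟩
      ⟨hy.1, by linarith [hy.2, Real.pi_gt_three]⟩ this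
  have : q = 0 := Polynomial.eq_zero_of_infinite_isRoot q
    (((Set.Icc_infinite one_pos).image injOn).mono root_on_circle)
  simp [← q_coeff, this]

section Vector

variable {A B P : ℝ → E3} {a b p : Fin 3 → ℂ} {k : ℕ}

theorem inner_cross (hA : ∀ i, HasTopFourierCoeff n (fun θ => A θ i) (a i))
    (hB : ∀ i, HasTopFourierCoeff m (fun θ => B θ i) (b i))
    (hP : ∀ i, HasTopFourierCoeff k (fun θ => P θ i) (p i)) :
    HasTopFourierCoeff (n + m + k) (fun θ => ⟪cross (A θ) (B θ), P θ⟫) (crossProduct a b ⬝ᵥ p) := by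
  have coord (i j : Fin 3) := ((hA i).mul (hB j)).sub ((hA j).mul (hB i))
  have := (((coord 1 2).mul (hP 0)).add ((coord 2 0).mul (hP 1))).add ((coord 0 1).mul (hP 2))
  simpa only [inner_coord, cross_zero, cross_one, cross_two, cross_apply, dotProduct,
    Fin.sum_univ_three, Matrix.cons_val] using this

theorem horizontalInner (hA : ∀ i, HasTopFourierCoeff n (fun θ => A θ i) (a i))
    (hB : ∀ i, HasTopFourierCoeff m (fun θ => B θ i) (b i)) :
    HasTopFourierCoeff (n + m) (fun θ => horizontalInner (A θ) (B θ))
      (a 0 * b 0 + a 1 * b 1) :=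
  ((hA 0).mul (hB 0)).add ((hA 1).mul (hB 1))

end Vector

end HasTopFourierCoeff

/-! ### Circles and isotropic vectors -/

/-- The point at angle `θ` of the ellipse with conjugate half-diameters `u, v`. -/
noncomputable def rot (u v : E3) (θ : ℝ) : E3 := Real.cos θ • u + Real.sin θ • v

theorem rot_apply (u v : E3) (θ : ℝ) (i : Fin 3) :
    rot u v θ i = u i * Real.cos θ + v i * Real.sin θ := by
  simp [rot]; ring

theorem rot_neg (u v : E3) (θ : ℝ) : rot (-u) (-v) θ = -rot u v θ := by
  simp [rot]; abel

theorem hasDerivAt_rot_angle (u v : E3) (θ : ℝ) : HasDerivAt (rot u v) (rot v (-u) θ) θ :=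
  (((Real.hasDerivAt_cos θ).smul_const u).add ((Real.hasDerivAt_sin θ).smul_const v)).congr_deriv
    (by simp [rot, add_comm])

theorem hasDerivAt_rot {u v : ℝ → E3} {u' v' : E3} {s : ℝ} (hu : HasDerivAt u u' s)
    (hv : HasDerivAt v v' s) (θ : ℝ) : HasDerivAt (fun t => rot (u t) (v t) θ) (rot u' v' θ) s :=
  (hu.const_smul (Real.cos θ)).add (hv.const_smul (Real.sin θ))

/-- The complex vector `u - iv`, twice the coefficient of `e^{iθ}` in `rot u v θ`. It is isotropic
precisely when `rot u v` parametrizes a circle. -/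
noncomputable def fourierVector (u v : E3) : Fin 3 → ℂ := fun i => u i - v i * Complex.I

theorem fourierVector_neg_right (u v : E3) :
    fourierVector v (-u) = Complex.I • fourierVector u v := by
  ext i
  simp only [fourierVector, PiLp.neg_apply, Complex.ofReal_neg, Pi.smul_apply, smul_eq_mul]
  linear_combination (v i : ℂ) * Complex.I_sq

theorem fourierVector_dotProduct (u v u' v' : E3) :
    fourierVector u v ⬝ᵥ fourierVector u' v' =
      (⟪u, u'⟫ - ⟪v, v'⟫ : ℝ) - (⟪u, v'⟫ + ⟪v, u'⟫ : ℝ) * Complex.I := by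
  simp only [fourierVector, Matrix.vec3_dotProduct, inner_coord]
  push_cast
  linear_combination (v 0 * v' 0 + v 1 * v' 1 + v 2 * v' 2 : ℂ) * Complex.I_sq

theorem fourierVector_apply_eq_zero_iff {u v : E3} {i : Fin 3} :
    fourierVector u v i = 0 ↔ u i = 0 ∧ v i = 0 := by
  simp [fourierVector, Complex.ext_iff]

theorem hasTopFourierCoeff_add_rot (c u v : E3) (i : Fin 3) :
    HasTopFourierCoeff 1 (fun θ => (c + rot u v θ) i) (fourierVector u v i / 2) := by
  simpa only [PiLp.add_apply, rot_apply, fourierVector] using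
    HasTopFourierCoeff.linear (c i) (u i) (v i)

theorem hasTopFourierCoeff_rot (u v : E3) (i : Fin 3) :
    HasTopFourierCoeff 1 (fun θ => rot u v θ i) (fourierVector u v i / 2) := by
  simpa only [zero_add] using hasTopFourierCoeff_add_rot 0 u v i

/-- The expression `heightLaplacian` at angle `θ` of a family of circles `c + rot E₁ E₂ θ`, where
`c₁, c₂` are the first two derivatives of the centre and `Fᵢ, Gᵢ` those of `Eᵢ`. -/
noncomputable def circleLaplacian (c₁ c₂ E₁ E₂ F₁ F₂ G₁ G₂ : E3) (θ : ℝ) : ℝ :=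
  heightLaplacian (c₁ + rot F₁ F₂ θ) (rot E₂ (-E₁) θ) (c₂ + rot G₁ G₂ θ)
    (rot F₂ (-F₁) θ) (rot F₂ (-F₁) θ) (-rot E₁ E₂ θ)

theorem hasTopFourierCoeff_circleLaplacian (c₁ c₂ E₁ E₂ F₁ F₂ G₁ G₂ : E3) :
    HasTopFourierCoeff 5 (circleLaplacian c₁ c₂ E₁ E₂ F₁ F₂ G₁ G₂)
      (-(Complex.I / 32) * (fourierVector E₁ E₂ 0 ^ 2 + fourierVector E₁ E₂ 1 ^ 2) *
        (crossProduct (fourierVector F₁ F₂) (fourierVector E₁ E₂) ⬝ᵥ fourierVector G₁ G₂)) := by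
  have hA := hasTopFourierCoeff_add_rot c₁ F₁ F₂
  have hB := hasTopFourierCoeff_rot E₂ (-E₁)
  have hAtt (i : Fin 3) := (hasTopFourierCoeff_rot E₁ E₂ i).neg
  have mixed := HasTopFourierCoeff.inner_cross hA hB (hasTopFourierCoeff_rot F₂ (-F₁))
  have top := (((HasTopFourierCoeff.horizontalInner hB hB).mul
    (HasTopFourierCoeff.inner_cross hA hB (hasTopFourierCoeff_add_rot c₂ G₁ G₂))).sub
    ((HasTopFourierCoeff.horizontalInner hA hB).mul (mixed.add mixed))).add
    ((HasTopFourierCoeff.horizontalInner hA hA).mul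
      (HasTopFourierCoeff.inner_cross (P := fun θ => -rot E₁ E₂ θ) hA hB hAtt))
  refine Eq.subst (motive := HasTopFourierCoeff 5 _) ?_ top
  simp only [fourierVector_neg_right, cross_apply, dotProduct, Fin.sum_univ_three, Pi.smul_apply,
    smul_eq_mul, Matrix.cons_val]
  generalize fourierVector E₁ E₂ = e, fourierVector F₁ F₂ = f, fourierVector G₁ G₂ = g
  linear_combination Complex.I / 32 * (e 0 ^ 2 + e 1 ^ 2) * ((f 1 * e 2 - f 2 * e 1) * g 0
    + (f 2 * e 0 - f 0 * e 2) * g 1 + (f 0 * e 1 - f 1 * e 0) * g 2) * Complex.I_sq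

/-- Isotropy forces `b × a = σ a`, and then the determinant `(b × a) ⬝ c` equals `σ³`. -/
theorem exists_eq_smul_of_isotropic {K : Type*} [Field K] {a b c : Fin 3 → K} (ha : a ≠ 0)
    (haa : a ⬝ᵥ a = 0) (hab : a ⬝ᵥ b = 0) (hac : b ⬝ᵥ b + a ⬝ᵥ c = 0)
    (hdet : crossProduct b a ⬝ᵥ c = 0) : ∃ β : K, b = β • a := by
  have exists_smul_of_cross {v : Fin 3 → K} (h : crossProduct a v = 0) : ∃ β : K, v = β • a := by
    have := mt crossProduct_ne_zero_iff_linearIndependent.2 (not_not.2 h)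
    rw [LinearIndependent.pair_iff' ha] at this
    push Not at this
    exact this.imp fun _ => Eq.symm
  obtain ⟨σ, hσ⟩ : ∃ σ : K, crossProduct b a = σ • a :=
    exists_smul_of_cross (by
      rw [← cross_anticomm, cross_cross_eq_smul_sub_smul, haa, dotProduct_comm, hab]; simp)
  have hbb : b ⬝ᵥ b = -σ ^ 2 := by
    have h := cross_cross_eq_smul_sub_smul b a b
    rw [hab, zero_smul, sub_zero, hσ, map_smul, LinearMap.smul_apply, ← cross_anticomm, hσ,
      smul_neg, smul_smul, ← neg_smul] at h
    linear_combination -smul_left_injective K ha h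
  have σ_cube : σ ^ 3 = 0 := by
    rw [hσ, smul_dotProduct, smul_eq_mul] at hdet
    linear_combination hdet - σ * hac + σ * hbb
  refine exists_smul_of_cross ?_
  rw [← cross_anticomm, hσ, pow_eq_zero_iff (n := 3) (by norm_num) |>.1 σ_cube, zero_smul, neg_zero]

/-! ### The Laplacian of a cyclic surface -/

section Smooth

variable {F : Type*} [NormedAddCommGroup F] [NormedSpace ℝ F] {f : ℝ → F} {I : Set ℝ} {s : ℝ}

theorem hasDerivAt_of_contDiffOn (hf : ContDiffOn ℝ ∞ f I) (hI : IsOpen I) (hs : s ∈ I) :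
    HasDerivAt f (deriv f s) s :=
  ((hf.differentiableOn (by simp)).differentiableAt (hI.mem_nhds hs)).hasDerivAt

theorem contDiffOn_deriv (hf : ContDiffOn ℝ ∞ f I) (hI : IsOpen I) : ContDiffOn ℝ ∞ (deriv f) I :=
  ((contDiffOn_infty_iff_deriv_of_isOpen hI).1 hf).2

theorem continuousAt_fst_of_contDiffOn (hf : ContDiffOn ℝ ∞ f I) (hI : IsOpen I) {q : ℝ × ℝ}
    (hq : q.1 ∈ I) : ContinuousAt (fun p : ℝ × ℝ => f p.1) q :=
  ContinuousAt.comp (g := f) (hf.continuousOn.continuousAt (hI.mem_nhds hq)) continuousAt_fst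

theorem eq_zero_of_hasDerivAt_of_eqOn_const {f' a : F} (hf : HasDerivAt f f' s) (hI : IsOpen I)
    (hs : s ∈ I) (h : ∀ t ∈ I, f t = a) : f' = 0 :=
  hf.unique ((hasDerivAt_const s a).congr_of_eventuallyEq
    (Filter.eventually_of_mem (hI.mem_nhds hs) h))

theorem IsOpenInterval.eq_of_hasDerivAt_zero (hI : IsOpenInterval I)
    (h : ∀ s ∈ I, HasDerivAt f 0 s) {t : ℝ} (hs : s ∈ I) (ht : t ∈ I) : f s = f t :=
  hI.1.is_const_of_deriv_eq_zero hI.2.1.isPreconnected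
    (fun x hx => (h x hx).differentiableAt.differentiableWithinAt) (fun x hx => (h x hx).deriv)
    hs ht

end Smooth

theorem unitNormal_two_ne_zero_iff {X : ℝ → ℝ → E3} {s θ : ℝ} :
    unitNormal X s θ 2 ≠ 0 ↔ cross (ds X s θ) (dθ X s θ) 2 ≠ 0 := by
  have : cross (ds X s θ) (dθ X s θ) 2 ≠ 0 → cross (ds X s θ) (dθ X s θ) ≠ 0 := by
    contrapose!; intro h; rw [h]; rfl
  simpa [unitNormal] using this

theorem continuousAt_heightLaplacian {T : Type*} [TopologicalSpace T] {A B Ass Ast Ats Att : T → E3}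
    {q : T} (hA : ContinuousAt A q) (hB : ContinuousAt B q) (hss : ContinuousAt Ass q)
    (hst : ContinuousAt Ast q) (hts : ContinuousAt Ats q) (htt : ContinuousAt Att q) :
    ContinuousAt (fun p => heightLaplacian (A p) (B p) (Ass p) (Ast p) (Ats p) (Att p)) q := by
  simp only [heightLaplacian, horizontalInner, inner_coord, cross_zero, cross_one, cross_two]
  fun_prop

theorem continuousAt_rot {u v : ℝ × ℝ → E3} {q : ℝ × ℝ} (hu : ContinuousAt u q)
    (hv : ContinuousAt v q) : ContinuousAt (fun p => rot (u p) (v p) p.2) q := by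
  unfold rot; fun_prop

namespace CyclicSurface

variable (C : CyclicSurface)

/-- The radius vector of the circle of parameter `s` at angle `0`. -/
noncomputable def E₁ (s : ℝ) : E3 := C.radius s • C.e₁ s

/-- The radius vector of the circle of parameter `s` at angle `π/2`. -/
noncomputable def E₂ (s : ℝ) : E3 := C.radius s • C.e₂ s

theorem X_eq (s θ : ℝ) : C.X s θ = C.center s + rot (C.E₁ s) (C.E₂ s) θ := by
  simp only [X, circleFamily, rot, E₁, E₂]; module

theorem E₁_smooth : ContDiffOn ℝ ∞ C.E₁ C.I := C.radius_smooth.smul C.e₁_smooth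

theorem E₂_smooth : ContDiffOn ℝ ∞ C.E₂ C.I := C.radius_smooth.smul C.e₂_smooth

/-- The expression `heightLaplacian` at a parameter of a cyclic surface. -/
noncomputable def laplacian (s θ : ℝ) : ℝ :=
  circleLaplacian (deriv C.center s) (deriv (deriv C.center) s) (C.E₁ s) (C.E₂ s)
    (deriv C.E₁ s) (deriv C.E₂ s) (deriv (deriv C.E₁) s) (deriv (deriv C.E₂) s) θ

variable {C} {s : ℝ}

theorem hasDerivAt_X_s (hs : s ∈ C.I) (θ : ℝ) : HasDerivAt (fun t => C.X t θ)
    (deriv C.center s + rot (deriv C.E₁ s) (deriv C.E₂ s) θ) s := by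
  have hI := C.interval.1
  simp only [X_eq]
  exact (hasDerivAt_of_contDiffOn C.center_smooth hI hs).add
    (hasDerivAt_rot (hasDerivAt_of_contDiffOn C.E₁_smooth hI hs)
      (hasDerivAt_of_contDiffOn C.E₂_smooth hI hs) θ)

theorem hasDerivAt_X_θ (s θ : ℝ) :
    HasDerivAt (fun t => C.X s t) (rot (C.E₂ s) (-C.E₁ s) θ) θ := by
  simp only [X_eq]
  exact (hasDerivAt_rot_angle _ _ θ).const_add _

theorem ds_X (hs : s ∈ C.I) (θ : ℝ) :
    ds C.X s θ = deriv C.center s + rot (deriv C.E₁ s) (deriv C.E₂ s) θ :=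
  (hasDerivAt_X_s hs θ).deriv

theorem dθ_X (s θ : ℝ) : dθ C.X s θ = rot (C.E₂ s) (-C.E₁ s) θ := (hasDerivAt_X_θ s θ).deriv

theorem hasDerivAt_ds_s (hs : s ∈ C.I) (θ : ℝ) :
    HasDerivAt (fun t => ds C.X t θ)
      (deriv (deriv C.center) s + rot (deriv (deriv C.E₁) s) (deriv (deriv C.E₂) s) θ) s := by
  have hI := C.interval.1
  refine HasDerivAt.congr_of_eventuallyEq ?_
    (Filter.eventually_of_mem (hI.mem_nhds hs) fun t ht => ds_X ht θ)
  exact (hasDerivAt_of_contDiffOn (contDiffOn_deriv C.center_smooth hI) hI hs).add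
    (hasDerivAt_rot (hasDerivAt_of_contDiffOn (contDiffOn_deriv C.E₁_smooth hI) hI hs)
      (hasDerivAt_of_contDiffOn (contDiffOn_deriv C.E₂_smooth hI) hI hs) θ)

theorem hasDerivAt_dθ_s (hs : s ∈ C.I) (θ : ℝ) :
    HasDerivAt (fun t => dθ C.X t θ) (rot (deriv C.E₂ s) (-deriv C.E₁ s) θ) s := by
  have hI := C.interval.1
  rw [funext fun t => dθ_X t θ]
  exact hasDerivAt_rot (hasDerivAt_of_contDiffOn C.E₂_smooth hI hs)
    (hasDerivAt_of_contDiffOn C.E₁_smooth hI hs).neg θ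

theorem hasDerivAt_ds_θ (hs : s ∈ C.I) (θ : ℝ) :
    HasDerivAt (fun t => ds C.X s t) (rot (deriv C.E₂ s) (-deriv C.E₁ s) θ) θ := by
  rw [funext fun t => ds_X hs t]
  exact (hasDerivAt_rot_angle _ _ θ).const_add _

theorem hasDerivAt_dθ_θ (s θ : ℝ) :
    HasDerivAt (fun t => dθ C.X s t) (-rot (C.E₁ s) (C.E₂ s) θ) θ := by
  rw [funext fun t => dθ_X s t, ← rot_neg]
  exact hasDerivAt_rot_angle _ _ θ

theorem anisotropicMeanCurvature_eq_zero_iff (hs : s ∈ C.I) {θ : ℝ}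
    (h : unitNormal C.X s θ 2 ≠ 0) :
    anisotropicMeanCurvature dirichletIntegrand C.X s θ = 0 ↔ C.laplacian s θ = 0 := by
  have hN := unitNormal_two_ne_zero_iff.1 h
  rw [anisotropicMeanCurvature_dirichletIntegrand (hasDerivAt_ds_s hs θ) (hasDerivAt_dθ_s hs θ)
    (hasDerivAt_ds_θ hs θ) (hasDerivAt_dθ_θ s θ) h, mul_eq_zero,
    or_iff_right (div_ne_zero two_ne_zero (pow_ne_zero 3 hN)), ds_X hs, dθ_X, laplacian,
    circleLaplacian]

theorem continuousAt_laplacian {q : ℝ × ℝ} (hq : q.1 ∈ C.I) :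
    ContinuousAt (fun p : ℝ × ℝ => C.laplacian p.1 p.2) q := by
  have hI := C.interval.1
  have smooth {f : ℝ → E3} (hf : ContDiffOn ℝ ∞ f C.I) :=
    continuousAt_fst_of_contDiffOn hf hI hq
  have hc' := contDiffOn_deriv C.center_smooth hI
  have hE₁' := contDiffOn_deriv C.E₁_smooth hI
  have hE₂' := contDiffOn_deriv C.E₂_smooth hI
  have mixed := continuousAt_rot (smooth hE₂') (smooth hE₁').neg
  exact continuousAt_heightLaplacian
    ((smooth hc').add (continuousAt_rot (smooth hE₁') (smooth hE₂')))
    (continuousAt_rot (smooth C.E₂_smooth) (smooth C.E₁_smooth).neg)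
    ((smooth (contDiffOn_deriv hc' hI)).add
      (continuousAt_rot (smooth (contDiffOn_deriv hE₁' hI)) (smooth (contDiffOn_deriv hE₂' hI))))
    mixed mixed (continuousAt_rot (smooth C.E₁_smooth) (smooth C.E₂_smooth)).neg

theorem IsAnisotropicMinimal.exists_regular (hC : C.IsAnisotropicMinimal) (hs : s ∈ C.I) (θ : ℝ)
    {P : ℝ × ℝ → Prop} (hP : ∀ᶠ q in nhds (s, θ), P q) : ∃ q ∈ C.regular, P q :=
  ((mem_closure_iff_frequently.1 (hC.1 ⟨hs, trivial⟩)).and_eventually hP).exists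

theorem IsAnisotropicMinimal.laplacian_eq_zero (hC : C.IsAnisotropicMinimal) (hs : s ∈ C.I)
    (θ : ℝ) : C.laplacian s θ = 0 := by
  by_contra hne
  obtain ⟨q, hq, hq'⟩ := hC.exists_regular hs θ
    ((continuousAt_laplacian (q := (s, θ)) hs).eventually_ne hne)
  exact hq' ((anisotropicMeanCurvature_eq_zero_iff hq.1 hq.2).1 (hC.2 q hq))

end CyclicSurface

/-! ### The planes of the circles are parallel -/

theorem orthonormal_pair_iff {E : Type*} [NormedAddCommGroup E] [InnerProductSpace ℝ E] {u v : E} :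
    Orthonormal ℝ ![u, v] ↔ ⟪u, u⟫ = 1 ∧ ⟪v, v⟫ = 1 ∧ ⟪u, v⟫ = 0 := by
  simp only [real_inner_self_eq_norm_sq, pow_eq_one_iff_of_nonneg (norm_nonneg _) two_ne_zero]
  simp [orthonormal_vecCons_iff, and_left_comm, and_comm]

section Orthonormal

variable {e₁ e₂ : E3}

theorem norm_cross_sq_of_orthonormal (he : Orthonormal ℝ ![e₁, e₂]) : ‖cross e₁ e₂‖ ^ 2 = 1 := by
  obtain ⟨h₁, h₂, h₁₂⟩ := orthonormal_pair_iff.1 he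
  rw [norm_cross_sq, h₁, h₂, h₁₂]; norm_num

theorem cross_cross_left_of_orthonormal (he : Orthonormal ℝ ![e₁, e₂]) :
    cross (cross e₁ e₂) e₁ = e₂ := by
  obtain ⟨h₁, -, h₁₂⟩ := orthonormal_pair_iff.1 he
  rw [cross_cross_left, h₁, h₁₂]; simp

theorem cross_cross_right_of_orthonormal (he : Orthonormal ℝ ![e₁, e₂]) :
    cross e₂ (cross e₁ e₂) = e₁ := by
  obtain ⟨-, h₂, h₁₂⟩ := orthonormal_pair_iff.1 he
  rw [cross_cross_right, h₂, h₁₂]; simp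

theorem orthonormal_decomposition (he : Orthonormal ℝ ![e₁, e₂]) (w : E3) :
    w = ⟪w, e₁⟫ • e₁ + ⟪w, e₂⟫ • e₂ + ⟪w, cross e₁ e₂⟫ • cross e₁ e₂ := by
  have := norm_cross_sq_smul e₁ e₂ w
  rwa [norm_cross_sq_of_orthonormal he, cross_cross_left_of_orthonormal he,
    cross_cross_right_of_orthonormal he, one_smul] at this

theorem cross_two_sq_add_of_orthonormal (he : Orthonormal ℝ ![e₁, e₂]) :
    cross e₁ e₂ 2 ^ 2 + e₁ 2 ^ 2 + e₂ 2 ^ 2 = 1 := by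
  have := congrArg (fun u : E3 => u 2) (orthonormal_decomposition he !₂[0, 0, 1])
  simp [inner_coord] at this
  rw [cross_two]
  linarith

theorem fourierVector_dotProduct_self_of_orthonormal (he : Orthonormal ℝ ![e₁, e₂]) (r : ℝ) :
    fourierVector (r • e₁) (r • e₂) ⬝ᵥ fourierVector (r • e₁) (r • e₂) = 0 := by
  obtain ⟨h₁, h₂, h₁₂⟩ := orthonormal_pair_iff.1 he
  simp only [fourierVector_dotProduct, real_inner_smul_left, real_inner_smul_right, h₁, h₂, h₁₂,
    real_inner_comm e₁ e₂]
  simp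

end Orthonormal

theorem hasDerivAt_fourierVector {u v : ℝ → E3} {u' v' : E3} {s : ℝ} (hu : HasDerivAt u u' s)
    (hv : HasDerivAt v v' s) (i : Fin 3) :
    HasDerivAt (fun t => fourierVector (u t) (v t) i) (fourierVector u' v' i) s :=
  (hasDerivAt_coord hu i).ofReal_comp.sub
    ((hasDerivAt_coord hv i).ofReal_comp.mul_const Complex.I)

theorem hasDerivAt_dotProduct {ι : Type*} [Fintype ι] {u v : ℝ → ι → ℂ} {u' v' : ι → ℂ} {s : ℝ}
    (hu : ∀ i, HasDerivAt (fun t => u t i) (u' i) s)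
    (hv : ∀ i, HasDerivAt (fun t => v t i) (v' i) s) :
    HasDerivAt (fun t => u t ⬝ᵥ v t) (u' ⬝ᵥ v s + u s ⬝ᵥ v') s :=
  (HasDerivAt.fun_sum fun i _ => (hu i).mul (hv i)).congr_deriv Finset.sum_add_distrib

theorem inner_eq_zero_of_fourierVector_eq_smul {u v u' v' n : E3} {β : ℂ}
    (h : fourierVector u' v' = β • fourierVector u v) (hu : ⟪u, n⟫ = 0) (hv : ⟪v, n⟫ = 0) :
    ⟪u', n⟫ = 0 ∧ ⟪v', n⟫ = 0 := by
  have := congrArg (· ⬝ᵥ fourierVector n 0) h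
  simp only [smul_dotProduct, fourierVector_dotProduct, inner_zero_right, hu, hv] at this
  simpa [Complex.ext_iff] using this

namespace CyclicSurface

variable {C : CyclicSurface} {s : ℝ}

theorem fourierVector_E_dotProduct_self (hs : s ∈ C.I) :
    fourierVector (C.E₁ s) (C.E₂ s) ⬝ᵥ fourierVector (C.E₁ s) (C.E₂ s) = 0 :=
  fourierVector_dotProduct_self_of_orthonormal (C.orthonormal s hs) _

theorem fourierVector_E_dotProduct_deriv (hs : s ∈ C.I) :
    fourierVector (C.E₁ s) (C.E₂ s) ⬝ᵥ fourierVector (deriv C.E₁ s) (deriv C.E₂ s) = 0 := by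
  have hI := C.interval.1
  have hM := hasDerivAt_fourierVector (hasDerivAt_of_contDiffOn C.E₁_smooth hI hs)
    (hasDerivAt_of_contDiffOn C.E₂_smooth hI hs)
  have := eq_zero_of_hasDerivAt_of_eqOn_const (hasDerivAt_dotProduct hM hM) hI hs
    fun t ht => fourierVector_E_dotProduct_self ht
  rw [dotProduct_comm, ← two_mul] at this
  exact (mul_eq_zero.1 this).resolve_left two_ne_zero

theorem fourierVector_E_dotProduct_deriv_deriv (hs : s ∈ C.I) :
    fourierVector (deriv C.E₁ s) (deriv C.E₂ s) ⬝ᵥ fourierVector (deriv C.E₁ s) (deriv C.E₂ s)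
      + fourierVector (C.E₁ s) (C.E₂ s) ⬝ᵥ
        fourierVector (deriv (deriv C.E₁) s) (deriv (deriv C.E₂) s) = 0 := by
  have hI := C.interval.1
  have hM := hasDerivAt_fourierVector (hasDerivAt_of_contDiffOn C.E₁_smooth hI hs)
    (hasDerivAt_of_contDiffOn C.E₂_smooth hI hs)
  have hM' := hasDerivAt_fourierVector
    (hasDerivAt_of_contDiffOn (contDiffOn_deriv C.E₁_smooth hI) hI hs)
    (hasDerivAt_of_contDiffOn (contDiffOn_deriv C.E₂_smooth hI) hI hs)
  have h := hasDerivAt_dotProduct hM hM'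
  exact eq_zero_of_hasDerivAt_of_eqOn_const h hI hs fun t ht => fourierVector_E_dotProduct_deriv ht

variable (C) in
/-- The unit normal of the plane of the circle of parameter `s`. -/
noncomputable def normal (s : ℝ) : E3 := cross (C.e₁ s) (C.e₂ s)

variable (C) in
/-- The plane of the circle of parameter `s` is horizontal. -/
def IsHorizontalAt (s : ℝ) : Prop := C.e₁ s 2 = 0 ∧ C.e₂ s 2 = 0

theorem isHorizontalAt_iff_normal (hs : s ∈ C.I) : C.IsHorizontalAt s ↔ C.normal s 2 ^ 2 = 1 := by
  have := cross_two_sq_add_of_orthonormal (C.orthonormal s hs)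
  rw [← normal] at this
  constructor
  · rintro ⟨h₁, h₂⟩
    rw [h₁, h₂] at this
    linarith
  · intro h
    constructor <;> nlinarith [sq_nonneg (C.e₁ s 2), sq_nonneg (C.e₂ s 2)]

theorem isHorizontalAt_iff_fourierVector (hs : s ∈ C.I) :
    C.IsHorizontalAt s ↔ fourierVector (C.E₁ s) (C.E₂ s) 2 = 0 := by
  simp [fourierVector_apply_eq_zero_iff, E₁, E₂, IsHorizontalAt, (C.radius_pos s hs).ne']

variable (C) in
/-- The plane of the circles does not turn at the parameter `s`. -/
def IsStationaryAt (s : ℝ) : Prop :=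
  ⟪deriv C.e₁ s, C.normal s⟫ = 0 ∧ ⟪deriv C.e₂ s, C.normal s⟫ = 0

theorem hasDerivAt_normal (hs : s ∈ C.I) :
    HasDerivAt C.normal (-(⟪deriv C.e₁ s, C.normal s⟫ • C.e₁ s
      + ⟪deriv C.e₂ s, C.normal s⟫ • C.e₂ s)) s := by
  have hI := C.interval.1
  have he₁ := hasDerivAt_of_contDiffOn C.e₁_smooth hI hs
  have he₂ := hasDerivAt_of_contDiffOn C.e₂_smooth hI hs
  have hn : HasDerivAt C.normal _ s := hasDerivAt_cross he₁ he₂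
  have near := hI.mem_nhds hs
  have hn₁ := inner_left_eq_neg_of_hasDerivAt hn he₁ (.of_forall fun _ => inner_cross_left _ _)
  have hn₂ := inner_left_eq_neg_of_hasDerivAt hn he₂ (.of_forall fun _ => inner_cross_right _ _)
  have hnn := inner_left_eq_neg_of_hasDerivAt hn hn (Filter.eventually_of_mem near fun t ht => by
    rw [real_inner_self_eq_norm_sq]; exact norm_cross_sq_of_orthonormal (C.orthonormal t ht))
  refine hn.congr_deriv ?_
  rw [orthonormal_decomposition (C.orthonormal s hs) (cross _ _ + cross _ _), hn₁, hn₂]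
  rw [real_inner_comm] at hnn
  change _ + ⟪_, C.normal s⟫ • _ = _
  rw [show ⟪_, C.normal s⟫ = (0 : ℝ) by rw [real_inner_comm]; linarith,
    real_inner_comm (C.normal s), real_inner_comm (C.normal s)]
  module

theorem IsStationaryAt.hasDerivAt_normal (h : C.IsStationaryAt s) (hs : s ∈ C.I) :
    HasDerivAt C.normal 0 s := by
  simpa [h.1, h.2] using CyclicSurface.hasDerivAt_normal hs

theorem IsAnisotropicMinimal.isStationaryAt_of_not_isHorizontalAt (hC : C.IsAnisotropicMinimal)
    (hs : s ∈ C.I) (h : ¬C.IsHorizontalAt s) : C.IsStationaryAt s := by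
  have hI := C.interval.1
  rw [isHorizontalAt_iff_fourierVector hs] at h
  have isotropic := fourierVector_E_dotProduct_self hs
  have top := (hasTopFourierCoeff_circleLaplacian (deriv C.center s) (deriv (deriv C.center) s)
    (C.E₁ s) (C.E₂ s) (deriv C.E₁ s) (deriv C.E₂ s) (deriv (deriv C.E₁) s)
    (deriv (deriv C.E₂) s)).eq_zero (hC.laplacian_eq_zero hs)
  rw [show fourierVector (C.E₁ s) (C.E₂ s) 0 ^ 2 + fourierVector (C.E₁ s) (C.E₂ s) 1 ^ 2
      = -fourierVector (C.E₁ s) (C.E₂ s) 2 ^ 2 by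
    rw [dotProduct, Fin.sum_univ_three] at isotropic; linear_combination isotropic] at top
  obtain ⟨β, hβ⟩ := exists_eq_smul_of_isotropic (fun h₀ => h (congrFun h₀ 2)) isotropic
    (fourierVector_E_dotProduct_deriv hs) (fourierVector_E_dotProduct_deriv_deriv hs)
    (by simpa [h] using top)
  have tangent₁ : ⟪C.e₁ s, C.normal s⟫ = 0 := by rw [real_inner_comm]; exact inner_cross_left _ _
  have tangent₂ : ⟪C.e₂ s, C.normal s⟫ = 0 := by rw [real_inner_comm]; exact inner_cross_right _ _
  obtain ⟨h₁, h₂⟩ := inner_eq_zero_of_fourierVector_eq_smul (n := C.normal s) hβ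
    (by rw [E₁, real_inner_smul_left, tangent₁, mul_zero])
    (by rw [E₂, real_inner_smul_left, tangent₂, mul_zero])
  have hr := hasDerivAt_of_contDiffOn C.radius_smooth hI hs
  have hE₁ : deriv C.E₁ s = _ := (hr.smul (hasDerivAt_of_contDiffOn C.e₁_smooth hI hs)).deriv
  have hE₂ : deriv C.E₂ s = _ := (hr.smul (hasDerivAt_of_contDiffOn C.e₂_smooth hI hs)).deriv
  have := (C.radius_pos s hs).ne'
  constructor
  · simpa [hE₁, inner_add_left, real_inner_smul_left, tangent₁, this] using h₁
  · simpa [hE₂, inner_add_left, real_inner_smul_left, tangent₂, this] using h₂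

theorem IsAnisotropicMinimal.normal_two_eq (hC : C.IsAnisotropicMinimal) {t : ℝ} (hs : s ∈ C.I)
    (ht : t ∈ C.I) : C.normal s 2 = C.normal t 2 := by
  refine C.interval.eq_of_hasDerivAt_zero (f := fun s => C.normal s 2) (fun x hx => ?_) hs ht
  by_cases h : C.IsHorizontalAt x
  · simpa [h.1, h.2] using hasDerivAt_coord (hasDerivAt_normal hx) 2
  · exact hasDerivAt_coord
      ((hC.isStationaryAt_of_not_isHorizontalAt hx h).hasDerivAt_normal hx) 2

theorem IsAnisotropicMinimal.isHorizontalAt_iff (hC : C.IsAnisotropicMinimal) {t : ℝ}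
    (hs : s ∈ C.I) (ht : t ∈ C.I) : C.IsHorizontalAt s ↔ C.IsHorizontalAt t := by
  rw [isHorizontalAt_iff_normal hs, isHorizontalAt_iff_normal ht, hC.normal_two_eq hs ht]

theorem IsAnisotropicMinimal.isStationaryAt (hC : C.IsAnisotropicMinimal) (hs : s ∈ C.I) :
    C.IsStationaryAt s := by
  by_cases h : C.IsHorizontalAt s
  · have hI := C.interval.1
    have horizontal (t : ℝ) (ht : t ∈ C.I) := (hC.isHorizontalAt_iff hs ht).1 h
    have h₁ := eq_zero_of_hasDerivAt_of_eqOn_const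
      (hasDerivAt_coord (hasDerivAt_of_contDiffOn C.e₁_smooth hI hs) 2) hI hs
      fun t ht => (horizontal t ht).1
    have h₂ := eq_zero_of_hasDerivAt_of_eqOn_const
      (hasDerivAt_coord (hasDerivAt_of_contDiffOn C.e₂_smooth hI hs) 2) hI hs
      fun t ht => (horizontal t ht).2
    simp [IsStationaryAt, normal, inner_coord, h₁, h₂, h.1, h.2]
  · exact hC.isStationaryAt_of_not_isHorizontalAt hs h

theorem IsAnisotropicMinimal.normal_eq (hC : C.IsAnisotropicMinimal) {t : ℝ} (hs : s ∈ C.I)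
    (ht : t ∈ C.I) : C.normal s = C.normal t :=
  C.interval.eq_of_hasDerivAt_zero (fun _ hx => (hC.isStationaryAt hx).hasDerivAt_normal hx) hs ht

end CyclicSurface

/-! ### Circles in parallel planes -/

theorem inner_cross_cross (a b c d : E3) :
    ⟪cross a b, cross c d⟫ = ⟪a, c⟫ * ⟪b, d⟫ - ⟪a, d⟫ * ⟪b, c⟫ := by
  simp only [inner_coord, cross_zero, cross_one, cross_two]; ring

theorem horizontalInner_self_nonneg (u : E3) : 0 ≤ horizontalInner u u :=
  add_nonneg (mul_self_nonneg _) (mul_self_nonneg _)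

theorem horizontalInner_self_eq_zero {u : E3} : horizontalInner u u = 0 ↔ u 0 = 0 ∧ u 1 = 0 :=
  mul_self_add_mul_self_eq_zero

/-- The value of `heightLaplacian / r²` for circles of radius `r` in parallel planes, at the point
of the circle with outer unit normal `E` and unit tangent `T`; here `c₁, c₂` and `r₁, r₂` are the
first two derivatives of the centre and of the radius. -/
noncomputable def parallelLaplacian (c₁ c₂ E T : E3) (r r₁ r₂ : ℝ) : ℝ :=
  r * horizontalInner T T * (⟪cross E T, c₂⟫ * (⟪c₁, E⟫ + r₁) - ⟪cross E T, c₁⟫ * (⟪c₂, E⟫ + r₂))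
    + ⟪cross E T, c₁⟫ * horizontalInner (c₁ + r₁ • E) (c₁ + r₁ • E)

theorem cross_rot_rot (e₁ e₂ : E3) (θ : ℝ) :
    cross (rot e₁ e₂ θ) (rot e₂ (-e₁) θ) = cross e₁ e₂ := by
  have h := Real.sin_sq_add_cos_sq θ
  apply E3.ext_coord <;> simp only [cross_zero, cross_one, cross_two, rot_apply, PiLp.neg_apply]
  · linear_combination (e₁ 1 * e₂ 2 - e₁ 2 * e₂ 1) * h
  · linear_combination (e₁ 2 * e₂ 0 - e₁ 0 * e₂ 2) * h
  · linear_combination (e₁ 0 * e₂ 1 - e₁ 1 * e₂ 0) * h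

section Orthonormal

variable {e₁ e₂ : E3}

theorem orthonormal_rot (he : Orthonormal ℝ ![e₁, e₂]) (θ : ℝ) :
    Orthonormal ℝ ![rot e₁ e₂ θ, rot e₂ (-e₁) θ] := by
  obtain ⟨h₁, h₂, h₁₂⟩ := orthonormal_pair_iff.1 he
  have h := Real.sin_sq_add_cos_sq θ
  refine orthonormal_pair_iff.2 ⟨?_, ?_, ?_⟩ <;>
    simp only [rot, inner_add_left, inner_add_right, real_inner_smul_left, real_inner_smul_right,
      inner_neg_left, inner_neg_right, h₁, h₂, h₁₂, real_inner_comm e₁ e₂]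
  · linear_combination h
  · linear_combination h
  · ring

theorem inner_cross_of_orthonormal (he : Orthonormal ℝ ![e₁, e₂]) (d v : E3) :
    ⟪cross d e₂, v⟫ = ⟪d, e₁⟫ * ⟪cross e₁ e₂, v⟫ - ⟪cross e₁ e₂, d⟫ * ⟪e₁, v⟫ := by
  conv_lhs => rw [← cross_cross_left_of_orthonormal he]
  simp only [inner_coord, cross_zero, cross_one, cross_two]; ring

theorem cross_eq_smul_of_orthonormal (he : Orthonormal ℝ ![e₁, e₂])
    {a b : E3} (ha : ⟪a, cross e₁ e₂⟫ = 0)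
    (hb : ⟪b, cross e₁ e₂⟫ = 0) : cross a b = ⟪cross a b, cross e₁ e₂⟫ • cross e₁ e₂ := by
  have h₁ : ⟪cross a b, e₁⟫ = 0 := by
    conv_lhs => rw [← cross_cross_right_of_orthonormal he, inner_cross_cross, ha, hb]
    ring
  have h₂ : ⟪cross a b, e₂⟫ = 0 := by
    conv_lhs => rw [← cross_cross_left_of_orthonormal he, inner_cross_cross, ha, hb]
    ring
  have h := orthonormal_decomposition he (cross a b)
  rw [h₁, h₂] at h
  simpa using h

theorem heightLaplacian_of_orthonormal (he : Orthonormal ℝ ![e₁, e₂])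
    (c₁ c₂ : E3) (r r₁ r₂ w k : ℝ) :
    heightLaplacian (c₁ + (r₁ • e₁ + (r * w) • e₂)) (r • e₂)
        (c₂ + ((r₂ - r * w ^ 2) • e₁ + k • e₂)) (r₁ • e₂ - (r * w) • e₁) (r₁ • e₂ - (r * w) • e₁)
        (-(r • e₁)) =
      r ^ 2 * parallelLaplacian c₁ c₂ e₁ e₂ r r₁ r₂ := by
  obtain ⟨h₁, -, h₁₂⟩ := orthonormal_pair_iff.1 he
  have cross_eq : cross (c₁ + (r₁ • e₁ + (r * w) • e₂)) (r • e₂) =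
      r • cross (c₁ + r₁ • e₁) e₂ := by
    apply E3.ext_coord <;> simp <;> ring
  have inner_eq (v : E3) : ⟪cross (c₁ + r₁ • e₁) e₂, v⟫ =
      (⟪c₁, e₁⟫ + r₁) * ⟪cross e₁ e₂, v⟫ - ⟪cross e₁ e₂, c₁⟫ * ⟪e₁, v⟫ := by
    rw [inner_cross_of_orthonormal he, inner_add_left, inner_add_right, real_inner_smul_left,
      real_inner_smul_right, h₁, inner_cross_left]
    ring
  simp only [heightLaplacian, parallelLaplacian, cross_eq, real_inner_smul_left, inner_eq,
    inner_add_right, inner_sub_right, inner_neg_right, real_inner_smul_right, inner_cross_left,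
    inner_cross_right, h₁, h₁₂, real_inner_comm e₁ c₂]
  simp only [horizontalInner, PiLp.add_apply, PiLp.smul_apply, smul_eq_mul]
  ring

theorem circleLaplacian_of_orthonormal (he : Orthonormal ℝ ![e₁, e₂])
    (c₁ c₂ : E3) (r r₁ r₂ w k θ : ℝ) :
    circleLaplacian c₁ c₂ (r • e₁) (r • e₂) (r₁ • e₁ + (r * w) • e₂) (r₁ • e₂ - (r * w) • e₁)
        ((r₂ - r * w ^ 2) • e₁ + k • e₂) ((r₂ - r * w ^ 2) • e₂ - k • e₁) θ =
      r ^ 2 * parallelLaplacian c₁ c₂ (rot e₁ e₂ θ) (rot e₂ (-e₁) θ) r r₁ r₂ := by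
  rw [← heightLaplacian_of_orthonormal (orthonormal_rot he θ) c₁ c₂ r r₁ r₂ w k, circleLaplacian]
  congr 1 <;> simp only [rot] <;> module

theorem fourierVector_sq_add_sq_of_orthonormal (he : Orthonormal ℝ ![e₁, e₂]) :
    fourierVector e₁ e₂ 0 ^ 2 + fourierVector e₁ e₂ 1 ^ 2 = -fourierVector e₁ e₂ 2 ^ 2 := by
  have := fourierVector_dotProduct_self_of_orthonormal he 1
  rw [one_smul, one_smul, dotProduct, Fin.sum_univ_three] at this
  linear_combination this

theorem hasTopFourierCoeff_horizontalInner_tangent (he : Orthonormal ℝ ![e₁, e₂]) :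
    HasTopFourierCoeff 2 (fun θ => horizontalInner (rot e₂ (-e₁) θ) (rot e₂ (-e₁) θ))
      (fourierVector e₁ e₂ 2 ^ 2 / 4) := by
  have hT := hasTopFourierCoeff_rot e₂ (-e₁)
  refine Eq.subst (motive := HasTopFourierCoeff 2 _) ?_ (HasTopFourierCoeff.horizontalInner hT hT)
  simp only [fourierVector_neg_right, Pi.smul_apply, smul_eq_mul]
  linear_combination -(1 / 4 : ℂ) * fourierVector_sq_add_sq_of_orthonormal he +
    (fourierVector e₁ e₂ 0 ^ 2 + fourierVector e₁ e₂ 1 ^ 2) / 4 * Complex.I_sq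

theorem hasTopFourierCoeff_horizontalInner_add_rot (he : Orthonormal ℝ ![e₁, e₂]) (d : E3) (q : ℝ) :
    HasTopFourierCoeff 2 (fun θ => horizontalInner (d + q • rot e₁ e₂ θ) (d + q • rot e₁ e₂ θ))
      (-(q ^ 2 * fourierVector e₁ e₂ 2 ^ 2 / 4)) := by
  have hD := hasTopFourierCoeff_add_rot d (q • e₁) (q • e₂)
  have smul_rot (θ : ℝ) : rot (q • e₁) (q • e₂) θ = q • rot e₁ e₂ θ := by simp only [rot]; module
  simp only [smul_rot] at hD
  refine Eq.subst (motive := HasTopFourierCoeff 2 _) ?_ (HasTopFourierCoeff.horizontalInner hD hD)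
  have smul_apply (i : Fin 3) : fourierVector (q • e₁) (q • e₂) i = q * fourierVector e₁ e₂ i := by
    simp only [fourierVector, PiLp.smul_apply, smul_eq_mul, Complex.ofReal_mul]; ring
  simp only [smul_apply]
  linear_combination (q ^ 2 / 4 : ℂ) * fourierVector_sq_add_sq_of_orthonormal he

theorem inner_rot_eq_zero_of_third_harmonic (he : Orthonormal ℝ ![e₁, e₂])
    {p d : E3} {r α k q : ℝ} (h₃ : ¬(e₁ 2 = 0 ∧ e₂ 2 = 0)) (hr : r ≠ 0)
    (h : ∀ θ, r * horizontalInner (rot e₂ (-e₁) θ) (rot e₂ (-e₁) θ) * (⟪p, rot e₁ e₂ θ⟫ + α)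
      + k * horizontalInner (d + q • rot e₁ e₂ θ) (d + q • rot e₁ e₂ θ) = 0) (θ : ℝ) :
    ⟪p, rot e₁ e₂ θ⟫ = 0 := by
  have inner_rot (θ : ℝ) : ⟪p, rot e₁ e₂ θ⟫ = ⟪p, e₁⟫ * Real.cos θ + ⟪p, e₂⟫ * Real.sin θ := by
    simp only [rot, inner_add_right, real_inner_smul_right]; ring
  have top := ((((HasTopFourierCoeff.const r).mul
    (hasTopFourierCoeff_horizontalInner_tangent he)).mul
      (HasTopFourierCoeff.linear α ⟪p, e₁⟫ ⟪p, e₂⟫)).add ((HasTopFourierCoeff.const k).mul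
        (hasTopFourierCoeff_horizontalInner_add_rot he d q)).raise).eq_zero fun θ => by
    rw [← h θ, inner_rot]; ring
  have : ((⟪p, e₁⟫ : ℝ) : ℂ) - (⟪p, e₂⟫ : ℝ) * Complex.I = 0 := by
    simpa [hr, mt fourierVector_apply_eq_zero_iff.1 h₃] using top
  obtain ⟨h₁, h₂⟩ : ⟪p, e₁⟫ = 0 ∧ ⟪p, e₂⟫ = 0 := by simpa [Complex.ext_iff] using this
  rw [inner_rot, h₁, h₂]
  ring

theorem mul_eq_mul_sq_of_second_harmonic (he : Orthonormal ℝ ![e₁, e₂])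
    {p d : E3} {r α k q : ℝ} (h₃ : ¬(e₁ 2 = 0 ∧ e₂ 2 = 0))
    (h : ∀ θ, r * horizontalInner (rot e₂ (-e₁) θ) (rot e₂ (-e₁) θ) * (⟪p, rot e₁ e₂ θ⟫ + α)
      + k * horizontalInner (d + q • rot e₁ e₂ θ) (d + q • rot e₁ e₂ θ) = 0)
    (hp : ∀ θ, ⟪p, rot e₁ e₂ θ⟫ = 0) : r * α = k * q ^ 2 := by
  have top := (((HasTopFourierCoeff.const (r * α)).mul
    (hasTopFourierCoeff_horizontalInner_tangent he)).add ((HasTopFourierCoeff.const k).mul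
      (hasTopFourierCoeff_horizontalInner_add_rot he d q))).eq_zero fun θ => by
    rw [← h θ, hp]; ring
  have factored : ((r * α - k * q ^ 2 : ℝ) : ℂ) * fourierVector e₁ e₂ 2 ^ 2 = 0 := by
    push_cast at top ⊢
    linear_combination 4 * top
  rw [mul_eq_zero, or_iff_left (pow_ne_zero 2 (mt fourierVector_apply_eq_zero_iff.1 h₃))]
    at factored
  exact sub_eq_zero.1 (by exact_mod_cast factored)

theorem eq_zero_of_horizontalInner_add_rot_eq_zero (he : Orthonormal ℝ ![e₁, e₂]) {d : E3} {q : ℝ}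
    (h : ∀ θ, horizontalInner (d + q • rot e₁ e₂ θ) (d + q • rot e₁ e₂ θ) = 0) :
    q = 0 ∧ d 0 = 0 ∧ d 1 = 0 := by
  have key {i : Fin 3} (hi : ∀ θ, d i + q * (e₁ i * Real.cos θ + e₂ i * Real.sin θ) = 0) :
      d i = 0 ∧ q * e₁ i = 0 ∧ q * e₂ i = 0 := by
    have at_zero := hi 0
    have at_pi := hi Real.pi
    have at_pi_div_two := hi (Real.pi / 2)
    simp only [Real.cos_zero, Real.sin_zero, Real.cos_pi, Real.sin_pi, Real.cos_pi_div_two,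
      Real.sin_pi_div_two] at at_zero at_pi at_pi_div_two
    refine ⟨?_, ?_, ?_⟩ <;> linarith
  have coord (θ : ℝ) := horizontalInner_self_eq_zero.1 (h θ)
  simp only [PiLp.add_apply, PiLp.smul_apply, smul_eq_mul, rot_apply] at coord
  obtain ⟨hd₀, h₁₀, h₂₀⟩ := key fun θ => (coord θ).1
  obtain ⟨hd₁, h₁₁, h₂₁⟩ := key fun θ => (coord θ).2
  refine ⟨by_contra fun hq => ?_, hd₀, hd₁⟩
  have := norm_cross_sq_of_orthonormal he
  rw [mul_eq_zero, or_iff_right hq] at h₁₀ h₂₀ h₁₁ h₂₁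
  simp [norm_sq_coord, h₁₀, h₂₀, h₁₁, h₂₁] at this

theorem vertical_translation_of_parallelLaplacian_eq_zero (he : Orthonormal ℝ ![e₁, e₂])
    {c₁ c₂ : E3} {r r₁ r₂ : ℝ} (hr : r ≠ 0)
    (h₃ : ¬(e₁ 2 = 0 ∧ e₂ 2 = 0)) (hk : ⟪cross e₁ e₂, c₁⟫ ≠ 0)
    (h : ∀ θ, parallelLaplacian c₁ c₂ (rot e₁ e₂ θ) (rot e₂ (-e₁) θ) r r₁ r₂ = 0) :
    r₁ = 0 ∧ c₁ 0 = 0 ∧ c₁ 1 = 0 := by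
  simp only [parallelLaplacian, cross_rot_rot] at h
  set k := ⟪cross e₁ e₂, c₁⟫
  set y := ⟪cross e₁ e₂, c₂⟫
  replace h (θ : ℝ) : r * horizontalInner (rot e₂ (-e₁) θ) (rot e₂ (-e₁) θ) *
      (⟪y • c₁ - k • c₂, rot e₁ e₂ θ⟫ + (y * r₁ - k * r₂)) +
        k * horizontalInner (c₁ + r₁ • rot e₁ e₂ θ) (c₁ + r₁ • rot e₁ e₂ θ) = 0 := by
    rw [← h θ, inner_sub_left, real_inner_smul_left, real_inner_smul_left]
    ring
  have third := inner_rot_eq_zero_of_third_harmonic he h₃ hr h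
  have second := mul_eq_mul_sq_of_second_harmonic he h₃ h third
  refine eq_zero_of_horizontalInner_add_rot_eq_zero he fun θ => ?_
  have sum_eq_zero : k * (r₁ ^ 2 * horizontalInner (rot e₂ (-e₁) θ) (rot e₂ (-e₁) θ) +
      horizontalInner (c₁ + r₁ • rot e₁ e₂ θ) (c₁ + r₁ • rot e₁ e₂ θ)) = 0 := by
    have := h θ
    rw [third θ] at this
    linear_combination this - horizontalInner (rot e₂ (-e₁) θ) (rot e₂ (-e₁) θ) * second
  exact ((add_eq_zero_iff_of_nonneg
    (mul_nonneg (sq_nonneg r₁) (horizontalInner_self_nonneg _)) (horizontalInner_self_nonneg _)).1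
    ((mul_eq_zero.1 sum_eq_zero).resolve_left hk)).2

end Orthonormal

namespace CyclicSurface

variable {C : CyclicSurface} {s : ℝ}

variable (C) in
/-- The angular velocity of the frame `e₁, e₂` inside its plane. -/
noncomputable def spin (s : ℝ) : ℝ := ⟪deriv C.e₁ s, C.e₂ s⟫

theorem IsStationaryAt.deriv_frame (h : C.IsStationaryAt s) (hs : s ∈ C.I) :
    deriv C.e₁ s = C.spin s • C.e₂ s ∧ deriv C.e₂ s = -(C.spin s • C.e₁ s) := by
  have hI := C.interval.1
  have he₁ := hasDerivAt_of_contDiffOn C.e₁_smooth hI hs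
  have he₂ := hasDerivAt_of_contDiffOn C.e₂_smooth hI hs
  have frame (t : ℝ) (ht : t ∈ C.I) := orthonormal_pair_iff.1 (C.orthonormal t ht)
  have near := hI.mem_nhds hs
  have h₁₁ := inner_left_eq_neg_of_hasDerivAt he₁ he₁
    (Filter.eventually_of_mem near fun t ht => (frame t ht).1)
  have h₂₂ := inner_left_eq_neg_of_hasDerivAt he₂ he₂
    (Filter.eventually_of_mem near fun t ht => (frame t ht).2.1)
  have h₁₂ := inner_left_eq_neg_of_hasDerivAt he₁ he₂
    (Filter.eventually_of_mem near fun t ht => (frame t ht).2.2)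
  have d₁ := orthonormal_decomposition (C.orthonormal s hs) (deriv C.e₁ s)
  have d₂ := orthonormal_decomposition (C.orthonormal s hs) (deriv C.e₂ s)
  rw [← normal, h.1, show ⟪deriv C.e₁ s, C.e₁ s⟫ = 0 by
    rw [real_inner_comm] at h₁₁ ⊢; linarith, ← spin] at d₁
  rw [← normal, h.2, show ⟪deriv C.e₂ s, C.e₂ s⟫ = 0 by
    rw [real_inner_comm] at h₂₂ ⊢; linarith, show ⟪deriv C.e₂ s, C.e₁ s⟫ = -C.spin s by
    rw [spin, h₁₂, neg_neg, real_inner_comm]] at d₂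
  exact ⟨by simpa using d₁, by simpa using d₂⟩

namespace IsAnisotropicMinimal

theorem hasDerivAt_frame (hC : C.IsAnisotropicMinimal) (hs : s ∈ C.I) :
    HasDerivAt C.e₁ (C.spin s • C.e₂ s) s ∧ HasDerivAt C.e₂ (-(C.spin s • C.e₁ s)) s := by
  have hI := C.interval.1
  obtain ⟨h₁, h₂⟩ := (hC.isStationaryAt hs).deriv_frame hs
  exact ⟨h₁ ▸ hasDerivAt_of_contDiffOn C.e₁_smooth hI hs,
    h₂ ▸ hasDerivAt_of_contDiffOn C.e₂_smooth hI hs⟩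

theorem deriv_E₁ (hC : C.IsAnisotropicMinimal) (hs : s ∈ C.I) :
    deriv C.E₁ s = deriv C.radius s • C.e₁ s + (C.radius s * C.spin s) • C.e₂ s := by
  have hr := hasDerivAt_of_contDiffOn C.radius_smooth C.interval.1 hs
  have : deriv C.E₁ s = _ := (hr.smul (hC.hasDerivAt_frame hs).1).deriv
  rw [this]; module

theorem deriv_E₂ (hC : C.IsAnisotropicMinimal) (hs : s ∈ C.I) :
    deriv C.E₂ s = deriv C.radius s • C.e₂ s - (C.radius s * C.spin s) • C.e₁ s := by
  have hr := hasDerivAt_of_contDiffOn C.radius_smooth C.interval.1 hs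
  have : deriv C.E₂ s = _ := (hr.smul (hC.hasDerivAt_frame hs).2).deriv
  rw [this]; module

theorem exists_deriv_deriv_E (hC : C.IsAnisotropicMinimal) (hs : s ∈ C.I) :
    ∃ k : ℝ,
      deriv (deriv C.E₁) s =
          (deriv (deriv C.radius) s - C.radius s * C.spin s ^ 2) • C.e₁ s + k • C.e₂ s ∧
        deriv (deriv C.E₂) s =
          (deriv (deriv C.radius) s - C.radius s * C.spin s ^ 2) • C.e₂ s - k • C.e₁ s := by
  have hI := C.interval.1
  have hr' := hasDerivAt_of_contDiffOn (contDiffOn_deriv C.radius_smooth hI) hI hs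
  have hrw := hasDerivAt_of_contDiffOn
    (C.radius_smooth.mul ((contDiffOn_deriv C.e₁_smooth hI).inner ℝ C.e₂_smooth)) hI hs
  obtain ⟨he₁, he₂⟩ := hC.hasDerivAt_frame hs
  have h₁ := ((hr'.smul he₁).add (hrw.smul he₂)).congr_of_eventuallyEq
    (Filter.eventually_of_mem (hI.mem_nhds hs) fun t ht => hC.deriv_E₁ ht)
  have h₂ := ((hr'.smul he₂).sub (hrw.smul he₁)).congr_of_eventuallyEq
    (Filter.eventually_of_mem (hI.mem_nhds hs) fun t ht => hC.deriv_E₂ ht)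
  refine ⟨deriv C.radius s * C.spin s + deriv (fun t => C.radius t * C.spin t) s, ?_, ?_⟩
  · rw [h₁.deriv]; simp only [spin]; module
  · rw [h₂.deriv]; simp only [spin]; module

theorem parallelLaplacian_eq_zero (hC : C.IsAnisotropicMinimal) (hs : s ∈ C.I) (θ : ℝ) :
    parallelLaplacian (deriv C.center s) (deriv (deriv C.center) s) (rot (C.e₁ s) (C.e₂ s) θ)
      (rot (C.e₂ s) (-C.e₁ s) θ) (C.radius s) (deriv C.radius s) (deriv (deriv C.radius) s) =
      0 := by
  have h := hC.laplacian_eq_zero hs θ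
  obtain ⟨k, h₁, h₂⟩ := hC.exists_deriv_deriv_E hs
  rw [laplacian, hC.deriv_E₁ hs, hC.deriv_E₂ hs, h₁, h₂, E₁, E₂,
    circleLaplacian_of_orthonormal (C.orthonormal s hs)] at h
  exact (mul_eq_zero.1 h).resolve_left (pow_ne_zero 2 (C.radius_pos s hs).ne')

end IsAnisotropicMinimal

end CyclicSurface

/-! ### Inclined planes -/

namespace CyclicSurface

variable {C : CyclicSurface} {s : ℝ}

theorem inner_e₁_normal (s : ℝ) : ⟪C.e₁ s, C.normal s⟫ = 0 := by
  rw [real_inner_comm]; exact inner_cross_left _ _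

theorem inner_e₂_normal (s : ℝ) : ⟪C.e₂ s, C.normal s⟫ = 0 := by
  rw [real_inner_comm]; exact inner_cross_right _ _

namespace IsAnisotropicMinimal

theorem inner_deriv_center_normal (hC : C.IsAnisotropicMinimal) (hs : s ∈ C.I)
    (h : ¬C.IsHorizontalAt s) : ⟪C.normal s, deriv C.center s⟫ = 0 := by
  by_contra hne
  have hI := C.interval.1
  have hcont : ContinuousAt (fun t => ⟪C.normal t, deriv C.center t⟫) s :=
    (hasDerivAt_normal hs).continuousAt.inner
      (hasDerivAt_of_contDiffOn (contDiffOn_deriv C.center_smooth hI) hI hs).continuousAt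
  obtain ⟨⟨t, θ⟩, hq, hne_t⟩ := hC.exists_regular hs 0
    (continuousAt_fst.eventually (hcont.eventually_ne hne))
  have ht : t ∈ C.I := hq.1
  obtain ⟨hr₁, hc₀, hc₁⟩ := vertical_translation_of_parallelLaplacian_eq_zero (C.orthonormal t ht)
    (C.radius_pos t ht).ne' (mt (hC.isHorizontalAt_iff hs ht).2 h) hne_t
    (hC.parallelLaplacian_eq_zero ht)
  refine unitNormal_two_ne_zero_iff.1 hq.2 ?_
  rw [ds_X ht, dθ_X, hC.deriv_E₁ ht, hC.deriv_E₂ ht, hr₁, E₁, E₂]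
  simp [rot_apply, hc₀, hc₁]
  ring

theorem normal_two_ne_zero (hC : C.IsAnisotropicMinimal) (hs : s ∈ C.I)
    (h : ¬C.IsHorizontalAt s) : C.normal s 2 ≠ 0 := by
  intro hz
  obtain ⟨⟨t, θ⟩, hq, -⟩ := hC.exists_regular hs 0 (P := fun _ => True) (by simp)
  have ht : t ∈ C.I := hq.1
  have hc := hC.inner_deriv_center_normal ht (mt (hC.isHorizontalAt_iff hs ht).2 h)
  rw [real_inner_comm] at hc
  have ds_tangent : ⟪ds C.X t θ, C.normal t⟫ = 0 := by
    rw [ds_X ht, hC.deriv_E₁ ht, hC.deriv_E₂ ht]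
    simp [rot, inner_add_left, inner_sub_left, real_inner_smul_left, inner_e₁_normal,
      inner_e₂_normal, hc]
  have dθ_tangent : ⟪dθ C.X t θ, C.normal t⟫ = 0 := by
    rw [dθ_X, E₁, E₂]
    simp [rot, inner_add_left, inner_neg_left, real_inner_smul_left, inner_e₁_normal,
      inner_e₂_normal]
  refine unitNormal_two_ne_zero_iff.1 hq.2 ?_
  rw [cross_eq_smul_of_orthonormal (C.orthonormal t ht) ds_tangent dθ_tangent, ← normal,
    PiLp.smul_apply, hC.normal_two_eq ht hs, hz, smul_zero]

theorem inner_normal_X (hC : C.IsAnisotropicMinimal) {s₀ : ℝ} (hs₀ : s₀ ∈ C.I)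
    (h : ¬C.IsHorizontalAt s₀) (hs : s ∈ C.I) (θ : ℝ) :
    ⟪C.normal s₀, C.X s θ⟫ = ⟪C.normal s₀, C.center s₀⟫ := by
  have center_eq : ⟪C.normal s₀, C.center s⟫ = ⟪C.normal s₀, C.center s₀⟫ := by
    refine C.interval.eq_of_hasDerivAt_zero (f := fun t => ⟪C.normal s₀, C.center t⟫)
      (fun t ht => ?_) hs hs₀
    refine ((hasDerivAt_const t (C.normal s₀)).inner ℝ
      (hasDerivAt_of_contDiffOn C.center_smooth C.interval.1 ht)).congr_deriv ?_
    rw [inner_zero_left, add_zero, hC.normal_eq hs₀ ht,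
      hC.inner_deriv_center_normal ht (mt (hC.isHorizontalAt_iff hs₀ ht).2 h)]
  have h₁ := inner_e₁_normal (C := C) s
  have h₂ := inner_e₂_normal (C := C) s
  rw [real_inner_comm, hC.normal_eq hs hs₀] at h₁ h₂
  rw [X_eq, rot, E₁, E₂]
  simp [inner_add_right, real_inner_smul_right, h₁, h₂, center_eq]

theorem isInclinedPlanePiece (hC : C.IsAnisotropicMinimal) (hs : s ∈ C.I)
    (h : ¬C.IsHorizontalAt s) : IsInclinedPlanePiece C.carrier := by
  have hz := hC.normal_two_ne_zero hs h
  refine ⟨⟨C, rfl⟩, -(C.normal s 0 / C.normal s 2), -(C.normal s 1 / C.normal s 2),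
    ⟪C.normal s, C.center s⟫ / C.normal s 2, fun hAB => h ?_, ?_⟩
  · simp only [Prod.mk.injEq, neg_eq_zero, div_eq_zero_iff, hz, or_false] at hAB
    have unit := norm_cross_sq_of_orthonormal (C.orthonormal s hs)
    rw [← normal, norm_sq_coord, hAB.1, hAB.2] at unit
    exact (isHorizontalAt_iff_normal hs).2 (by linarith)
  · rintro _ ⟨t, ht, θ, rfl⟩
    rw [← hC.inner_normal_X hs h ht θ, inner_coord]
    field_simp
    ring

end IsAnisotropicMinimal

end CyclicSurface

/-! ### Horizontal circles -/

theorem exists_cos_sin_eq {p q : ℝ} (h : p ^ 2 + q ^ 2 = 1) :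
    ∃ θ : ℝ, Real.cos θ = p ∧ Real.sin θ = q := by
  have hn : ‖(⟨p, q⟩ : ℂ)‖ = 1 := by
    rw [Complex.norm_def, Complex.normSq_mk, Real.sqrt_eq_one]; linarith
  refine ⟨Complex.arg ⟨p, q⟩, ?_, ?_⟩
  · rw [Complex.cos_arg (norm_ne_zero_iff.1 (by rw [hn]; exact one_ne_zero)), hn, div_one]
  · rw [Complex.sin_arg, hn, div_one]

theorem inner_cross_of_horizontal {e₁ e₂ : E3} (h₁ : e₁ 2 = 0) (h₂ : e₂ 2 = 0) (u : E3) :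
    ⟪cross e₁ e₂, u⟫ = cross e₁ e₂ 2 * u 2 := by
  simp [inner_coord, h₁, h₂]

theorem orthonormal_standard : Orthonormal ℝ ![(!₂[1, 0, 0] : E3), !₂[0, 1, 0]] :=
  orthonormal_pair_iff.2 (by simp only [inner_coord]; simp)

theorem rot_standard (θ : ℝ) : rot !₂[1, 0, 0] !₂[0, 1, 0] θ = !₂[Real.cos θ, Real.sin θ, 0] := by
  apply E3.ext_coord <;> simp [rot_apply]

section Orthonormal

variable {e₁ e₂ : E3}

theorem range_rot_of_orthonormal (he : Orthonormal ℝ ![e₁, e₂]) :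
    Set.range (rot e₁ e₂) = {u | ‖u‖ = 1 ∧ ⟪u, cross e₁ e₂⟫ = 0} := by
  ext u
  constructor
  · rintro ⟨θ, rfl⟩
    refine ⟨(orthonormal_rot he θ).1 0, ?_⟩
    rw [← cross_rot_rot e₁ e₂ θ, real_inner_comm, inner_cross_left]
  · rintro ⟨hu, hn⟩
    have decomposition := orthonormal_decomposition he u
    rw [hn, zero_smul, add_zero] at decomposition
    have coord_sq : ⟪u, e₁⟫ ^ 2 + ⟪u, e₂⟫ ^ 2 = 1 := by
      have := congrArg (⟪u, ·⟫) decomposition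
      rw [real_inner_self_eq_norm_sq, hu, inner_add_right, real_inner_smul_right,
        real_inner_smul_right] at this
      linarith
    obtain ⟨θ, hcos, hsin⟩ := exists_cos_sin_eq coord_sq
    exact ⟨θ, by rw [rot, hcos, hsin, ← decomposition]⟩

theorem cross_two_ne_zero_of_horizontal (he : Orthonormal ℝ ![e₁, e₂])
    (h₁ : e₁ 2 = 0) (h₂ : e₂ 2 = 0) : cross e₁ e₂ 2 ≠ 0 := by
  intro hn
  have := cross_two_sq_add_of_orthonormal he
  rw [hn, h₁, h₂] at this
  norm_num at this

theorem range_rot_of_horizontal (he : Orthonormal ℝ ![e₁, e₂]) (h₁ : e₁ 2 = 0) (h₂ : e₂ 2 = 0) :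
    Set.range (rot e₁ e₂) = {u | ‖u‖ = 1 ∧ u 2 = 0} := by
  rw [range_rot_of_orthonormal he]
  refine Set.ext fun u => and_congr_right fun _ => ?_
  rw [real_inner_comm, inner_cross_of_horizontal h₁ h₂, mul_eq_zero,
    or_iff_right (cross_two_ne_zero_of_horizontal he h₁ h₂)]

theorem exists_eq_smul_rot_of_horizontal (he : Orthonormal ℝ ![e₁, e₂])
    (h₁ : e₁ 2 = 0) (h₂ : e₂ 2 = 0) {u : E3} (hu : u 2 = 0) :
    ∃ k θ : ℝ, u = k • rot e₁ e₂ θ := by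
  by_cases hzero : u = 0
  · exact ⟨0, 0, by rw [hzero, zero_smul]⟩
  · have hnorm := norm_ne_zero_iff.2 hzero
    obtain ⟨θ, hθ⟩ : ‖u‖⁻¹ • u ∈ Set.range (rot e₁ e₂) := by
      rw [range_rot_of_horizontal he h₁ h₂]
      simp [norm_smul, hnorm, hu]
    exact ⟨‖u‖, θ, by rw [hθ, smul_inv_smul₀ hnorm]⟩

theorem parallelLaplacian_of_horizontal (he : Orthonormal ℝ ![e₁, e₂])
    (h₁ : e₁ 2 = 0) (h₂ : e₂ 2 = 0) (c₁ c₂ : E3) (r r₁ r₂ : ℝ) :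
    parallelLaplacian c₁ c₂ e₁ e₂ r r₁ r₂ = cross e₁ e₂ 2 *
      (r * (c₂ 2 * (c₁ 0 * e₁ 0 + c₁ 1 * e₁ 1 + r₁) - c₁ 2 * (c₂ 0 * e₁ 0 + c₂ 1 * e₁ 1 + r₂))
        + c₁ 2 * ((c₁ 0 + r₁ * e₁ 0) ^ 2 + (c₁ 1 + r₁ * e₁ 1) ^ 2)) := by
  have tangent : horizontalInner e₂ e₂ = 1 := by
    have := (orthonormal_pair_iff.1 he).2.1
    rwa [inner_coord, h₂, mul_zero, add_zero] at this
  rw [parallelLaplacian, tangent, inner_cross_of_horizontal h₁ h₂, inner_cross_of_horizontal h₁ h₂]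
  simp only [inner_coord, horizontalInner, h₁, PiLp.add_apply, PiLp.smul_apply, smul_eq_mul]
  ring

/-- The three equations are the constant term and the two first harmonics. -/
theorem horizontal_equations (he : Orthonormal ℝ ![e₁, e₂]) (h₁ : e₁ 2 = 0) (h₂ : e₂ 2 = 0)
    {c₁ c₂ : E3} {r r₁ r₂ : ℝ}
    (h : ∀ θ, parallelLaplacian c₁ c₂ (rot e₁ e₂ θ) (rot e₂ (-e₁) θ) r r₁ r₂ = 0) :
    r * (r₁ * c₂ 2 - c₁ 2 * r₂) + c₁ 2 * (c₁ 0 ^ 2 + c₁ 1 ^ 2 + r₁ ^ 2) = 0 ∧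
      r * (c₂ 2 * c₁ 0 - c₁ 2 * c₂ 0) + 2 * r₁ * c₁ 2 * c₁ 0 = 0 ∧
      r * (c₂ 2 * c₁ 1 - c₁ 2 * c₂ 1) + 2 * r₁ * c₁ 2 * c₁ 1 = 0 := by
  have on_circle (x y : ℝ) (hxy : x ^ 2 + y ^ 2 = 1) :
      r * (c₂ 2 * (c₁ 0 * x + c₁ 1 * y + r₁) - c₁ 2 * (c₂ 0 * x + c₂ 1 * y + r₂))
        + c₁ 2 * ((c₁ 0 + r₁ * x) ^ 2 + (c₁ 1 + r₁ * y) ^ 2) = 0 := by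
    obtain ⟨θ, hθ⟩ : !₂[x, y, 0] ∈ Set.range (rot e₁ e₂) := by
      rw [range_rot_of_horizontal he h₁ h₂]
      exact ⟨by rw [EuclideanSpace.norm_eq]; simp [Fin.sum_univ_three, hxy], rfl⟩
    have hE : rot e₁ e₂ θ 2 = 0 := by rw [hθ]; rfl
    have hT : rot e₂ (-e₁) θ 2 = 0 := by simp [rot_apply, h₁, h₂]
    have hp := h θ
    rw [parallelLaplacian_of_horizontal (orthonormal_rot he θ) hE hT, mul_eq_zero,
      or_iff_right (cross_two_ne_zero_of_horizontal (orthonormal_rot he θ) hE hT), hθ] at hp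
    simpa using hp
  have east := on_circle 1 0 (by norm_num)
  have west := on_circle (-1) 0 (by norm_num)
  have north := on_circle 0 1 (by norm_num)
  refine ⟨?_, ?_, ?_⟩ <;> linarith

end Orthonormal

theorem eventually_eq_zero_of_linear_ode {y g : ℝ → ℝ} {s : ℝ} (hg : ContinuousAt g s)
    (h : ∀ᶠ t in nhds s, HasDerivAt y (g t * y t) t) (h0 : y s = 0) :
    ∀ᶠ t in nhds s, y t = 0 := by
  have lipschitz : ∀ᶠ t in nhds s, LipschitzOnWith (‖g s‖₊ + 1) (g t * ·) Set.univ := by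
    filter_upwards [hg.nnnorm.eventually_lt_const (lt_add_one _)] with t ht
    exact ((lipschitzWith_smul (g t)).weaken ht.le).lipschitzOnWith
  exact ODE_solution_unique_of_eventually (v := fun t x => g t * x) lipschitz
    (h.mono fun _ ht => ⟨ht, trivial⟩)
    (.of_forall fun t => ⟨by simpa using hasDerivAt_const t (0 : ℝ), trivial⟩) h0

theorem eq_zero_of_forall_eventually_eq_zero {T : Type*} [TopologicalSpace T] {I : Set T}
    (hI : IsPreconnected I) {f : T → ℝ} (hf : ∀ t ∈ I, ContinuousAt f t)
    (h : ∀ t ∈ I, f t = 0 → ∀ᶠ x in nhds t, f x = 0) {s t : T} (hs : s ∈ I) (hfs : f s = 0)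
    (ht : t ∈ I) : f t = 0 := by
  refine (hI.subset_of_closure_inter_subset (u := {t | ∀ᶠ x in nhds t, f x = 0})
    isOpen_setOfPred_eventually_nhds ⟨s, hs, h s hs hfs⟩ ?_ ht).self_of_nhds
  rintro t ⟨ht, htI⟩
  refine h t htI (by_contra fun hne => ?_)
  obtain ⟨x, hx, hx'⟩ := ((mem_closure_iff_frequently.1 ht).and_eventually
    ((hf t htI).eventually_ne hne)).exists
  exact hx' hx.self_of_nhds

namespace CyclicSurface

variable {C : CyclicSurface} {s : ℝ}

theorem carrier_eq_of_horizontal (h : ∀ s ∈ C.I, C.IsHorizontalAt s) :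
    C.carrier = {p | ∃ s ∈ C.I, ∃ θ : ℝ,
      p = C.center s + C.radius s • !₂[Real.cos θ, Real.sin θ, 0]} := by
  have same_circle (s : ℝ) (hs : s ∈ C.I) : Set.range (rot (C.e₁ s) (C.e₂ s)) =
      Set.range (rot !₂[1, 0, 0] !₂[0, 1, 0]) := by
    rw [range_rot_of_horizontal (C.orthonormal s hs) (h s hs).1 (h s hs).2,
      range_rot_of_horizontal orthonormal_standard rfl rfl]
  ext p
  constructor
  · rintro ⟨s, hs, θ, rfl⟩
    obtain ⟨φ, hφ⟩ := (same_circle s hs).subset ⟨θ, rfl⟩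
    exact ⟨s, hs, φ, by rw [← rot_standard, hφ]; rfl⟩
  · rintro ⟨s, hs, θ, rfl⟩
    obtain ⟨φ, hφ⟩ := (same_circle s hs).superset ⟨θ, rfl⟩
    exact ⟨s, hs, φ, by rw [← rot_standard, ← hφ]; rfl⟩

namespace IsAnisotropicMinimal

/-- Otherwise some point of the circle would move along the circle. -/
theorem deriv_radius_ne_zero (hC : C.IsAnisotropicMinimal) (hs : s ∈ C.I)
    (h : C.IsHorizontalAt s) (hz : deriv C.center s 2 = 0) : deriv C.radius s ≠ 0 := by
  intro hr
  obtain ⟨h₁, h₂, h₁₂⟩ := orthonormal_pair_iff.1 (C.orthonormal s hs)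
  have he : Orthonormal ℝ ![C.e₂ s, -C.e₁ s] :=
    orthonormal_pair_iff.2 ⟨h₂, by simpa using h₁, by rw [inner_neg_right, real_inner_comm, h₁₂,
      neg_zero]⟩
  obtain ⟨k, θ, hk⟩ := exists_eq_smul_rot_of_horizontal he h.2 (by simp [h.1]) hz
  have independent : LinearIndependent ℝ ![ds C.X s θ, dθ C.X s θ] := C.immersion s hs θ
  rw [ds_X hs, dθ_X, hC.deriv_E₁ hs, hC.deriv_E₂ hs, hr, hk, E₁, E₂,
    LinearIndependent.pair_iff] at independent
  refine (C.radius_pos s hs).ne'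
    (independent (C.radius s) (-(k + C.radius s * C.spin s)) ?_).1
  simp only [rot]
  module

theorem horizontal_equations (hC : C.IsAnisotropicMinimal) (hs : s ∈ C.I)
    (h : C.IsHorizontalAt s) :
    C.radius s * (deriv C.radius s * deriv (deriv C.center) s 2
        - deriv C.center s 2 * deriv (deriv C.radius) s) + deriv C.center s 2 *
          (deriv C.center s 0 ^ 2 + deriv C.center s 1 ^ 2 + deriv C.radius s ^ 2) = 0 ∧
      C.radius s * (deriv (deriv C.center) s 2 * deriv C.center s 0
        - deriv C.center s 2 * deriv (deriv C.center) s 0)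
          + 2 * deriv C.radius s * deriv C.center s 2 * deriv C.center s 0 = 0 ∧
      C.radius s * (deriv (deriv C.center) s 2 * deriv C.center s 1
        - deriv C.center s 2 * deriv (deriv C.center) s 1)
          + 2 * deriv C.radius s * deriv C.center s 2 * deriv C.center s 1 = 0 :=
  DirichletCyclic.horizontal_equations (C.orthonormal s hs) h.1 h.2
    (hC.parallelLaplacian_eq_zero hs)

theorem eventually_deriv_center_two_eq_zero (hC : C.IsAnisotropicMinimal)
    (h : ∀ s ∈ C.I, C.IsHorizontalAt s) (hs : s ∈ C.I) (hz : deriv C.center s 2 = 0) :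
    ∀ᶠ t in nhds s, deriv C.center t 2 = 0 := by
  have hI := C.interval.1
  have hc' {t : ℝ} (ht : t ∈ C.I) (i : Fin 3) := hasDerivAt_coord
    (hasDerivAt_of_contDiffOn (contDiffOn_deriv C.center_smooth hI) hI ht) i
  have hr := (hasDerivAt_of_contDiffOn C.radius_smooth hI hs).continuousAt
  have hr' := (contDiffOn_deriv C.radius_smooth hI)
  have hr'_cont := (hasDerivAt_of_contDiffOn hr' hI hs).continuousAt
  have hr''_cont := (hasDerivAt_of_contDiffOn (contDiffOn_deriv hr' hI) hI hs).continuousAt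
  have hne := hC.deriv_radius_ne_zero hs (h s hs) hz
  refine eventually_eq_zero_of_linear_ode (g := fun t => (C.radius t * deriv (deriv C.radius) t -
    (deriv C.center t 0 ^ 2 + deriv C.center t 1 ^ 2 + deriv C.radius t ^ 2)) /
    (C.radius t * deriv C.radius t)) ?_ ?_ hz
  · exact ((hr.mul hr''_cont).sub ((((hc' hs 0).continuousAt.pow 2).add
      ((hc' hs 1).continuousAt.pow 2)).add (hr'_cont.pow 2))).div (hr.mul hr'_cont)
      (mul_ne_zero (C.radius_pos s hs).ne' hne)
  · filter_upwards [hI.mem_nhds hs, hr'_cont.eventually_ne hne] with t ht hne_t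
    refine (hc' ht 2).congr_deriv ?_
    have := (hC.horizontal_equations ht (h t ht)).1
    have := (C.radius_pos t ht).ne'
    field_simp
    linarith

theorem isHorizontalPlanePiece (hC : C.IsAnisotropicMinimal)
    (h : ∀ s ∈ C.I, C.IsHorizontalAt s) (hs : s ∈ C.I) (hz : deriv C.center s 2 = 0) :
    IsHorizontalPlanePiece C.carrier := by
  have hI := C.interval.1
  have hc' (t : ℝ) (ht : t ∈ C.I) : ContinuousAt (fun t => deriv C.center t 2) t :=
    (hasDerivAt_coord (hasDerivAt_of_contDiffOn (contDiffOn_deriv C.center_smooth hI) hI ht)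
      2).continuousAt
  have hz' {t : ℝ} (ht : t ∈ C.I) : deriv C.center t 2 = 0 :=
    eq_zero_of_forall_eventually_eq_zero C.interval.2.1.isPreconnected hc'
      (fun t ht => hC.eventually_deriv_center_two_eq_zero h ht) hs hz ht
  refine ⟨⟨C, rfl⟩, C.center s 2, ?_⟩
  rintro _ ⟨t, ht, θ, rfl⟩
  have height_eq := C.interval.eq_of_hasDerivAt_zero (f := fun t => C.center t 2) (fun t ht =>
    (hasDerivAt_coord (hasDerivAt_of_contDiffOn C.center_smooth hI ht) 2).congr_deriv (hz' ht))
    ht hs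
  simp [X, circleFamily, (h t ht).1, (h t ht).2, height_eq]

end IsAnisotropicMinimal

end CyclicSurface

/-! ### The profile equation -/

theorem IsOpenInterval.image {I : Set ℝ} (hI : IsOpenInterval I) {f f' : ℝ → ℝ}
    (hf : ∀ s ∈ I, HasStrictDerivAt f (f' s) s) (h0 : ∀ s ∈ I, f' s ≠ 0) :
    IsOpenInterval (f '' I) := by
  refine ⟨isOpen_iff_mem_nhds.2 ?_, ?_, hI.2.2.image f⟩
  · rintro _ ⟨s, hs, rfl⟩
    rw [← (hf s hs).map_nhds_eq (h0 s hs)]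
    exact Filter.image_mem_map (hI.1.mem_nhds hs)
  · exact (hI.2.1.isPreconnected.image f fun s hs =>
      (hf s hs).hasDerivAt.continuousAt.continuousWithinAt).ordConnected

theorem IsOpenInterval.exists_eq_const {I : Set ℝ} (hI : IsOpenInterval I) {f : ℝ → ℝ}
    (h : ∀ s ∈ I, HasDerivAt f 0 s) : ∃ k, ∀ s ∈ I, f s = k :=
  let ⟨s₀, hs₀⟩ := hI.2.2
  ⟨f s₀, fun _ hs => hI.eq_of_hasDerivAt_zero h hs hs₀⟩

/-- As functions of the height `z`, the inverse radius `y` and its derivative `w` satisfy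
`y' = w`, `w' = κ y` and `w² - κ y² = q`. All functions depend on a parameter `s ∈ I`, which need
not be the height. -/
structure IsProfile (I : Set ℝ) (κ q : ℝ) (z y w : ℝ → ℝ) : Prop where
  differentiableAt_height : ∀ s ∈ I, DifferentiableAt ℝ z s
  hasDerivAt_fst : ∀ s ∈ I, HasDerivAt y (deriv z s * w s) s
  hasDerivAt_snd : ∀ s ∈ I, HasDerivAt w (deriv z s * (κ * y s)) s
  firstIntegral : ∀ s ∈ I, w s ^ 2 - κ * y s ^ 2 = q

namespace IsProfile

variable {I : Set ℝ} {κ q : ℝ} {z y w Y W : ℝ → ℝ}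

theorem neg (h : IsProfile I κ q z y w) :
    IsProfile I κ q z (fun s => -y s) (fun s => -w s) where
  differentiableAt_height := h.differentiableAt_height
  hasDerivAt_fst s hs := (h.hasDerivAt_fst s hs).fun_neg.congr_deriv (by ring)
  hasDerivAt_snd s hs := (h.hasDerivAt_snd s hs).fun_neg.congr_deriv (by ring)
  firstIntegral s hs := by rw [neg_sq, neg_sq, h.firstIntegral s hs]

theorem hasDerivAt_div (h : IsProfile I κ q z y w) {s : ℝ} (hs : s ∈ I) (hy : y s ≠ 0) :
    HasDerivAt (fun s => w s / y s) (-(deriv z s * q / y s ^ 2)) s := by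
  refine ((h.hasDerivAt_snd s hs).fun_div (h.hasDerivAt_fst s hs) hy).congr_deriv ?_
  rw [← h.firstIntegral s hs]
  field_simp
  ring

theorem mono {J : Set ℝ} (h : IsProfile J κ q z y w) (hIJ : I ⊆ J) : IsProfile I κ q z y w where
  differentiableAt_height s hs := h.differentiableAt_height s (hIJ hs)
  hasDerivAt_fst s hs := h.hasDerivAt_fst s (hIJ hs)
  hasDerivAt_snd s hs := h.hasDerivAt_snd s (hIJ hs)
  firstIntegral s hs := h.firstIntegral s (hIJ hs)

theorem of_height (hy : ∀ s, HasDerivAt Y (W s) s) (hw : ∀ s, HasDerivAt W (κ * Y s) s)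
    (hq : ∀ s, W s ^ 2 - κ * Y s ^ 2 = q) : IsProfile Set.univ κ q (fun s => s) Y W where
  differentiableAt_height _ _ := differentiableAt_fun_id
  hasDerivAt_fst s _ := (hy s).congr_deriv (by rw [deriv_id'', one_mul])
  hasDerivAt_snd s _ := (hw s).congr_deriv (by rw [deriv_id'', one_mul])
  firstIntegral s _ := hq s

theorem comp_sub_const (h : IsProfile Set.univ κ q (fun s => s) Y W)
    (hz : ∀ s ∈ I, DifferentiableAt ℝ z s) (t : ℝ) :
    IsProfile I κ q z (fun s => Y (z s - t)) (fun s => W (z s - t)) where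
  differentiableAt_height := hz
  hasDerivAt_fst s hs :=
    ((h.hasDerivAt_fst _ trivial).comp s ((hz s hs).hasDerivAt.sub_const t)).congr_deriv
      (by rw [deriv_id'']; ring)
  hasDerivAt_snd s hs :=
    ((h.hasDerivAt_snd _ trivial).comp s ((hz s hs).hasDerivAt.sub_const t)).congr_deriv
      (by rw [deriv_id'']; ring)
  firstIntegral s _ := h.firstIntegral _ trivial

/-- The Wronskian `y W - w Y` and the polarized first integral `w W - κ y Y` are constant. -/
theorem eq_of_eq_at (hI : IsOpenInterval I) (hq : q ≠ 0) (h : IsProfile I κ q z y w)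
    (H : IsProfile I κ q z Y W) {s₀ : ℝ} (hs₀ : s₀ ∈ I) (hy : y s₀ = Y s₀) (hw : w s₀ = W s₀)
    {s : ℝ} (hs : s ∈ I) : y s = Y s ∧ w s = W s := by
  have wronskian : y s * W s - w s * Y s = 0 := by
    rw [hI.eq_of_hasDerivAt_zero (f := fun s => y s * W s - w s * Y s) (fun s hs =>
      (((h.hasDerivAt_fst s hs).fun_mul (H.hasDerivAt_snd s hs)).fun_sub
        ((h.hasDerivAt_snd s hs).fun_mul (H.hasDerivAt_fst s hs))).congr_deriv (by ring)) hs hs₀,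
      hy, hw]
    ring
  have polarized : w s * W s - κ * (y s * Y s) = q := by
    rw [hI.eq_of_hasDerivAt_zero (f := fun s => w s * W s - κ * (y s * Y s)) (fun s hs =>
      (((h.hasDerivAt_snd s hs).fun_mul (H.hasDerivAt_snd s hs)).fun_sub
        (((h.hasDerivAt_fst s hs).fun_mul (H.hasDerivAt_fst s hs)).const_mul κ)).congr_deriv
          (by ring)) hs hs₀, hy, hw, ← H.firstIntegral s₀ hs₀]
    ring
  have H' := H.firstIntegral s hs
  constructor <;> apply mul_left_cancel₀ hq
  · linear_combination W s * wronskian + Y s * polarized - y s * H'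
  · linear_combination κ * Y s * wronskian + W s * polarized - w s * H'

theorem cos {c : ℝ} (hc : c ≠ 0) (k : ℝ) : IsProfile Set.univ (-c ^ 2) (k ^ 2) (fun s => s)
    (fun s => k / c * Real.cos (c * s)) (fun s => -(k * Real.sin (c * s))) := by
  have hmul (s : ℝ) : HasDerivAt (c * ·) c s := by simpa using (hasDerivAt_id s).const_mul c
  refine of_height (fun s => ((hmul s).cos.const_mul _).congr_deriv ?_)
    (fun s => ((hmul s).sin.const_mul k).fun_neg.congr_deriv ?_) fun s => ?_
  · field_simp
  · field_simp
  · field_simp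
    linear_combination k ^ 2 * Real.sin_sq_add_cos_sq (c * s)

theorem affine (k c : ℝ) :
    IsProfile Set.univ 0 (k ^ 2) (fun s => s) (fun s => k * s + c) (fun _ => k) :=
  of_height (fun s => by simpa using ((hasDerivAt_id s).const_mul k).add_const c)
    (fun s => by simpa using hasDerivAt_const s k) fun s => by ring

theorem sinh {c : ℝ} (hc : c ≠ 0) (k : ℝ) : IsProfile Set.univ (c ^ 2) (k ^ 2) (fun s => s)
    (fun s => k / c * Real.sinh (c * s)) (fun s => k * Real.cosh (c * s)) := by
  have hmul (s : ℝ) : HasDerivAt (c * ·) c s := by simpa using (hasDerivAt_id s).const_mul c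
  refine of_height (fun s => ((hmul s).sinh.const_mul _).congr_deriv ?_)
    (fun s => ((hmul s).cosh.const_mul k).congr_deriv ?_) fun s => ?_
  · field_simp
  · field_simp
  · field_simp
    linear_combination k ^ 2 * Real.cosh_sq_sub_sinh_sq (c * s)

theorem exp (c : ℝ) : IsProfile Set.univ (c ^ 2) 0 (fun s => s)
    (fun s => Real.exp (c * s)) (fun s => c * Real.exp (c * s)) := by
  have hmul (s : ℝ) : HasDerivAt (c * ·) c s := by simpa using (hasDerivAt_id s).const_mul c
  exact of_height (fun s => (hmul s).exp.congr_deriv (by ring))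
    (fun s => ((hmul s).exp.const_mul c).congr_deriv (by ring)) fun s => by ring

variable {k c : ℝ}

theorem exists_eq_cos (hI : IsOpenInterval I) (hc : c ≠ 0) (hk : k ≠ 0)
    (h : IsProfile I (-c ^ 2) (k ^ 2) z y w) :
    ∃ t, ∀ s ∈ I, y s = k / c * Real.cos (c * (z s - t)) ∧
      w s = -(k * Real.sin (c * (z s - t))) := by
  obtain ⟨s₀, hs₀⟩ := hI.2.2
  obtain ⟨φ, hcos, hsin⟩ := exists_cos_sin_eq (p := c * y s₀ / k) (q := -(w s₀ / k)) (by
    have := h.firstIntegral s₀ hs₀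
    field_simp
    linarith)
  have phase : c * (z s₀ - (z s₀ - φ / c)) = φ := by field_simp; ring
  refine ⟨z s₀ - φ / c, fun s hs => h.eq_of_eq_at hI (pow_ne_zero 2 hk)
    ((cos hc k).comp_sub_const h.differentiableAt_height _) hs₀ ?_ ?_ hs⟩
  · rw [phase, hcos]; field_simp
  · rw [phase, hsin]; field_simp

theorem exists_eq_affine (hI : IsOpenInterval I) (hk : k ≠ 0) (h : IsProfile I 0 (k ^ 2) z y w)
    {s₀ : ℝ} (hs₀ : s₀ ∈ I) (hw : w s₀ = k) :
    ∃ t, ∀ s ∈ I, y s = k * (z s - t) + 1 ∧ w s = k :=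
  ⟨z s₀ - (y s₀ - 1) / k, fun s hs => h.eq_of_eq_at hI (pow_ne_zero 2 hk)
    ((affine k 1).comp_sub_const h.differentiableAt_height _) hs₀ (by field_simp; ring) hw hs⟩

theorem exists_eq_sinh (hI : IsOpenInterval I) (hc : c ≠ 0) (hk : 0 < k)
    (h : IsProfile I (c ^ 2) (k ^ 2) z y w) {s₀ : ℝ} (hs₀ : s₀ ∈ I) (hw : 0 < w s₀) :
    ∃ t, ∀ s ∈ I, y s = k / c * Real.sinh (c * (z s - t)) ∧
      w s = k * Real.cosh (c * (z s - t)) := by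
  set φ := Real.arsinh (c * y s₀ / k)
  have hsinh : Real.sinh φ = c * y s₀ / k := Real.sinh_arsinh _
  have hcosh : Real.cosh φ = w s₀ / k := by
    rw [← pow_left_inj₀ (Real.cosh_pos φ).le (div_pos hw hk).le two_ne_zero, Real.cosh_sq, hsinh]
    have := h.firstIntegral s₀ hs₀
    field_simp
    linarith
  have phase : c * (z s₀ - (z s₀ - φ / c)) = φ := by field_simp; ring
  refine ⟨z s₀ - φ / c, fun s hs => h.eq_of_eq_at hI (pow_ne_zero 2 hk.ne')
    ((sinh hc k).comp_sub_const h.differentiableAt_height _) hs₀ ?_ ?_ hs⟩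
  · rw [phase, hsinh]; field_simp
  · rw [phase, hcosh]; field_simp

theorem exists_eq_exp (hI : IsOpenInterval I) (hκ : κ ≠ 0) (h : IsProfile I κ 0 z y w)
    (hy : ∀ s ∈ I, 0 < y s) :
    ∃ c t, c ≠ 0 ∧ ∀ s ∈ I, y s = Real.exp (c * (z s - t)) ∧
      w s = c * Real.exp (c * (z s - t)) := by
  obtain ⟨s₀, hs₀⟩ := hI.2.2
  obtain ⟨c, hc⟩ := hI.exists_eq_const (f := fun s => w s / y s) fun s hs =>
    (h.hasDerivAt_div hs (hy s hs).ne').congr_deriv (by simp)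
  obtain ⟨d, hd⟩ := hI.exists_eq_const (f := fun s => Real.log (y s) - c * z s) fun s hs => by
    have := (hy s hs).ne'
    refine (((h.hasDerivAt_fst s hs).log this).fun_sub
      ((h.differentiableAt_height s hs).hasDerivAt.const_mul c)).congr_deriv ?_
    rw [← hc s hs]
    ring
  have hc0 : c ≠ 0 := by
    have hw := (div_eq_iff (hy s₀ hs₀).ne').1 (hc s₀ hs₀)
    rintro rfl
    have := h.firstIntegral s₀ hs₀
    have := mul_ne_zero hκ (pow_ne_zero 2 (hy s₀ hs₀).ne')
    simp_all
  refine ⟨c, -(d / c), hc0, fun s hs => ?_⟩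
  have hexp : Real.exp (c * (z s - -(d / c))) = y s := by
    rw [← Real.exp_log (hy s hs), ← sub_add_cancel (Real.log (y s)) (c * z s), hd s hs]
    congr 1
    field_simp
    ring
  exact ⟨hexp.symm, by rw [hexp, ← hc s hs, div_mul_cancel₀ _ (hy s hs).ne']⟩

end IsProfile

/-- The horizontal circles of radius `|1 / y(s)|` at height `s` around the points
`-(w(s) / y(s)) (l, m) / (l² + m²)`, translated by `v`. For `l = m = 0`, where the quotients by
`l² + m² = 0` have the value `0`, the circles are centred on a vertical line. -/
noncomputable def profileCircles (v : E3) (J : Set ℝ) (l m : ℝ) (y w : ℝ → ℝ) : Set E3 :=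
  horizontalCircles v J (fun s => -(l / (l ^ 2 + m ^ 2) * (w s / y s)))
    (fun s => -(m / (l ^ 2 + m ^ 2) * (w s / y s))) (fun s => (y s)⁻¹)

theorem isTypeI_iff {S : Set E3} :
    IsTypeI S ↔ ∃ c l m : ℝ, c ≠ 0 ∧ l ^ 2 + m ^ 2 ≠ 0 ∧ ∃ J : Set ℝ, IsOpenInterval J ∧
      (∀ s ∈ J, Real.cos (c * s) ≠ 0) ∧ ∃ v : E3, S = profileCircles v J l m
        (fun s => √(l ^ 2 + m ^ 2) / c * Real.cos (c * s))
        (fun s => -(√(l ^ 2 + m ^ 2) * Real.sin (c * s))) := by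
  refine exists_congr fun c => exists_congr fun l => exists_congr fun m => and_congr_right
    fun hc => and_congr_right fun hlm => exists_congr fun J => and_congr_right fun _ =>
    and_congr_right fun _ => exists_congr fun v => ?_
  have hk : √(l ^ 2 + m ^ 2) ≠ 0 := Real.sqrt_ne_zero'.2 (by positivity)
  rw [profileCircles]
  have quotient (s : ℝ) : -(√(l ^ 2 + m ^ 2) * Real.sin (c * s)) /
      (√(l ^ 2 + m ^ 2) / c * Real.cos (c * s)) = -(c * Real.tan (c * s)) := by
    rw [Real.tan_eq_sin_div_cos]
    field_simp
  simp only [quotient]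
  congr! 3 with s s s <;> field_simp

theorem isTypeII_iff {S : Set E3} :
    IsTypeII S ↔ ∃ c l m : ℝ, c ≠ 0 ∧ l ^ 2 + m ^ 2 ≠ 0 ∧ ∃ J : Set ℝ, IsOpenInterval J ∧
      (∀ s ∈ J, √(l ^ 2 + m ^ 2) * s + c ≠ 0) ∧ ∃ v : E3, S = profileCircles v J l m
        (fun s => √(l ^ 2 + m ^ 2) * s + c) (fun _ => √(l ^ 2 + m ^ 2)) := by
  refine exists_congr fun c => exists_congr fun l => exists_congr fun m => and_congr_right
    fun _ => and_congr_right fun hlm => exists_congr fun J => and_congr_right fun _ =>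
    and_congr_right fun _ => exists_congr fun v => ?_
  have hk : √(l ^ 2 + m ^ 2) ≠ 0 := Real.sqrt_ne_zero'.2 (by positivity)
  have denominator (s : ℝ) : (l ^ 2 + m ^ 2) * s + c * √(l ^ 2 + m ^ 2) =
      √(l ^ 2 + m ^ 2) * (√(l ^ 2 + m ^ 2) * s + c) := by
    rw [mul_add, ← mul_assoc, Real.mul_self_sqrt (by positivity), mul_comm c]
  have quotient (l' s : ℝ) : l' / (l ^ 2 + m ^ 2) *
      (√(l ^ 2 + m ^ 2) / (√(l ^ 2 + m ^ 2) * s + c)) =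
        l' / (√(l ^ 2 + m ^ 2) * (√(l ^ 2 + m ^ 2) * s + c)) := by
    nth_rw 1 [← Real.mul_self_sqrt (show 0 ≤ l ^ 2 + m ^ 2 by positivity)]
    field_simp
  simp only [profileCircles, quotient, denominator, one_div]

theorem isTypeIII_iff {S : Set E3} :
    IsTypeIII S ↔ ∃ c l m : ℝ, c ≠ 0 ∧ l ^ 2 + m ^ 2 ≠ 0 ∧ ∃ J : Set ℝ, IsOpenInterval J ∧
      (∀ s ∈ J, Real.sinh (c * s) ≠ 0) ∧ ∃ v : E3, S = profileCircles v J l m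
        (fun s => √(l ^ 2 + m ^ 2) / c * Real.sinh (c * s))
        (fun s => √(l ^ 2 + m ^ 2) * Real.cosh (c * s)) := by
  refine exists_congr fun c => exists_congr fun l => exists_congr fun m => and_congr_right
    fun hc => and_congr_right fun hlm => exists_congr fun J => and_congr_right fun _ =>
    and_congr_right fun _ => exists_congr fun v => ?_
  have hk : √(l ^ 2 + m ^ 2) ≠ 0 := Real.sqrt_ne_zero'.2 (by positivity)
  rw [profileCircles]
  congr! 3 with s s s <;> field_simp

theorem revolution_log_eq_profileCircles {c : ℝ} (hc : c ≠ 0) (v : E3) (J : Set ℝ) :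
    revolution v ((fun s => Real.exp (s / c)) '' J) (fun ρ => c * Real.log ρ) =
      profileCircles v J 0 0 (fun s => Real.exp (-c⁻¹ * s))
        (fun s => -c⁻¹ * Real.exp (-c⁻¹ * s)) := by
  have radius (s : ℝ) : (Real.exp (-c⁻¹ * s))⁻¹ = Real.exp (s / c) := by
    rw [← Real.exp_neg, neg_mul, neg_neg, inv_mul_eq_div]
  have point (r s θ : ℝ) : !₂[r * Real.cos θ, r * Real.sin θ, s] =
      !₂[0, 0, s] + r • !₂[Real.cos θ, Real.sin θ, 0] := by
    apply E3.ext_coord <;> simp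
  simp only [revolution, profileCircles, horizontalCircles, Set.exists_mem_image, Real.log_exp,
    mul_div_cancel₀ _ hc, zero_div, zero_mul, neg_zero, radius, point]

theorem isLogarithmicRevolution_iff {S : Set E3} :
    IsLogarithmicRevolution S ↔ ∃ c : ℝ, c ≠ 0 ∧ ∃ J : Set ℝ, IsOpenInterval J ∧ ∃ v : E3,
      S = profileCircles v J 0 0 (fun s => Real.exp (c * s))
        (fun s => c * Real.exp (c * s)) := by
  constructor
  · rintro ⟨c, hc, J, hJ, hJpos, v, rfl⟩
    refine ⟨-c⁻¹, neg_ne_zero.2 (inv_ne_zero hc), (fun ρ => c * Real.log ρ) '' J,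
      hJ.image (fun ρ hρ => (Real.hasStrictDerivAt_log (hJpos hρ).ne').const_mul c)
        fun ρ hρ => mul_ne_zero hc (inv_ne_zero (hJpos hρ).ne'), v, ?_⟩
    rw [← revolution_log_eq_profileCircles hc, Set.image_image, Set.image_congr (g := id),
      Set.image_id]
    intro ρ hρ
    rw [mul_div_cancel_left₀ _ hc, Real.exp_log (hJpos hρ), id]
  · rintro ⟨c, hc, J, hJ, v, rfl⟩
    refine ⟨-c⁻¹, neg_ne_zero.2 (inv_ne_zero hc), (fun s => Real.exp (s / -c⁻¹)) '' J,
      hJ.image (fun s _ => ((hasStrictDerivAt_id s).div_const (-c⁻¹)).exp) fun s _ => ?_, ?_, v, ?_⟩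
    · simp [hc]
    · rintro _ ⟨s, -, rfl⟩
      exact Real.exp_pos _
    · rw [revolution_log_eq_profileCircles (neg_ne_zero.2 (inv_ne_zero hc)), inv_neg, inv_inv,
        neg_neg]

theorem eq_zero_of_sq_add_sq_eq_zero {l m : ℝ} (h : l ^ 2 + m ^ 2 = 0) : l = 0 ∧ m = 0 :=
  ⟨by nlinarith [sq_nonneg l, sq_nonneg m], by nlinarith [sq_nonneg l, sq_nonneg m]⟩

theorem IsOpenInterval.forall_pos_or_forall_neg {I : Set ℝ} (hI : IsOpenInterval I) {f : ℝ → ℝ}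
    (hf : ContinuousOn f I) (h0 : ∀ s ∈ I, f s ≠ 0) :
    (∀ s ∈ I, 0 < f s) ∨ ∀ s ∈ I, f s < 0 := by
  refine (hI.2.1.isPreconnected.eq_or_eq_neg_of_sq_eq hf hf.abs
    (fun s _ => (sq_abs (f s)).symm) fun hs => abs_ne_zero.2 (h0 _ hs)).imp
    (fun h s hs => ?_) fun h s hs => ?_
  · rw [h hs]
    exact abs_pos.2 (h0 s hs)
  · rw [h hs]
    exact neg_neg_of_pos (abs_pos.2 (h0 s hs))

/-- Rotating by `π` absorbs the sign of the radius. -/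
theorem setOf_circle_abs (u : E3) (r : ℝ) :
    {p : E3 | ∃ θ : ℝ, p = u + |r| • !₂[Real.cos θ, Real.sin θ, 0]} =
      {p | ∃ θ : ℝ, p = u + r • !₂[Real.cos θ, Real.sin θ, 0]} := by
  rcases abs_choice r with h | h
  · rw [h]
  · have half_turn (θ : ℝ) : -r • !₂[Real.cos θ, Real.sin θ, 0] =
        r • !₂[Real.cos (θ + Real.pi), Real.sin (θ + Real.pi), 0] := by
      apply E3.ext_coord <;> simp
    rw [h]
    simp only [half_turn]
    refine Set.ext fun p => (Equiv.addRight Real.pi).exists_congr fun θ => Iff.rfl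

namespace CyclicSurface

variable {C : CyclicSurface} {s : ℝ}

/-- The circles of `C` are horizontal, have radius `|1 / y|`, and their centres move in the
vertical plane through `(a, b)` with direction `(l, m)`, where `y` and `w` form a profile. -/
structure HasProfile (C : CyclicSurface) (κ l m a b : ℝ) (y w : ℝ → ℝ) : Prop
    extends IsProfile C.I κ (l ^ 2 + m ^ 2) (fun s => C.center s 2) y w where
  isHorizontalAt : ∀ s ∈ C.I, C.IsHorizontalAt s
  radius_eq : ∀ s ∈ C.I, C.radius s = |(y s)⁻¹|
  center_zero : ∀ s ∈ C.I, C.center s 0 = a - l / (l ^ 2 + m ^ 2) * (w s / y s)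
  center_one : ∀ s ∈ C.I, C.center s 1 = b - m / (l ^ 2 + m ^ 2) * (w s / y s)

namespace HasProfile

variable {κ l m a b : ℝ} {y w : ℝ → ℝ}

theorem neg (h : C.HasProfile κ l m a b y w) :
    C.HasProfile κ l m a b (fun s => -y s) (fun s => -w s) where
  toIsProfile := h.toIsProfile.neg
  isHorizontalAt := h.isHorizontalAt
  radius_eq s hs := by rw [inv_neg, abs_neg, h.radius_eq s hs]
  center_zero s hs := by rw [neg_div_neg_eq, h.center_zero s hs]
  center_one s hs := by rw [neg_div_neg_eq, h.center_one s hs]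

theorem ne_zero (h : C.HasProfile κ l m a b y w) (hs : s ∈ C.I) : y s ≠ 0 := by
  simpa [h.radius_eq s hs] using C.radius_pos s hs

theorem carrier_eq (h : C.HasProfile κ l m a b y w) {t : ℝ} {Y W : ℝ → ℝ}
    (hYW : ∀ s ∈ C.I, y s = Y (C.center s 2 - t) ∧ w s = W (C.center s 2 - t)) :
    C.carrier = profileCircles !₂[a, b, t] ((fun s => C.center s 2 - t) '' C.I) l m Y W := by
  have circle (s : ℝ) (hs : s ∈ C.I) (p : E3) :
      (∃ θ : ℝ, p = C.center s + C.radius s • !₂[Real.cos θ, Real.sin θ, 0]) ↔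
        ∃ θ : ℝ, p = !₂[a, b, t] + (!₂[-(l / (l ^ 2 + m ^ 2) * (w s / y s)),
          -(m / (l ^ 2 + m ^ 2) * (w s / y s)), C.center s 2 - t] +
            (y s)⁻¹ • !₂[Real.cos θ, Real.sin θ, 0]) := by
    have center : C.center s = !₂[a, b, t] + !₂[-(l / (l ^ 2 + m ^ 2) * (w s / y s)),
        -(m / (l ^ 2 + m ^ 2) * (w s / y s)), C.center s 2 - t] := by
      apply E3.ext_coord
      · simp [h.center_zero s hs, sub_eq_add_neg]
      · simp [h.center_one s hs, sub_eq_add_neg]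
      · simp
    simp only [← add_assoc]
    rw [← center, h.radius_eq s hs]
    exact Set.ext_iff.1 (setOf_circle_abs _ _) p
  rw [carrier_eq_of_horizontal h.isHorizontalAt]
  ext p
  simp only [profileCircles, horizontalCircles, Set.exists_mem_image]
  refine exists_congr fun s => and_congr_right fun hs => ?_
  rw [circle s hs p, (hYW s hs).1, (hYW s hs).2]

end HasProfile

/-- The derivative of `1 / r` with respect to the height, for horizontal circles of radius `r`. -/
noncomputable def inverseRadiusSlope (C : CyclicSurface) (s : ℝ) : ℝ :=
  -(deriv C.radius s / (C.radius s ^ 2 * deriv C.center s 2))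

theorem hasDerivAt_inv_radius (hs : s ∈ C.I) (hz : deriv C.center s 2 ≠ 0) :
    HasDerivAt (fun s => (C.radius s)⁻¹) (deriv C.center s 2 * C.inverseRadiusSlope s) s := by
  have hr₀ := (C.radius_pos s hs).ne'
  refine ((hasDerivAt_of_contDiffOn C.radius_smooth C.interval.1 hs).fun_inv hr₀).congr_deriv ?_
  rw [inverseRadiusSlope]
  field_simp

theorem exists_deriv_center_eq (hz : ∀ s ∈ C.I, deriv C.center s 2 ≠ 0) {i : Fin 3}
    (hi : ∀ s ∈ C.I, C.radius s * (deriv (deriv C.center) s 2 * deriv C.center s i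
      - deriv C.center s 2 * deriv (deriv C.center) s i)
        + 2 * deriv C.radius s * deriv C.center s 2 * deriv C.center s i = 0) :
    ∃ l, ∀ s ∈ C.I, deriv C.center s i = l * deriv C.center s 2 * C.radius s ^ 2 := by
  have hI := C.interval
  have hden {s : ℝ} (hs : s ∈ C.I) : deriv C.center s 2 * C.radius s ^ 2 ≠ 0 :=
    mul_ne_zero (hz s hs) (pow_ne_zero 2 (C.radius_pos s hs).ne')
  obtain ⟨l, hl⟩ := hI.exists_eq_const
    (f := fun s => deriv C.center s i / (deriv C.center s 2 * C.radius s ^ 2)) fun s hs => by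
      have hc' := hasDerivAt_coord
        (hasDerivAt_of_contDiffOn (contDiffOn_deriv C.center_smooth hI.1) hI.1 hs)
      have hr := hasDerivAt_of_contDiffOn C.radius_smooth hI.1 hs
      refine ((hc' i).fun_div ((hc' 2).fun_mul (hr.fun_pow 2)) (hden hs)).congr_deriv
        (div_eq_zero_iff.2 (Or.inl ?_))
      linear_combination (-C.radius s) * hi s hs
  exact ⟨l, fun s hs => by rw [mul_assoc, ← hl s hs, div_mul_cancel₀ _ (hden hs)]⟩

namespace IsAnisotropicMinimal

variable {l m : ℝ}

theorem hasDerivAt_inverseRadiusSlope (hC : C.IsAnisotropicMinimal) (hs : s ∈ C.I)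
    (h : C.IsHorizontalAt s) (hz : deriv C.center s 2 ≠ 0)
    (hl : deriv C.center s 0 = l * deriv C.center s 2 * C.radius s ^ 2)
    (hm : deriv C.center s 1 = m * deriv C.center s 2 * C.radius s ^ 2) :
    HasDerivAt C.inverseRadiusSlope
      (deriv C.center s 2 * (C.inverseRadiusSlope s ^ 2 - (l ^ 2 + m ^ 2)) * C.radius s) s := by
  have hI := C.interval.1
  have hr₀ := (C.radius_pos s hs).ne'
  have hr := hasDerivAt_of_contDiffOn C.radius_smooth hI hs
  have hr' := hasDerivAt_of_contDiffOn (contDiffOn_deriv C.radius_smooth hI) hI hs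
  have hz' := hasDerivAt_coord
    (hasDerivAt_of_contDiffOn (contDiffOn_deriv C.center_smooth hI) hI hs) 2
  refine (hr'.fun_div ((hr.fun_pow 2).fun_mul hz')
    (mul_ne_zero (pow_ne_zero 2 hr₀) hz)).fun_neg.congr_deriv ?_
  have constant_term := (hC.horizontal_equations hs h).1
  rw [hl, hm] at constant_term
  simp only [inverseRadiusSlope]
  field_simp
  linear_combination C.radius s * constant_term

theorem exists_firstIntegral (hC : C.IsAnisotropicMinimal) (h : ∀ s ∈ C.I, C.IsHorizontalAt s)
    (hz : ∀ s ∈ C.I, deriv C.center s 2 ≠ 0)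
    (hl : ∀ s ∈ C.I, deriv C.center s 0 = l * deriv C.center s 2 * C.radius s ^ 2)
    (hm : ∀ s ∈ C.I, deriv C.center s 1 = m * deriv C.center s 2 * C.radius s ^ 2) :
    ∃ κ, ∀ s ∈ C.I, C.inverseRadiusSlope s ^ 2 - κ * (C.radius s)⁻¹ ^ 2 = l ^ 2 + m ^ 2 := by
  obtain ⟨κ, hκ⟩ := C.interval.exists_eq_const
    (f := fun s => (C.inverseRadiusSlope s ^ 2 - (l ^ 2 + m ^ 2)) / (C.radius s)⁻¹ ^ 2)
    fun s hs => by
      have hr₀ := (C.radius_pos s hs).ne'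
      refine ((((hC.hasDerivAt_inverseRadiusSlope hs (h s hs) (hz s hs) (hl s hs)
        (hm s hs)).fun_pow 2).sub_const _).fun_div ((hasDerivAt_inv_radius hs (hz s hs)).fun_pow 2)
          (pow_ne_zero 2 (inv_ne_zero hr₀))).congr_deriv ?_
      simp only [Nat.add_one_sub_one, pow_one]
      field_simp
      ring
  refine ⟨κ, fun s hs => ?_⟩
  have hr₀ := (C.radius_pos s hs).ne'
  rw [← hκ s hs]
  field_simp
  ring

theorem exists_isProfile (hC : C.IsAnisotropicMinimal) (h : ∀ s ∈ C.I, C.IsHorizontalAt s)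
    (hz : ∀ s ∈ C.I, deriv C.center s 2 ≠ 0)
    (hl : ∀ s ∈ C.I, deriv C.center s 0 = l * deriv C.center s 2 * C.radius s ^ 2)
    (hm : ∀ s ∈ C.I, deriv C.center s 1 = m * deriv C.center s 2 * C.radius s ^ 2) :
    ∃ κ, IsProfile C.I κ (l ^ 2 + m ^ 2) (fun s => C.center s 2) (fun s => (C.radius s)⁻¹)
      C.inverseRadiusSlope := by
  obtain ⟨κ, hκ⟩ := hC.exists_firstIntegral h hz hl hm
  have height {s : ℝ} (hs : s ∈ C.I) : HasDerivAt (fun s => C.center s 2) (deriv C.center s 2) s :=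
    hasDerivAt_coord (hasDerivAt_of_contDiffOn C.center_smooth C.interval.1 hs) 2
  refine ⟨κ, fun s hs => (height hs).differentiableAt, fun s hs => ?_, fun s hs => ?_, hκ⟩
  · rw [(height hs).deriv]
    exact hasDerivAt_inv_radius hs (hz s hs)
  · rw [(height hs).deriv]
    have hr₀ := (C.radius_pos s hs).ne'
    refine (hC.hasDerivAt_inverseRadiusSlope hs (h s hs) (hz s hs) (hl s hs)
      (hm s hs)).congr_deriv ?_
    rw [← hκ s hs]
    field_simp
    ring

theorem exists_deriv_ne_zero (hC : C.IsAnisotropicMinimal) : ∃ s ∈ C.I,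
    deriv C.center s 0 ≠ 0 ∨ deriv C.center s 1 ≠ 0 ∨ deriv C.radius s ≠ 0 := by
  obtain ⟨s₀, hs₀⟩ := C.interval.2.2
  obtain ⟨⟨s, θ⟩, ⟨hs, hν⟩, -⟩ := hC.exists_regular hs₀ 0 (.of_forall fun _ => trivial)
  refine ⟨s, hs, ?_⟩
  contrapose! hν
  obtain ⟨ha, hb, hr⟩ := hν
  rw [← not_ne_iff, unitNormal_two_ne_zero_iff, not_ne_iff, ds_X hs, dθ_X, hC.deriv_E₁ hs,
    hC.deriv_E₂ hs, hr]
  simp only [zero_smul, zero_add, zero_sub, E₁, E₂, cross_two, PiLp.add_apply, rot_apply,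
    PiLp.smul_apply, smul_eq_mul, PiLp.neg_apply, ha, hb]
  ring

theorem exists_hasProfile (hC : C.IsAnisotropicMinimal) (h : ∀ s ∈ C.I, C.IsHorizontalAt s)
    (hz : ∀ s ∈ C.I, deriv C.center s 2 ≠ 0) :
    ∃ κ l m a b y w, (l ^ 2 + m ^ 2 = 0 → κ ≠ 0) ∧ C.HasProfile κ l m a b y w := by
  obtain ⟨l, hl⟩ := exists_deriv_center_eq hz fun s hs => (hC.horizontal_equations hs (h s hs)).2.1
  obtain ⟨m, hm⟩ := exists_deriv_center_eq hz fun s hs => (hC.horizontal_equations hs (h s hs)).2.2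
  obtain ⟨κ, hκ⟩ := hC.exists_isProfile h hz hl hm
  have exists_center {i : Fin 3} {l' : ℝ} (hl' : l ^ 2 + m ^ 2 = 0 → l' = 0) (hi : ∀ s ∈ C.I,
      deriv C.center s i = l' * deriv C.center s 2 * C.radius s ^ 2) : ∃ a, ∀ s ∈ C.I,
        C.center s i = a - l' / (l ^ 2 + m ^ 2) * (C.inverseRadiusSlope s / (C.radius s)⁻¹) := by
    obtain ⟨a, ha⟩ := C.interval.exists_eq_const (f := fun s => C.center s i +
      l' / (l ^ 2 + m ^ 2) * (C.inverseRadiusSlope s / (C.radius s)⁻¹)) fun s hs => by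
        have hc := hasDerivAt_coord (hasDerivAt_of_contDiffOn C.center_smooth C.interval.1 hs)
        refine ((hc i).fun_add ((hκ.hasDerivAt_div hs
          (inv_ne_zero (C.radius_pos s hs).ne')).const_mul _)).congr_deriv ?_
        rw [(hc 2).deriv, hi s hs, inv_pow, div_inv_eq_mul]
        linear_combination (-deriv C.center s 2 * C.radius s ^ 2) * div_mul_cancel_of_imp hl'
    exact ⟨a, fun s hs => eq_sub_of_add_eq (ha s hs)⟩
  obtain ⟨a, ha⟩ := exists_center (fun hq => (eq_zero_of_sq_add_sq_eq_zero hq).1) hl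
  obtain ⟨b, hb⟩ := exists_center (fun hq => (eq_zero_of_sq_add_sq_eq_zero hq).2) hm
  refine ⟨κ, l, m, a, b, _, _, fun hq hκ₀ => ?_, hκ, h, fun s hs => ?_, ha, hb⟩
  · obtain ⟨hl₀, hm₀⟩ := eq_zero_of_sq_add_sq_eq_zero hq
    obtain ⟨s, hs, hne⟩ := hC.exists_deriv_ne_zero
    have slope := hκ.firstIntegral s hs
    rw [hκ₀, hq, zero_mul, sub_zero, sq_eq_zero_iff] at slope
    have := (C.radius_pos s hs).ne'
    have := hz s hs
    simp_all [inverseRadiusSlope]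
  · rw [inv_inv, abs_of_pos (C.radius_pos s hs)]

end IsAnisotropicMinimal

namespace HasProfile

variable {κ l m a b : ℝ} {y w : ℝ → ℝ}

theorem isOpenInterval_height (hz : ∀ s ∈ C.I, deriv C.center s 2 ≠ 0) (t : ℝ) :
    IsOpenInterval ((fun s => C.center s 2 - t) '' C.I) :=
  C.interval.image (fun s hs => (((contDiffOn_euclidean.1 C.center_smooth 2).contDiffAt
    (C.interval.1.mem_nhds hs)).hasStrictDerivAt' (hasDerivAt_coord
      (hasDerivAt_of_contDiffOn C.center_smooth C.interval.1 hs) 2) (by simp)).sub_const t) hz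

theorem isLogarithmicRevolution (h : C.HasProfile κ 0 0 a b y w)
    (hz : ∀ s ∈ C.I, deriv C.center s 2 ≠ 0) (hκ : κ ≠ 0) :
    IsLogarithmicRevolution C.carrier := by
  wlog hpos : ∀ s ∈ C.I, 0 < y s generalizing y w
  · refine this h.neg fun s hs => neg_pos.2 ((C.interval.forall_pos_or_forall_neg (fun s hs =>
      (h.hasDerivAt_fst s hs).continuousAt.continuousWithinAt) fun s => h.ne_zero).resolve_left
      hpos s hs)
  obtain ⟨c, t, hc, hct⟩ := IsProfile.exists_eq_exp C.interval hκ
    (by simpa using h.toIsProfile) hpos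
  exact isLogarithmicRevolution_iff.2 ⟨c, hc, _, isOpenInterval_height hz t, _, h.carrier_eq hct⟩

theorem isTypeI (h : C.HasProfile κ l m a b y w) (hz : ∀ s ∈ C.I, deriv C.center s 2 ≠ 0)
    (hq : l ^ 2 + m ^ 2 ≠ 0) (hκ : κ < 0) : IsTypeI C.carrier := by
  have hk : √(l ^ 2 + m ^ 2) ^ 2 = l ^ 2 + m ^ 2 := Real.sq_sqrt (by positivity)
  have hk₀ : √(l ^ 2 + m ^ 2) ≠ 0 := Real.sqrt_ne_zero'.2 (by positivity)
  have hc : √(-κ) ^ 2 = -κ := Real.sq_sqrt (neg_nonneg.2 hκ.le)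
  have hc₀ : √(-κ) ≠ 0 := Real.sqrt_ne_zero'.2 (neg_pos.2 hκ)
  obtain ⟨t, ht⟩ := IsProfile.exists_eq_cos C.interval hc₀ hk₀
    (by simpa only [hk, hc, neg_neg] using h.toIsProfile)
  refine isTypeI_iff.2 ⟨_, l, m, hc₀, hq, _, isOpenInterval_height hz t, ?_, _, h.carrier_eq ht⟩
  rintro _ ⟨s, hs, rfl⟩ hcos
  exact h.ne_zero hs (by rw [(ht s hs).1, hcos, mul_zero])

theorem isTypeII (h : C.HasProfile 0 l m a b y w) (hz : ∀ s ∈ C.I, deriv C.center s 2 ≠ 0)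
    (hq : l ^ 2 + m ^ 2 ≠ 0) : IsTypeII C.carrier := by
  obtain ⟨s₀, hs₀⟩ := C.interval.2.2
  have hk : √(l ^ 2 + m ^ 2) ^ 2 = l ^ 2 + m ^ 2 := Real.sq_sqrt (by positivity)
  have hk₀ : √(l ^ 2 + m ^ 2) ≠ 0 := Real.sqrt_ne_zero'.2 (by positivity)
  wlog hw : w s₀ = √(l ^ 2 + m ^ 2) generalizing y w
  · have hw_sq : w s₀ ^ 2 = √(l ^ 2 + m ^ 2) ^ 2 := by
      rw [hk, ← h.firstIntegral s₀ hs₀, zero_mul, sub_zero]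
    exact this h.neg (neg_eq_iff_eq_neg.2 ((sq_eq_sq_iff_eq_or_eq_neg.1 hw_sq).resolve_left hw))
  obtain ⟨t, ht⟩ := IsProfile.exists_eq_affine C.interval hk₀
    (by simpa only [hk] using h.toIsProfile) hs₀ hw
  refine isTypeII_iff.2 ⟨1, l, m, one_ne_zero, hq, _, isOpenInterval_height hz t, ?_, _,
    h.carrier_eq ht⟩
  rintro _ ⟨s, hs, rfl⟩
  rw [← (ht s hs).1]
  exact h.ne_zero hs

theorem isTypeIII (h : C.HasProfile κ l m a b y w) (hz : ∀ s ∈ C.I, deriv C.center s 2 ≠ 0)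
    (hq : l ^ 2 + m ^ 2 ≠ 0) (hκ : 0 < κ) : IsTypeIII C.carrier := by
  obtain ⟨s₀, hs₀⟩ := C.interval.2.2
  have hk : √(l ^ 2 + m ^ 2) ^ 2 = l ^ 2 + m ^ 2 := Real.sq_sqrt (by positivity)
  have hk₀ : 0 < √(l ^ 2 + m ^ 2) := Real.sqrt_pos.2 (by positivity)
  have hc : √κ ^ 2 = κ := Real.sq_sqrt hκ.le
  have hc₀ : √κ ≠ 0 := Real.sqrt_ne_zero'.2 hκ
  wlog hw : 0 < w s₀ generalizing y w
  · have hw₀ : w s₀ ≠ 0 := fun h₀ => by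
      have := h.firstIntegral s₀ hs₀
      rw [h₀] at this
      have : 0 < l ^ 2 + m ^ 2 := by positivity
      nlinarith [sq_nonneg (y s₀)]
    exact this h.neg (neg_pos.2 (lt_of_le_of_ne (not_lt.1 hw) hw₀))
  obtain ⟨t, ht⟩ := IsProfile.exists_eq_sinh C.interval hc₀ hk₀
    (by simpa only [hk, hc] using h.toIsProfile) hs₀ hw
  refine isTypeIII_iff.2 ⟨_, l, m, hc₀, hq, _, isOpenInterval_height hz t, ?_, _, h.carrier_eq ht⟩
  rintro _ ⟨s, hs, rfl⟩ hsinh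
  exact h.ne_zero hs (by rw [(ht s hs).1, hsinh, mul_zero])

end HasProfile

theorem IsAnisotropicMinimal.horizontal_classification (hC : C.IsAnisotropicMinimal)
    (h : ∀ s ∈ C.I, C.IsHorizontalAt s) (hz : ∀ s ∈ C.I, deriv C.center s 2 ≠ 0) :
    IsLogarithmicRevolution C.carrier ∨ IsTypeI C.carrier ∨ IsTypeII C.carrier ∨
      IsTypeIII C.carrier := by
  obtain ⟨κ, l, m, a, b, y, w, hκ, profile⟩ := hC.exists_hasProfile h hz
  by_cases hq : l ^ 2 + m ^ 2 = 0
  · obtain ⟨rfl, rfl⟩ := eq_zero_of_sq_add_sq_eq_zero hq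
    exact .inl (profile.isLogarithmicRevolution hz (hκ hq))
  · rcases lt_trichotomy κ 0 with hneg | rfl | hpos
    · exact .inr (.inl (profile.isTypeI hz hq hneg))
    · exact .inr (.inr (.inl (profile.isTypeII hz hq)))
    · exact .inr (.inr (.inr (profile.isTypeIII hz hq hpos)))

theorem IsAnisotropicMinimal.classification (hC : C.IsAnisotropicMinimal) :
    (IsHorizontalPlanePiece C.carrier ∨ IsLogarithmicRevolution C.carrier) ∨
      (IsTypeI C.carrier ∨ IsTypeII C.carrier ∨ IsTypeIII C.carrier) ∨
        IsInclinedPlanePiece C.carrier := by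
  by_cases horizontal : ∀ s ∈ C.I, C.IsHorizontalAt s
  · by_cases hz : ∀ s ∈ C.I, deriv C.center s 2 ≠ 0
    · have := hC.horizontal_classification horizontal hz
      tauto
    · push Not at hz
      obtain ⟨s, hs, hz⟩ := hz
      exact .inl (.inl (hC.isHorizontalPlanePiece horizontal hs hz))
  · push Not at horizontal
    obtain ⟨s, hs, h⟩ := horizontal
    exact .inr (.inr (hC.isInclinedPlanePiece hs h))

end CyclicSurface

/-! ### Surfaces with a given profile -/

theorem linearIndependent_circleFamily_of_horizontal {e₁ e₂ : E3} (he : Orthonormal ℝ ![e₁, e₂])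
    (h₁ : e₁ 2 = 0) (h₂ : e₂ 2 = 0) {c : ℝ → E3} {c' : E3} {r : ℝ → ℝ} {r' s : ℝ}
    (hc : HasDerivAt c c' s) (hr : HasDerivAt r r' s) (hz : c' 2 ≠ 0) (hr₀ : r s ≠ 0) (θ : ℝ) :
    LinearIndependent ℝ ![ds (circleFamily c (fun _ => e₁) (fun _ => e₂) r) s θ,
      dθ (circleFamily c (fun _ => e₁) (fun _ => e₂) r) s θ] := by
  have hs : ds (circleFamily c (fun _ => e₁) (fun _ => e₂) r) s θ = c' + r' • rot e₁ e₂ θ :=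
    (hc.add (hr.smul_const (rot e₁ e₂ θ))).deriv
  have hθ : dθ (circleFamily c (fun _ => e₁) (fun _ => e₂) r) s θ = r s • rot e₂ (-e₁) θ :=
    (((hasDerivAt_rot_angle e₁ e₂ θ).const_smul (r s)).const_add (c s)).deriv
  have hT : rot e₂ (-e₁) θ ≠ 0 := (orthonormal_rot he θ).ne_zero 1
  rw [LinearIndependent.pair_symm_iff, hs, hθ, LinearIndependent.pair_iff' (smul_ne_zero hr₀ hT)]
  intro k hk
  have height := congrArg (fun u : E3 => u 2) hk
  simp only [PiLp.add_apply, PiLp.smul_apply, rot_apply, PiLp.neg_apply, h₁, h₂, neg_zero,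
    zero_mul, add_zero, smul_zero] at height
  exact hz height.symm

theorem frequently_add_cos_add_sin_ne_zero {A B R : ℝ} (h : A ^ 2 + B ^ 2 = 0 → R ≠ 0) (θ : ℝ) :
    ∃ᶠ t in nhds θ, A * Real.cos t + B * Real.sin t - R ≠ 0 := by
  intro hzero
  simp only [not_not] at hzero
  have first (t : ℝ) : HasDerivAt (fun t => A * Real.cos t + B * Real.sin t - R)
      (A * -Real.sin t + B * Real.cos t) t :=
    (((Real.hasDerivAt_cos t).const_mul A).add ((Real.hasDerivAt_sin t).const_mul B)).sub_const R
  have second : HasDerivAt (fun t => A * -Real.sin t + B * Real.cos t)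
      (A * -Real.cos θ + B * -Real.sin θ) θ :=
    ((Real.hasDerivAt_sin θ).fun_neg.const_mul A).add ((Real.hasDerivAt_cos θ).const_mul B)
  have first_zero : ∀ᶠ t in nhds θ, A * -Real.sin t + B * Real.cos t = 0 := by
    filter_upwards [hzero.eventually_nhds] with t ht
    exact (first t).unique ((hasDerivAt_const t 0).congr_of_eventuallyEq ht)
  have second_zero := second.unique ((hasDerivAt_const θ 0).congr_of_eventuallyEq first_zero)
  refine h ?_ (by linarith [hzero.self_of_nhds])
  linear_combination (-(A ^ 2 + B ^ 2)) * Real.sin_sq_add_cos_sq θ +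
    (-A * Real.sin θ + B * Real.cos θ) * first_zero.self_of_nhds -
      (A * Real.cos θ + B * Real.sin θ) * second_zero

theorem profileCircles_neg (v : E3) (J : Set ℝ) (l m : ℝ) (y w : ℝ → ℝ) :
    profileCircles v J l m (fun s => -y s) (fun s => -w s) = profileCircles v J l m y w := by
  have circle (u : E3) (r : ℝ) := (setOf_circle_abs u (-r)).symm.trans
    ((congrArg (fun x => {p : E3 | ∃ θ : ℝ, p = u + x • !₂[Real.cos θ, Real.sin θ, 0]})
      (abs_neg r)).trans (setOf_circle_abs u r))
  ext p
  simp only [profileCircles, horizontalCircles, neg_div_neg_eq, inv_neg, ← add_assoc]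
  exact exists_congr fun s => and_congr_right fun _ => Set.ext_iff.1 (circle _ _) p

/-- The centre, at height `s`, of a circle of `profileCircles 0 J l m y w`. -/
noncomputable def profileCenter (l m : ℝ) (y w : ℝ → ℝ) (s : ℝ) : E3 :=
  !₂[-(l / (l ^ 2 + m ^ 2) * (w s / y s)), -(m / (l ^ 2 + m ^ 2) * (w s / y s)), s]

theorem contDiffOn_profileCenter {J : Set ℝ} {y w : ℝ → ℝ} (hy : ContDiffOn ℝ ∞ y J)
    (hw : ContDiffOn ℝ ∞ w J) (hy₀ : ∀ s ∈ J, y s ≠ 0) (l m : ℝ) :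
    ContDiffOn ℝ ∞ (profileCenter l m y w) J := by
  refine contDiffOn_euclidean.2 fun i => ?_
  fin_cases i
  · exact (contDiffOn_const.mul (hw.div hy hy₀)).neg
  · exact (contDiffOn_const.mul (hw.div hy hy₀)).neg
  · exact contDiffOn_id

namespace IsProfile

variable {J : Set ℝ} {κ q l m s : ℝ} {y w : ℝ → ℝ}

theorem hasDerivAt_inv (h : IsProfile J κ q (fun s => s) y w) (hs : s ∈ J) (hy : y s ≠ 0) :
    HasDerivAt (fun s => (y s)⁻¹) (-(w s * (y s)⁻¹ ^ 2)) s :=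
  ((h.hasDerivAt_fst s hs).fun_inv hy).congr_deriv (by rw [deriv_id'']; field_simp)

theorem hasDerivAt_inv_sq (h : IsProfile J κ q (fun s => s) y w) (hs : s ∈ J) (hy : y s ≠ 0) :
    HasDerivAt (fun s => (y s)⁻¹ ^ 2) (-(2 * w s * (y s)⁻¹ ^ 3)) s :=
  ((h.hasDerivAt_inv hs hy).fun_pow 2).congr_deriv (by norm_num; ring)

theorem hasDerivAt_deriv_inv (h : IsProfile J κ q (fun s => s) y w) (hs : s ∈ J)
    (hy : y s ≠ 0) : HasDerivAt (fun s => -(w s * (y s)⁻¹ ^ 2))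
      (2 * w s ^ 2 * (y s)⁻¹ ^ 3 - κ * (y s)⁻¹) s := by
  refine ((h.hasDerivAt_snd s hs).fun_mul (h.hasDerivAt_inv_sq hs hy)).fun_neg.congr_deriv ?_
  rw [deriv_id'']
  field_simp
  ring

theorem hasDerivAt_profileCenter (h : IsProfile J κ (l ^ 2 + m ^ 2) (fun s => s) y w) (hs : s ∈ J)
    (hy : y s ≠ 0) :
    HasDerivAt (profileCenter l m y w) !₂[l * (y s)⁻¹ ^ 2, m * (y s)⁻¹ ^ 2, 1] s := by
  have coordinate {l' : ℝ} (hl' : l ^ 2 + m ^ 2 = 0 → l' = 0) :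
      HasDerivAt (fun s => -(l' / (l ^ 2 + m ^ 2) * (w s / y s))) (l' * (y s)⁻¹ ^ 2) s := by
    refine ((h.hasDerivAt_div hs hy).const_mul _).fun_neg.congr_deriv ?_
    rw [deriv_id'']
    linear_combination (y s)⁻¹ ^ 2 * div_mul_cancel_of_imp hl'
  refine hasDerivAt_of_coord fun i => ?_
  fin_cases i
  · exact coordinate fun hq => (eq_zero_of_sq_add_sq_eq_zero hq).1
  · exact coordinate fun hq => (eq_zero_of_sq_add_sq_eq_zero hq).2
  · exact hasDerivAt_id s

theorem hasDerivAt_deriv_profileCenter (h : IsProfile J κ (l ^ 2 + m ^ 2) (fun s => s) y w)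
    (hs : s ∈ J) (hy : y s ≠ 0) :
    HasDerivAt (fun s => (!₂[l * (y s)⁻¹ ^ 2, m * (y s)⁻¹ ^ 2, 1] : E3))
      !₂[l * -(2 * w s * (y s)⁻¹ ^ 3), m * -(2 * w s * (y s)⁻¹ ^ 3), 0] s := by
  refine hasDerivAt_of_coord fun i => ?_
  fin_cases i
  · exact (h.hasDerivAt_inv_sq hs hy).const_mul l
  · exact (h.hasDerivAt_inv_sq hs hy).const_mul m
  · exact hasDerivAt_const s 1

end IsProfile

namespace CyclicSurface

variable {C : CyclicSurface} {s : ℝ}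

theorem deriv_radius_smul (hs : s ∈ C.I) (u : E3) :
    deriv (fun t => C.radius t • u) s = deriv C.radius s • u :=
  ((hasDerivAt_of_contDiffOn C.radius_smooth C.interval.1 hs).smul_const u).deriv

theorem deriv_deriv_radius_smul (hs : s ∈ C.I) (u : E3) :
    deriv (deriv fun t => C.radius t • u) s = deriv (deriv C.radius) s • u := by
  have hI := C.interval.1
  refine (((hasDerivAt_of_contDiffOn (contDiffOn_deriv C.radius_smooth hI) hI hs).smul_const
    u).congr_of_eventuallyEq ?_).deriv
  exact Filter.eventually_of_mem (hI.mem_nhds hs) fun t ht => deriv_radius_smul ht u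

theorem laplacian_of_const_frame {e₁ e₂ : E3} (h₁ : C.e₁ = fun _ => e₁) (h₂ : C.e₂ = fun _ => e₂)
    (hs : s ∈ C.I) (θ : ℝ) : C.laplacian s θ = C.radius s ^ 2 * parallelLaplacian
      (deriv C.center s) (deriv (deriv C.center) s) (rot e₁ e₂ θ) (rot e₂ (-e₁) θ) (C.radius s)
        (deriv C.radius s) (deriv (deriv C.radius) s) := by
  have hE₁ : C.E₁ = fun t => C.radius t • e₁ := funext fun t => by rw [E₁, h₁]
  have hE₂ : C.E₂ = fun t => C.radius t • e₂ := funext fun t => by rw [E₂, h₂]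
  have he : Orthonormal ℝ ![e₁, e₂] := by simpa only [h₁, h₂] using C.orthonormal s hs
  rw [laplacian, hE₁, hE₂, deriv_radius_smul hs, deriv_radius_smul hs, deriv_deriv_radius_smul hs,
    deriv_deriv_radius_smul hs]
  simpa using circleLaplacian_of_orthonormal he (deriv C.center s) (deriv (deriv C.center) s)
    (C.radius s) (deriv C.radius s) (deriv (deriv C.radius) s) 0 0 θ

variable {J : Set ℝ} {κ l m : ℝ} {y w : ℝ → ℝ}

/-- The surface `profileCircles v J l m y w` parametrized by the height, for a positive profile. -/
noncomputable def ofProfile (v : E3) (hJ : IsOpenInterval J)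
    (h : IsProfile J κ (l ^ 2 + m ^ 2) (fun s => s) y w) (hy : ContDiffOn ℝ ∞ y J)
    (hw : ContDiffOn ℝ ∞ w J) (hpos : ∀ s ∈ J, 0 < y s) : CyclicSurface where
  I := J
  center s := v + profileCenter l m y w s
  radius s := (y s)⁻¹
  e₁ _ := !₂[1, 0, 0]
  e₂ _ := !₂[0, 1, 0]
  interval := hJ
  center_smooth := contDiffOn_const.add (contDiffOn_profileCenter hy hw
    (fun s hs => (hpos s hs).ne') l m)
  radius_smooth := hy.inv fun s hs => (hpos s hs).ne'
  e₁_smooth := contDiffOn_const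
  e₂_smooth := contDiffOn_const
  radius_pos s hs := inv_pos.2 (hpos s hs)
  orthonormal _ _ := orthonormal_standard
  immersion s hs := linearIndependent_circleFamily_of_horizontal orthonormal_standard rfl rfl
    ((h.hasDerivAt_profileCenter hs (hpos s hs).ne').const_add v)
    (h.hasDerivAt_inv hs (hpos s hs).ne') one_ne_zero (inv_ne_zero (hpos s hs).ne')

section OfProfile

variable (v : E3) (hJ : IsOpenInterval J) (h : IsProfile J κ (l ^ 2 + m ^ 2) (fun s => s) y w)
  (hy : ContDiffOn ℝ ∞ y J) (hw : ContDiffOn ℝ ∞ w J) (hpos : ∀ s ∈ J, 0 < y s)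

theorem carrier_ofProfile :
    (ofProfile v hJ h hy hw hpos).carrier = profileCircles v J l m y w := by
  rw [carrier_eq_of_horizontal fun s _ => ⟨rfl, rfl⟩]
  ext p
  simp only [profileCircles, horizontalCircles, ← add_assoc]
  rfl

theorem deriv_center_ofProfile (hs : s ∈ J) : deriv (ofProfile v hJ h hy hw hpos).center s =
    !₂[l * (y s)⁻¹ ^ 2, m * (y s)⁻¹ ^ 2, 1] :=
  ((h.hasDerivAt_profileCenter hs (hpos s hs).ne').const_add v).deriv

theorem deriv_radius_ofProfile (hs : s ∈ J) :
    deriv (ofProfile v hJ h hy hw hpos).radius s = -(w s * (y s)⁻¹ ^ 2) :=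
  (h.hasDerivAt_inv hs (hpos s hs).ne').deriv

theorem deriv_deriv_center_ofProfile (hs : s ∈ J) :
    deriv (deriv (ofProfile v hJ h hy hw hpos).center) s =
      !₂[l * -(2 * w s * (y s)⁻¹ ^ 3), m * -(2 * w s * (y s)⁻¹ ^ 3), 0] :=
  ((h.hasDerivAt_deriv_profileCenter hs (hpos s hs).ne').congr_of_eventuallyEq
    (Filter.eventually_of_mem (hJ.1.mem_nhds hs) fun _ =>
      deriv_center_ofProfile v hJ h hy hw hpos)).deriv

theorem deriv_deriv_radius_ofProfile (hs : s ∈ J) :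
    deriv (deriv (ofProfile v hJ h hy hw hpos).radius) s =
      2 * w s ^ 2 * (y s)⁻¹ ^ 3 - κ * (y s)⁻¹ :=
  ((h.hasDerivAt_deriv_inv hs (hpos s hs).ne').congr_of_eventuallyEq
    (Filter.eventually_of_mem (hJ.1.mem_nhds hs) fun _ =>
      deriv_radius_ofProfile v hJ h hy hw hpos)).deriv

theorem laplacian_ofProfile (hs : s ∈ J) (θ : ℝ) :
    (ofProfile v hJ h hy hw hpos).laplacian s θ = 0 := by
  have hy₀ := (hpos s hs).ne'
  have radius : (ofProfile v hJ h hy hw hpos).radius s = (y s)⁻¹ := rfl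
  rw [laplacian_of_const_frame rfl rfl hs, parallelLaplacian_of_horizontal
    (orthonormal_rot orthonormal_standard θ) (by simp [rot_apply]) (by simp [rot_apply]),
    deriv_center_ofProfile v hJ h hy hw hpos hs, deriv_radius_ofProfile v hJ h hy hw hpos hs,
    deriv_deriv_center_ofProfile v hJ h hy hw hpos hs,
    deriv_deriv_radius_ofProfile v hJ h hy hw hpos hs, rot_standard, radius]
  refine mul_eq_zero_of_right _ (mul_eq_zero_of_right _ ?_)
  have firstIntegral := h.firstIntegral s hs
  simp only [Matrix.cons_val]
  field_simp
  linear_combination w s ^ 2 * Real.sin_sq_add_cos_sq θ - firstIntegral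

theorem unitNormal_ofProfile_two_ne_zero_iff (hs : s ∈ J) (θ : ℝ) :
    unitNormal (ofProfile v hJ h hy hw hpos).X s θ 2 ≠ 0 ↔
      l * Real.cos θ + m * Real.sin θ - w s ≠ 0 := by
  have deriv_E₁ : deriv (ofProfile v hJ h hy hw hpos).E₁ s =
      deriv (ofProfile v hJ h hy hw hpos).radius s • !₂[1, 0, 0] := deriv_radius_smul hs _
  have deriv_E₂ : deriv (ofProfile v hJ h hy hw hpos).E₂ s =
      deriv (ofProfile v hJ h hy hw hpos).radius s • !₂[0, 1, 0] := deriv_radius_smul hs _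
  have normal : cross (ds (ofProfile v hJ h hy hw hpos).X s θ)
      (dθ (ofProfile v hJ h hy hw hpos).X s θ) 2 =
        (y s)⁻¹ ^ 3 * (l * Real.cos θ + m * Real.sin θ - w s) := by
    rw [ds_X hs, dθ_X, deriv_center_ofProfile v hJ h hy hw hpos hs, deriv_E₁, deriv_E₂,
      deriv_radius_ofProfile v hJ h hy hw hpos hs]
    simp only [E₁, E₂, ofProfile, cross_two, PiLp.add_apply, PiLp.neg_apply, PiLp.smul_apply,
      rot_apply, smul_eq_mul, Matrix.cons_val]
    linear_combination -(w s * (y s)⁻¹ ^ 3) * Real.sin_sq_add_cos_sq θ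
  rw [unitNormal_two_ne_zero_iff, normal, mul_ne_zero_iff,
    and_iff_right (pow_ne_zero 3 (inv_ne_zero (hpos s hs).ne'))]

theorem isAnisotropicMinimal_ofProfile (hκ : l ^ 2 + m ^ 2 = 0 → κ ≠ 0) :
    (ofProfile v hJ h hy hw hpos).IsAnisotropicMinimal := by
  refine ⟨?_, fun q ⟨hs, hν⟩ => (anisotropicMeanCurvature_eq_zero_iff hs hν).2
    (laplacian_ofProfile v hJ h hy hw hpos hs q.2)⟩
  rintro ⟨s, θ⟩ ⟨hs, -⟩
  have slope_ne_zero (hq : l ^ 2 + m ^ 2 = 0) : w s ≠ 0 := fun hw₀ => by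
    have := h.firstIntegral s hs
    rw [hw₀, hq] at this
    exact mul_ne_zero (hκ hq) (pow_ne_zero 2 (hpos s hs).ne') (by linarith)
  exact mem_closure_iff_frequently.2 (((Continuous.prodMk_right s).tendsto θ).frequently
    ((frequently_add_cos_add_sin_ne_zero slope_ne_zero θ).mono fun t ht =>
      ⟨hs, (unitNormal_ofProfile_two_ne_zero_iff v hJ h hy hw hpos hs t).2 ht⟩))

end OfProfile

end CyclicSurface

theorem isCyclicAnisotropicMinimal_profileCircles {J : Set ℝ} {κ l m : ℝ} {y w : ℝ → ℝ} (v : E3)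
    (hJ : IsOpenInterval J) (h : IsProfile Set.univ κ (l ^ 2 + m ^ 2) (fun s => s) y w)
    (hy : ContDiff ℝ ∞ y) (hw : ContDiff ℝ ∞ w) (hy₀ : ∀ s ∈ J, y s ≠ 0)
    (hκ : l ^ 2 + m ^ 2 = 0 → κ ≠ 0) :
    IsCyclicAnisotropicMinimal (profileCircles v J l m y w) := by
  wlog hpos : ∀ s ∈ J, 0 < y s generalizing y w
  · rw [← profileCircles_neg]
    exact this h.neg hy.neg hw.neg (fun s hs => neg_ne_zero.2 (hy₀ s hs)) fun s hs => neg_pos.2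
      ((hJ.forall_pos_or_forall_neg hy.continuous.continuousOn hy₀).resolve_left hpos s hs)
  exact ⟨_, CyclicSurface.isAnisotropicMinimal_ofProfile v hJ (h.mono (Set.subset_univ J))
    hy.contDiffOn hw.contDiffOn hpos hκ, CyclicSurface.carrier_ofProfile ..⟩

theorem IsLogarithmicRevolution.isCyclicAnisotropicMinimal {S : Set E3}
    (h : IsLogarithmicRevolution S) : IsCyclicAnisotropicMinimal S := by
  obtain ⟨c, hc, J, hJ, v, rfl⟩ := isLogarithmicRevolution_iff.1 h
  exact isCyclicAnisotropicMinimal_profileCircles v hJ (by simpa using IsProfile.exp c)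
    (by fun_prop) (by fun_prop) (fun s _ => Real.exp_ne_zero _) fun _ => pow_ne_zero 2 hc

theorem IsTypeI.isCyclicAnisotropicMinimal {S : Set E3} (h : IsTypeI S) :
    IsCyclicAnisotropicMinimal S := by
  obtain ⟨c, l, m, hc, hq, J, hJ, hcos, v, rfl⟩ := isTypeI_iff.1 h
  have hk : √(l ^ 2 + m ^ 2) ^ 2 = l ^ 2 + m ^ 2 := Real.sq_sqrt (by positivity)
  have hk₀ : √(l ^ 2 + m ^ 2) ≠ 0 := Real.sqrt_ne_zero'.2 (by positivity)
  exact isCyclicAnisotropicMinimal_profileCircles v hJ (hk ▸ IsProfile.cos hc _) (by fun_prop)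
    (by fun_prop) (fun s hs => mul_ne_zero (div_ne_zero hk₀ hc) (hcos s hs)) (absurd · hq)

theorem IsTypeII.isCyclicAnisotropicMinimal {S : Set E3} (h : IsTypeII S) :
    IsCyclicAnisotropicMinimal S := by
  obtain ⟨c, l, m, -, hq, J, hJ, hden, v, rfl⟩ := isTypeII_iff.1 h
  have hk : √(l ^ 2 + m ^ 2) ^ 2 = l ^ 2 + m ^ 2 := Real.sq_sqrt (by positivity)
  exact isCyclicAnisotropicMinimal_profileCircles v hJ (hk ▸ IsProfile.affine _ c) (by fun_prop)
    (by fun_prop) hden (absurd · hq)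

theorem IsTypeIII.isCyclicAnisotropicMinimal {S : Set E3} (h : IsTypeIII S) :
    IsCyclicAnisotropicMinimal S := by
  obtain ⟨c, l, m, hc, hq, J, hJ, hsinh, v, rfl⟩ := isTypeIII_iff.1 h
  have hk : √(l ^ 2 + m ^ 2) ^ 2 = l ^ 2 + m ^ 2 := Real.sq_sqrt (by positivity)
  have hk₀ : √(l ^ 2 + m ^ 2) ≠ 0 := Real.sqrt_ne_zero'.2 (by positivity)
  exact isCyclicAnisotropicMinimal_profileCircles v hJ (hk ▸ IsProfile.sinh hc _) (by fun_prop)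
    (by fun_prop) (fun s hs => mul_ne_zero (div_ne_zero hk₀ hc) (hsinh s hs)) (absurd · hq)

/-! ### Cyclic surfaces in a plane -/

theorem cross_ne_zero_of_linearIndependent {u v : E3} (h : LinearIndependent ℝ ![u, v]) :
    cross u v ≠ 0 := by
  intro h₀
  rw [LinearIndependent.pair_iff] at h
  have relation := cross_cross_right u v
  have cross_zero_right : cross v 0 = 0 := by apply E3.ext_coord <;> simp
  rw [h₀, cross_zero_right, sub_eq_add_neg, ← neg_smul] at relation
  have hv := inner_self_eq_zero.1 (h _ _ relation.symm).1
  exact one_ne_zero (h 0 1 (by rw [hv]; simp)).2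

theorem smul_cross_of_inner_eq_zero {N u v : E3} (hu : ⟪N, u⟫ = 0) (hv : ⟪N, v⟫ = 0) :
    N 2 • cross u v = cross u v 2 • N := by
  rw [inner_coord] at hu hv
  apply E3.ext_coord <;>
    simp only [PiLp.smul_apply, smul_eq_mul, cross_zero, cross_one, cross_two]
  · linear_combination u 1 * hv - v 1 * hu
  · linear_combination v 0 * hu - u 0 * hv
  · ring

theorem heightLaplacian_of_inner_eq_zero {N A B Ass Ast Ats Att : E3} (hN : N 2 ≠ 0)
    (hA : ⟪N, A⟫ = 0) (hB : ⟪N, B⟫ = 0) (hss : ⟪N, Ass⟫ = 0) (hst : ⟪N, Ast⟫ = 0)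
    (hts : ⟪N, Ats⟫ = 0) (htt : ⟪N, Att⟫ = 0) : heightLaplacian A B Ass Ast Ats Att = 0 := by
  have orthogonal {u : E3} (hu : ⟪N, u⟫ = 0) : ⟪cross A B, u⟫ = 0 := by
    have := congrArg (fun x => ⟪x, u⟫) (smul_cross_of_inner_eq_zero hA hB)
    simp only [real_inner_smul_left, hu, mul_zero] at this
    exact (mul_eq_zero.1 this).resolve_left hN
  rw [heightLaplacian, orthogonal hss, orthogonal hst, orthogonal hts, orthogonal htt]
  ring

theorem inner_eq_zero_of_hasDerivAt_of_eqOn_const {N f' : E3} {f : ℝ → E3} {s d : ℝ} {I : Set ℝ}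
    (hf : HasDerivAt f f' s) (hI : IsOpen I) (hs : s ∈ I) (h : ∀ t ∈ I, ⟪N, f t⟫ = d) :
    ⟪N, f'⟫ = 0 :=
  eq_zero_of_hasDerivAt_of_eqOn_const ((innerSL ℝ N).hasFDerivAt.comp_hasDerivAt s hf) hI hs h

namespace CyclicSurface

variable {C : CyclicSurface} {N : E3} {d s : ℝ}

theorem inner_ds_X_eq_zero (h : ∀ p ∈ C.carrier, ⟪N, p⟫ = d) (hs : s ∈ C.I) (θ : ℝ) :
    ⟪N, ds C.X s θ⟫ = 0 := by
  rw [ds_X hs]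
  exact inner_eq_zero_of_hasDerivAt_of_eqOn_const (hasDerivAt_X_s hs θ) C.interval.1 hs
    fun t ht => h _ ⟨t, ht, θ, rfl⟩

theorem inner_dθ_X_eq_zero (h : ∀ p ∈ C.carrier, ⟪N, p⟫ = d) (hs : s ∈ C.I) (θ : ℝ) :
    ⟪N, dθ C.X s θ⟫ = 0 := by
  rw [dθ_X]
  exact inner_eq_zero_of_hasDerivAt_of_eqOn_const (hasDerivAt_X_θ s θ) isOpen_univ trivial
    fun t _ => h _ ⟨s, hs, t, rfl⟩

theorem laplacian_of_plane (hN : N 2 ≠ 0) (h : ∀ p ∈ C.carrier, ⟪N, p⟫ = d) (hs : s ∈ C.I)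
    (θ : ℝ) : C.laplacian s θ = 0 := by
  have hI := C.interval.1
  have mixed := inner_eq_zero_of_hasDerivAt_of_eqOn_const (hasDerivAt_ds_θ hs θ) isOpen_univ
    trivial fun t _ => inner_ds_X_eq_zero h hs t
  exact heightLaplacian_of_inner_eq_zero hN (ds_X hs θ ▸ inner_ds_X_eq_zero h hs θ)
    (dθ_X s θ ▸ inner_dθ_X_eq_zero h hs θ)
    (inner_eq_zero_of_hasDerivAt_of_eqOn_const (hasDerivAt_ds_s hs θ) hI hs
      fun t ht => inner_ds_X_eq_zero h ht θ)
    mixed mixed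
    (inner_eq_zero_of_hasDerivAt_of_eqOn_const (hasDerivAt_dθ_θ s θ) isOpen_univ trivial
      fun t _ => inner_dθ_X_eq_zero h hs t)

theorem unitNormal_two_ne_zero_of_plane (hN : N 2 ≠ 0) (h : ∀ p ∈ C.carrier, ⟪N, p⟫ = d)
    (hs : s ∈ C.I) (θ : ℝ) : unitNormal C.X s θ 2 ≠ 0 := by
  refine unitNormal_two_ne_zero_iff.2 fun h₀ => ?_
  have parallel := smul_cross_of_inner_eq_zero (inner_ds_X_eq_zero h hs θ)
    (inner_dθ_X_eq_zero h hs θ)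
  rw [h₀, zero_smul] at parallel
  exact smul_ne_zero hN (cross_ne_zero_of_linearIndependent (C.immersion s hs θ)) parallel

theorem isAnisotropicMinimal_of_plane (hN : N 2 ≠ 0) (h : ∀ p ∈ C.carrier, ⟪N, p⟫ = d) :
    C.IsAnisotropicMinimal :=
  ⟨fun q hq => subset_closure ⟨hq.1, unitNormal_two_ne_zero_of_plane hN h hq.1 q.2⟩,
    fun q hq => (anisotropicMeanCurvature_eq_zero_iff hq.1 hq.2).2
      (laplacian_of_plane hN h hq.1 q.2)⟩

end CyclicSurface

theorem IsHorizontalPlanePiece.isCyclicAnisotropicMinimal {S : Set E3}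
    (h : IsHorizontalPlanePiece S) : IsCyclicAnisotropicMinimal S := by
  obtain ⟨⟨C, rfl⟩, z₀, plane⟩ := h
  exact ⟨C, C.isAnisotropicMinimal_of_plane (N := !₂[0, 0, 1]) (d := z₀) one_ne_zero
    fun p hp => by simp [inner_coord, plane p hp], rfl⟩

theorem IsInclinedPlanePiece.isCyclicAnisotropicMinimal {S : Set E3}
    (h : IsInclinedPlanePiece S) : IsCyclicAnisotropicMinimal S := by
  obtain ⟨⟨C, rfl⟩, A, B, z₀, -, plane⟩ := h
  exact ⟨C, C.isAnisotropicMinimal_of_plane (N := !₂[-A, -B, 1]) (d := z₀) one_ne_zero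
    fun p hp => by simp [inner_coord, plane p hp]; ring, rfl⟩

end DirichletCyclic

theorem corollary1p4 (S : Set DirichletCyclic.E3) :
    DirichletCyclic.IsCyclicAnisotropicMinimal S ↔
      (DirichletCyclic.IsHorizontalPlanePiece S ∨ DirichletCyclic.IsLogarithmicRevolution S) ∨
      (DirichletCyclic.IsTypeI S ∨ DirichletCyclic.IsTypeII S ∨ DirichletCyclic.IsTypeIII S) ∨
      DirichletCyclic.IsInclinedPlanePiece S := by
  constructor
  · rintro ⟨C, hC, rfl⟩
    exact hC.classification
  · rintro ((h | h) | (h | h | h) | h)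
    all_goals exact h.isCyclicAnisotropicMinimal
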